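/- \textbf{Setting.} Let $\mathbb{H}^1=\mathbb{R}^3$ be the first Heisenberg group with left-invariant frame $X=\partial_x+y\,\partial_t$, $Y=\partial_y-x\,\partial_t$, $T=\partial_t$, the Riemannian metric $g$ making $X,Y,T$ orthonormal (its measure $d\mathbb{H}^1$ is Lebesgue measure), horizontal distribution $\mathcal{H}=\operatorname{span}\{X,Y\}$, and $J(X)=Y$, $J(Y)=-X$, $J(T)=0$. A bounded convex set $K\subset\mathbb{R}^2$ is \emph{of class $C^2_+$} if $\partial K$ is a simple closed regular curve of class $C^2$ with strictly positive curvature. If moreover $0\in\operatorname{int}K$, let $\|\cdot\|$ be its Minkowski gauge and $\|aX+bY\|_K=\|(a,b)\|$. The $K$-perimeter of a measurable set $E$ in an open set $V$ is \[ |\partial E|_K(V)=\sup\Big\{\int_E\operatorname{div}U\,d\mathbb{H}^1:\ U \text{ horizontal, of class } C^1, \text{ with compact support in } V,\ \sup_V\|U\|_K\le 1\Big\}. \] Let $\Omega\subset\mathbb{H}^1$ be open and $f\in C^0(\Omega)$. A set $E\subset\Omega$ has \emph{prescribed $K$-mean curvature $f$} if $|\partial E|_K(V)<\infty$ for every open $V$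 whose closure is compact and contained in $\Omega$, and, for every bounded open $B$ with $\overline{B}\subset\Omega$ and every smooth vector field with compact support in $B$, with flow $(\psi_s)_{s\in\mathbb{R}}$, the function \[ s\mapsto |\partial \psi_s(E)|_K(B)-\int_{\psi_s(E)\cap B}f\,d\mathbb{H}^1 \] is finite near $s=0$ and differentiable at $s=0$ with derivative $0$. The boundary $S=\partial E\cap\Omega$ is \emph{of class $C^1$} if each $p\in S$ has a neighbourhood $U$ with a $C^1$ function $\varphi$ on $U$ such that $\varphi(p)=0$, $d\varphi_p\neq0$, $\{\varphi<0\}\subset E$ and $\{\varphi>0\}\cap E=\emptyset$. Let $N$ be the outer unit normal of $S$ with respect to $g$, $N_h$ its horizontal projection, $S_0=\{p\in S: T_pS=\mathcal{H}_p\}$ the singular set, and, on $S\smallsetminus S_0$, $\nu_h=N_h/|N_h|$ and $Z=J(\nu_h)$. A \emph{characteristic curve} in $S\smallsetminus S_0$ is a curve $\Gamma:I\to S\smallsetminus S_0$ on an open interval $I$ with $\Gamma'(s)=Z_{\Gamma(s)}$ for all $s\in I$. \textbf{Statement.} Let $K\subset\mathbb{R}^2$ be a bounded convex set of class $C^2_+$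 with $0\in\operatorname{int}K$, let $\Omega\subset\mathbb{H}^1$ be open, let $f\in C^0(\Omega)$, and let $E\subset\Omega$ be a set of prescribed $K$-mean curvature $f$ with $C^1$ boundary $S=\partial E\cap\Omega$. Then every characteristic curve in $S\smallsetminus S_0$ is of class $C^2$. -/

import Mathlib

open Set Filter Topology MeasureTheory
open scoped ContDiff ENNReal

noncomputable section

namespace SubFinsler

/-! ### The first Heisenberg group -/

/-- The first Heisenberg group `ℍ¹`, in its coordinates `(x, y, t) ∈ ℝ³`. The left-invariant
Riemannian metric `g` is the one for which the frame `X, Y, T` below is orthonormal at every point.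
This frame has determinant `1` in the coordinates, so the Riemannian measure of `g` is
Lebesgue measure, which is `volume` on `ℝ × ℝ × ℝ`. -/
abbrev Heis : Type := ℝ × ℝ × ℝ

/-- The group law `(x,y,t) * (x',y',t') = (x + x', y + y', t + t' + x' y - x y')`. -/
def heisMul (p q : Heis) : Heis :=
  (p.1 + q.1, p.2.1 + q.2.1, p.2.2 + q.2.2 + q.1 * p.2.1 - p.1 * q.2.1)

/-- The left-invariant vector field `X = ∂ₓ + y ∂ₜ`. -/
def frameX (p : Heis) : Heis := (1, 0, p.2.1)

/-- The left-invariant vector field `Y = ∂_y - x ∂ₜ`. -/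
def frameY (p : Heis) : Heis := (0, 1, -p.1)

/-- The left-invariant vector field `T = ∂ₜ`. -/
def frameT (_p : Heis) : Heis := (0, 0, 1)

/-- The fibre `ℋ_p = span {X_p, Y_p}` of the horizontal distribution. -/
def horizontalPlane (p : Heis) : Submodule ℝ Heis := Submodule.span ℝ {frameX p, frameY p}

/-- The horizontal vector field `c₁ X + c₂ Y`. -/
def horizontalField (c : Heis → ℝ × ℝ) (p : Heis) : Heis :=
  (c p).1 • frameX p + (c p).2 • frameY p

/-- The divergence of a vector field with respect to the Riemannian measure of `g`, which is
Lebesgue measure: the sum `∂ₓ W₁ + ∂_y W₂ + ∂ₜ W₃`. -/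
def divergence (W : Heis → Heis) (p : Heis) : ℝ :=
  (fderiv ℝ W p (1, 0, 0)).1 + (fderiv ℝ W p (0, 1, 0)).2.1 + (fderiv ℝ W p (0, 0, 1)).2.2

/-! ### Convex sets of class `C²₊` -/

/-- The (signed) curvature `(x' y'' - y' x'') / (x'² + y'²)^(3/2)` of a plane curve. -/
def planeCurvature (γ : ℝ → ℝ × ℝ) (s : ℝ) : ℝ :=
  ((deriv γ s).1 * (deriv (deriv γ) s).2 - (deriv γ s).2 * (deriv (deriv γ) s).1) /
    (Real.sqrt ((deriv γ s).1 ^ 2 + (deriv γ s).2 ^ 2)) ^ 3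

/-- `K ⊆ ℝ²` is a bounded convex set of class `C²₊`: its boundary is a simple closed regular curve
of class `C²` with strictly positive curvature (for the counterclockwise orientation). -/
structure IsConvexC2Plus (K : Set (ℝ × ℝ)) : Prop where
  convex : Convex ℝ K
  bounded : Bornology.IsBounded K
  boundary : ∃ (P : ℝ) (γ : ℝ → ℝ × ℝ), 0 < P ∧ ContDiff ℝ 2 γ ∧ Function.Periodic γ P ∧
    InjOn γ (Ico 0 P) ∧ range γ = frontier K ∧
    ∀ s, deriv γ s ≠ 0 ∧ 0 < planeCurvature γ s

/-! ### The sub-Finsler perimeter -/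

/-- `c₁ X + c₂ Y` is a horizontal vector field of class `C¹`, with compact support in `V`, whose
norm satisfies `‖c₁ X + c₂ Y‖_K = ‖(c₁, c₂)‖ ≤ 1`, where `‖·‖ = gauge K` is the asymmetric norm on
`ℝ²` associated with `K`. -/
structure IsTestField (K : Set (ℝ × ℝ)) (V : Set Heis) (c : Heis → ℝ × ℝ) : Prop where
  contDiff : ContDiff ℝ 1 c
  compact : HasCompactSupport c
  support : tsupport c ⊆ V
  norm_le : ∀ p ∈ V, gauge K (c p) ≤ 1

/-- The sub-Finsler `K`-perimeter `|∂E|_K(V)` of `E` in the open set `V`. (The zero field is a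
test field, so replacing negative integrals by `0` does not change the supremum.) -/
def perimeter (K : Set (ℝ × ℝ)) (E V : Set Heis) : ℝ≥0∞ :=
  ⨆ (c : Heis → ℝ × ℝ) (_ : IsTestField K V c),
    ENNReal.ofReal (∫ p in E, divergence (horizontalField c) p)

/-- `E` is a (Lebesgue measurable) set of locally finite `K`-perimeter in `Ω`. -/
def LocallyFinitePerimeter (K : Set (ℝ × ℝ)) (Ω E : Set Heis) : Prop :=
  NullMeasurableSet E ∧
    ∀ V : Set Heis, IsOpen V → IsCompact (closure V) → closure V ⊆ Ω → perimeter K E V ≠ ⊤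

/-! ### Prescribed mean curvature -/

/-- `ψ` is the flow of the vector field `W`. -/
structure IsFlow (W : Heis → Heis) (ψ : ℝ → Heis → Heis) : Prop where
  zero : ∀ p, ψ 0 p = p
  hasDerivAt : ∀ s p, HasDerivAt (fun r => ψ r p) (W (ψ s p)) s

/-- `E ⊆ Ω` has prescribed `K`-mean curvature `f` in `Ω`: it has locally finite `K`-perimeter, and
for each bounded open `B` with closure in `Ω`, it is a critical point of
`|∂E|_K(B) - ∫_{E ∩ B} f`, for variations by the flows `ψ` of smooth vector fields `W` with compact
support in `B`. The finiteness clause says that the functional takes finite values near `s = 0`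
along the variation, so that its derivative makes sense. -/
def HasPrescribedMeanCurvature (K : Set (ℝ × ℝ)) (Ω E : Set Heis) (f : Heis → ℝ) : Prop :=
  LocallyFinitePerimeter K Ω E ∧
    ∀ B : Set Heis, IsOpen B → Bornology.IsBounded B → closure B ⊆ Ω →
      ∀ W : Heis → Heis, ContDiff ℝ ∞ W → HasCompactSupport W → tsupport W ⊆ B →
        ∀ ψ : ℝ → Heis → Heis, IsFlow W ψ →
          (∀ᶠ s in 𝓝 (0 : ℝ), perimeter K (ψ s '' E) B ≠ ⊤) ∧
          HasDerivAt
            (fun s : ℝ => (perimeter K (ψ s '' E) B).toReal - ∫ p in ψ s '' E ∩ B, f p) 0 0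

/-! ### Sets with `C¹` boundary, singular set, characteristic curves -/

/-- `φ` is a `C¹` defining function of `E` near the boundary point `p`: near `p`, up to points of
the level set `{φ = 0}`, the set `E` is the sublevel set `{φ < 0}`, and `dφ_p ≠ 0`. -/
def IsDefiningFunction (E : Set Heis) (p : Heis) (φ : Heis → ℝ) : Prop :=
  φ p = 0 ∧ fderiv ℝ φ p ≠ 0 ∧
    ∃ U : Set Heis, IsOpen U ∧ p ∈ U ∧ ContDiffOn ℝ 1 φ U ∧
      ∀ q ∈ U, (φ q < 0 → q ∈ E) ∧ (0 < φ q → q ∉ E)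

/-- The boundary `S = ∂E ∩ Ω`. -/
def bdry (Ω E : Set Heis) : Set Heis := frontier E ∩ Ω

/-- The boundary `S = ∂E ∩ Ω` is of class `C¹` (with `E` lying locally on one side of it). -/
def HasC1Boundary (Ω E : Set Heis) : Prop :=
  ∀ p ∈ bdry Ω E, ∃ φ : Heis → ℝ, IsDefiningFunction E p φ

/-- The singular set `S₀`: the points `p ∈ S` where the tangent plane `T_p S = ker dφ_p` is the
horizontal plane `ℋ_p`. -/
def singularSet (Ω E : Set Heis) : Set Heis :=
  {p | p ∈ bdry Ω E ∧ ∃ φ : Heis → ℝ, IsDefiningFunction E p φ ∧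
    LinearMap.ker (fderiv ℝ φ p).toLinearMap = horizontalPlane p}

/-- The Riemannian gradient of `φ` for `g`, in components `(Xφ, Yφ, Tφ)` for the orthonormal
frame `X, Y, T`. -/
def frameGradient (φ : Heis → ℝ) (p : Heis) : ℝ × ℝ × ℝ :=
  (fderiv ℝ φ p (frameX p), fderiv ℝ φ p (frameY p), fderiv ℝ φ p (frameT p))

/-- `N` (in components for the frame `X, Y, T`) is the outer unit normal of `∂E` at `p`. It does not
depend on the choice of the defining function. -/
def IsOuterUnitNormal (E : Set Heis) (p : Heis) (N : ℝ × ℝ × ℝ) : Prop :=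
  ∃ φ : Heis → ℝ, IsDefiningFunction E p φ ∧
    N = (Real.sqrt ((frameGradient φ p).1 ^ 2 + (frameGradient φ p).2.1 ^ 2 + (frameGradient φ p).2.2 ^ 2))⁻¹ •
      frameGradient φ p

/-- The horizontal unit normal `ν_h = N_h / |N_h|`, in components for the frame `X, Y`, where `N_h`
is the horizontal projection of `N`. -/
def horizontalNormal (N : ℝ × ℝ × ℝ) : ℝ × ℝ :=
  (Real.sqrt (N.1 ^ 2 + N.2.1 ^ 2))⁻¹ • (N.1, N.2.1)

/-- The vector `Z = J(ν_h)` at `p`, where `J(X) = Y` and `J(Y) = -X`. -/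
def characteristicVector (N : ℝ × ℝ × ℝ) (p : Heis) : Heis :=
  (-(horizontalNormal N).2) • frameX p + (horizontalNormal N).1 • frameY p

/-- `Γ : I → S \ S₀` is a characteristic curve: an integral curve of the characteristic vector
field `Z = J(ν_h)` in the regular part of `S`. -/
def IsCharacteristicCurve (Ω E : Set Heis) (I : Set ℝ) (Γ : ℝ → Heis) : Prop :=
  ∀ s ∈ I, Γ s ∈ bdry Ω E \ singularSet Ω E ∧
    ∃ N : ℝ × ℝ × ℝ, IsOuterUnitNormal E (Γ s) N ∧
      HasDerivAt Γ (characteristicVector N (Γ s)) s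

end SubFinsler

end

open SubFinsler

/-! The claim is local, and near a regular point it reduces to a first-order equation for a scalar
`w` along characteristics. At such a point some unit horizontal direction `aX + bY` is transversal
to `S`. In coordinates `((z, τ), u)` with `aX + bY = ∂_u` and `-bX + aY = ∂_z - 2u ∂_τ`, the set is
a subgraph `u < g(z, τ)` with `g` of class C¹. The horizontal normal is a positive multiple of `e -
w e'`, where `e = (a, b)`, `e' = (-b, a)` and `w = g_z - 2 g g_τ` (`charSlope`). The characteristic
field is `(1 + w²)^(-1/2) ((1, -2g), w)`, so it suffices that the merely continuous function `w` is
C¹ along each characteristic.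

Let `H(w)` be the support function of `K` at `e - w e'` (`slopeSupport`). By the divergence theorem
the `K`-perimeter over a base `D` is `∫_D H(w)` (`perimeter_subgraph_eq`). Moving `g` to `g + s v`
by a flow along `∂_u` and differentiating gives (`weak_equation`) `∫ H'(w) (v_z - 2g v_τ - 2 g_τ v)
= ∫ f v`.

Test functions are now concentrated on tubes of width `ε` around a characteristic `τ' = -2g(z, τ)`.
As `ε → 0`, the transversal part of the transport term and the zeroth-order term combine into `-2
g_τ (r ρ'(r) + ρ(r))`, where `r` is the rescaled transversal variable and `ρ` the tube profile; its
integral in `r` is zero. What remains is the weak equation `(H'(w))' = -f` on the curve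
(`integral_characteristic`), and the du Bois-Reymond lemma makes `H'(w)` of class C¹ there
(`hasDerivAt_of_weak`).

Finally, positive curvature of `∂K` makes `H'` a C¹ function with nonvanishing derivative
(`slopeSupport_regularity`). Inverting it locally shows that `w` is C¹ along the curve, hence the
velocity is C¹ and the curve is C². -/

namespace SubFinsler

/-! ### The divergence theorem on subgraphs -/

/-- The slope `∂_z h - 2 h ∂_τ h` of the graph of `h` along its characteristic direction. -/
noncomputable def charSlope (h : ℝ × ℝ → ℝ) (q : ℝ × ℝ) : ℝ := fderiv ℝ h q (1, -2 * h q)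

theorem continuous_charSlope {h : ℝ × ℝ → ℝ} (hh : ContDiff ℝ 1 h) : Continuous (charSlope h) := by
  have h1 := hh.continuous_fderiv one_ne_zero
  have h2 := hh.continuous
  unfold charSlope
  fun_prop

theorem charSlope_eq (h : ℝ × ℝ → ℝ) (q : ℝ × ℝ) :
    charSlope h q = fderiv ℝ h q (1, 0) - 2 * h q * fderiv ℝ h q (0, 1) := by
  have : ((1, -2 * h q) : ℝ × ℝ) = (1, 0) + (-2 * h q) • (0, 1) := by simp
  rw [charSlope, this, map_add, map_smul, smul_eq_mul]
  ring

/-- Integration by parts against the constant `1`. -/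
theorem integral_fderiv_apply_eq_zero {E : Type*} [NormedAddCommGroup E] [NormedSpace ℝ E]
    [FiniteDimensional ℝ E] [MeasurableSpace E] [BorelSpace E] (μ : Measure E)
    [μ.IsAddHaarMeasure] {F : E → ℝ} (hF : ContDiff ℝ 1 F) (hc : HasCompactSupport F) (v : E) :
    ∫ x, fderiv ℝ F x v ∂μ = 0 := by
  have hi : Integrable (fun x => fderiv ℝ F x v) μ := by
    apply Continuous.integrable_of_hasCompactSupport
    · have := hF.continuous_fderiv one_ne_zero
      fun_prop
    · exact hc.fderiv_apply ℝ v
  have := integral_mul_fderiv_eq_neg_fderiv_mul_of_integrable (μ := μ) (f := fun _ : E => (1 : ℝ))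
    (g := F) (v := v) (by simp) (by simpa using hi)
    (by simpa using hF.continuous.integrable_of_hasCompactSupport hc)
    (fun _ _ => differentiableAt_const _) (fun _ _ => hF.differentiable one_ne_zero _)
  simpa using this

/-- The shear that flattens the graph of `h`. -/
def graphShear (h : ℝ × ℝ → ℝ) (p : (ℝ × ℝ) × ℝ) : (ℝ × ℝ) × ℝ := (p.1, h p.1 + p.2)

theorem contDiff_graphShear {n : WithTop ℕ∞} {h : ℝ × ℝ → ℝ} (hh : ContDiff ℝ n h) :
    ContDiff ℝ n (graphShear h) := by
  unfold graphShear
  fun_prop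

/-- `graphShear` as a homeomorphism. -/
def graphShearHomeo (h : ℝ × ℝ → ℝ) (hh : Continuous h) : ((ℝ × ℝ) × ℝ) ≃ₜ ((ℝ × ℝ) × ℝ) where
  toFun := graphShear h
  invFun p := (p.1, p.2 - h p.1)
  left_inv p := by simp [graphShear]
  right_inv p := by simp [graphShear]
  continuous_toFun := by unfold graphShear; fun_prop
  continuous_invFun := by fun_prop

theorem measurePreserving_graphShear {h : ℝ × ℝ → ℝ} (hh : Continuous h) :
    MeasurePreserving (graphShear h) := by
  unfold graphShear
  refine MeasurePreserving.skew_product (μa := volume) (μc := volume) (f := id)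
    (g := fun q r => h q + r) (MeasurePreserving.id _) ?_ ?_
  · have : Continuous (Function.uncurry fun (q : ℝ × ℝ) (r : ℝ) => h q + r) := by
      unfold Function.uncurry; fun_prop
    exact this.measurable
  · exact Eventually.of_forall fun q => (measurePreserving_add_left volume (h q)).map_eq

theorem HasCompactSupport.slice {α : (ℝ × ℝ) × ℝ → ℝ} (hαc : HasCompactSupport α) (q : ℝ × ℝ) :
    HasCompactSupport fun r => α (q, r) := by
  refine hαc.comp_isClosedEmbedding (g := fun r : ℝ => (q, r)) ?_
  exact (Isometry.of_dist_eq fun x y => by simp [Prod.dist_eq]).isClosedEmbedding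

theorem HasCompactSupport.slice_left {α : (ℝ × ℝ) × ℝ → ℝ} (hαc : HasCompactSupport α) (r : ℝ) :
    HasCompactSupport fun q => α (q, r) := by
  refine hαc.comp_isClosedEmbedding (g := fun q : ℝ × ℝ => (q, r)) ?_
  exact (Isometry.of_dist_eq fun x y => by simp [Prod.dist_eq]).isClosedEmbedding

theorem fderiv_slice_left {α : (ℝ × ℝ) × ℝ → ℝ} (hα : Differentiable ℝ α) (q v : ℝ × ℝ) (r : ℝ) :
    fderiv ℝ (fun q => α (q, r)) q v = fderiv ℝ α (q, r) (v, 0) := by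
  have h1 : HasFDerivAt (fun q : ℝ × ℝ => (q, r)) (ContinuousLinearMap.inl ℝ (ℝ × ℝ) ℝ) q :=
    hasFDerivAt_prodMk_left q r
  have := (hα (q, r)).hasFDerivAt.comp q h1
  rw [show (fun q => α (q, r)) = α ∘ (fun q : ℝ × ℝ => (q, r)) from rfl, this.fderiv]
  simp

/-- By Fubini: `s` restricts only the last variable, and on each full slice the derivative of a
compactly supported function integrates to zero. -/
theorem setIntegral_fderiv_left_eq_zero {α : (ℝ × ℝ) × ℝ → ℝ} (hα : ContDiff ℝ 1 α)
    (hαc : HasCompactSupport α) (v : ℝ × ℝ) (s : Set ℝ) :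
    ∫ p in univ ×ˢ s, fderiv ℝ α p (v, 0) = 0 := by
  have hi : Integrable (fun p => fderiv ℝ α p (v, 0)) := by
    apply Continuous.integrable_of_hasCompactSupport
    · have := hα.continuous_fderiv one_ne_zero
      fun_prop
    · exact hαc.fderiv_apply ℝ _
  rw [Measure.volume_eq_prod, ← Measure.prod_restrict, integral_prod_symm]
  · simp_rw [Measure.restrict_univ, ← fderiv_slice_left (hα.differentiable one_ne_zero)]
    have : ∀ r : ℝ, ∫ q, fderiv ℝ (fun q => α (q, r)) q v = 0 := fun r => by
      refine integral_fderiv_apply_eq_zero volume ?_ (HasCompactSupport.slice_left hαc r) v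
      fun_prop
    simp [this]
  · rw [Measure.prod_restrict, ← Measure.volume_eq_prod]
    exact hi.integrableOn

/-- The divergence theorem, in adapted coordinates, for the subgraph of a `C¹` function. -/
theorem setIntegral_subgraph_divergence {α β : (ℝ × ℝ) × ℝ → ℝ} (hα : ContDiff ℝ 1 α)
    (hαc : HasCompactSupport α) (hβ : ContDiff ℝ 1 β) (hβc : HasCompactSupport β)
    {h : ℝ × ℝ → ℝ} (hh : ContDiff ℝ 1 h) :
    ∫ p in {p : (ℝ × ℝ) × ℝ | p.2 < h p.1},
      (fderiv ℝ α p ((1, -2 * p.2), 0) + fderiv ℝ β p (0, 1)) =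
    ∫ q, (β (q, h q) - α (q, h q) * charSlope h q) := by
  set S := graphShear h with hS
  have hSd : ContDiff ℝ 1 S := contDiff_graphShear hh
  have hemb : MeasurableEmbedding S :=
    (graphShearHomeo h hh.continuous).measurableEmbedding
  have hpre : S ⁻¹' {p : (ℝ × ℝ) × ℝ | p.2 < h p.1} = univ ×ˢ Iio 0 := by
    ext p; simp [hS, graphShear]
  rw [← (measurePreserving_graphShear hh.continuous).setIntegral_preimage_emb hemb, hpre]
  set α' := fun p => α (S p) with hα'
  set β' := fun p => β (S p) with hβ'
  have hα'd : ContDiff ℝ 1 α' := hα.comp hSd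
  have hβ'd : ContDiff ℝ 1 β' := hβ.comp hSd
  have hα'c : HasCompactSupport α' := hαc.comp_homeomorph (graphShearHomeo h hh.continuous)
  have hβ'c : HasCompactSupport β' := hβc.comp_homeomorph (graphShearHomeo h hh.continuous)
  -- After the shear the region is `{r < 0}`. Writing `α_z - 2u α_τ` in the sheared variables, the
  -- tangential derivatives can all be put on `α'` and `κ = (h + r) α'`, where they integrate to
  -- zero; the rest is exactly `∂_r b`. Only `r`-derivatives of `b` occur, so no second derivative
  -- of `h` is needed although `b` contains `fderiv ℝ h`.
  set κ := fun p : (ℝ × ℝ) × ℝ => (h p.1 + p.2) * α' p with hκ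
  have hκd : ContDiff ℝ 1 κ := by rw [hκ]; fun_prop
  have hκc : HasCompactSupport κ := hα'c.mul_left
  set b := fun p : (ℝ × ℝ) × ℝ => β' p - fderiv ℝ h p.1 (1, 0) * α' p
      + 2 * fderiv ℝ h p.1 (0, 1) * κ p with hb
  have hbq : ∀ q, ContDiff ℝ 1 fun r => b (q, r) := fun q => by
    simp only [hb]; fun_prop
  have hbc : HasCompactSupport b := by
    exact (hβ'c.sub hα'c.mul_left).add hκc.mul_left
  have hSf : ∀ p, HasFDerivAt S ((ContinuousLinearMap.fst ℝ (ℝ × ℝ) ℝ).prod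
      ((fderiv ℝ h p.1).comp (ContinuousLinearMap.fst ℝ (ℝ × ℝ) ℝ) +
        ContinuousLinearMap.snd ℝ (ℝ × ℝ) ℝ)) p := fun p => by
    have h1 : HasFDerivAt (fun p : (ℝ × ℝ) × ℝ => p.1) (ContinuousLinearMap.fst ℝ (ℝ × ℝ) ℝ) p :=
      hasFDerivAt_fst
    have h2 := ((hh.differentiable one_ne_zero) p.1).hasFDerivAt.comp p h1
    exact h1.prodMk (h2.add hasFDerivAt_snd)
  have key : ∀ p : (ℝ × ℝ) × ℝ,
      fderiv ℝ α (S p) ((1, -2 * (S p).2), 0) + fderiv ℝ β (S p) (0, 1) =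
      (fderiv ℝ α' p ((1, 0), 0) - 2 * fderiv ℝ κ p ((0, 1), 0)) + deriv (fun r => b (p.1, r)) p.2 := by
    rintro ⟨q, r⟩
    have e1 : ∀ v, fderiv ℝ α' (q, r) v = fderiv ℝ α (S (q, r)) (v.1, fderiv ℝ h q v.1 + v.2) := by
      intro v
      have := ((hα.differentiable one_ne_zero) (S (q, r))).hasFDerivAt.comp _ (hSf (q, r))
      rw [show α' = α ∘ S from rfl, this.fderiv]; simp
    have e2 : ∀ v, fderiv ℝ κ (q, r) v = (h q + r) * fderiv ℝ α' (q, r) v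
        + (fderiv ℝ h q v.1 + v.2) * α' (q, r) := by
      intro v
      have h1 : HasFDerivAt (fun p : (ℝ × ℝ) × ℝ => h p.1 + p.2) _ (q, r) :=
        (((hh.differentiable one_ne_zero) q).hasFDerivAt.comp (q, r) hasFDerivAt_fst).add
          hasFDerivAt_snd
      have := h1.fun_mul ((hα'd.differentiable one_ne_zero) (q, r)).hasFDerivAt
      rw [hκ, this.fderiv]; simp; ring
    have ins : HasDerivAt (fun r : ℝ => (q, r)) ((0 : ℝ × ℝ), (1 : ℝ)) r :=
      (hasDerivAt_const r q).prodMk (hasDerivAt_id r)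
    have e3 : deriv (fun r => b (q, r)) r = fderiv ℝ β (S (q, r)) (0, 1)
        - fderiv ℝ h q (1, 0) * fderiv ℝ α (S (q, r)) (0, 1)
        + 2 * fderiv ℝ h q (0, 1) * ((h q + r) * fderiv ℝ α (S (q, r)) (0, 1) + α' (q, r)) := by
      have d1 : HasDerivAt (fun r => α' (q, r)) (fderiv ℝ α (S (q, r)) (0, 1)) r := by
        have := ((hα'd.differentiable one_ne_zero) (q, r)).hasFDerivAt.comp_hasDerivAt r ins
        rw [e1] at this; exact this.congr_deriv (by simp)
      have d2 : HasDerivAt (fun r => β' (q, r)) (fderiv ℝ β (S (q, r)) (0, 1)) r := by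
        have h3 := ((hβ.differentiable one_ne_zero) (S (q, r))).hasFDerivAt.comp _ (hSf (q, r))
        have := h3.comp_hasDerivAt r ins
        exact this.congr_deriv (by simp)
      have d3 : HasDerivAt (fun r => κ (q, r))
          ((h q + r) * fderiv ℝ α (S (q, r)) (0, 1) + α' (q, r)) r := by
        have := ((hasDerivAt_id r).const_add (h q)).mul d1
        simp only [hκ]
        refine this.congr_deriv ?_
        simp; ring
      exact ((d2.fun_sub (d1.const_mul (fderiv ℝ h q (1, 0)))).fun_add
        (d3.const_mul (2 * fderiv ℝ h q (0, 1)))).deriv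
    simp only [e3, e2, e1]
    have s1 : (((1 : ℝ), -2 * (S (q, r)).2), (0 : ℝ)) = (((1 : ℝ), (0 : ℝ)), (0 : ℝ))
        + (-2 * (h q + r)) • (((0 : ℝ), (1 : ℝ)), (0 : ℝ)) := by
      simp [hS, graphShear]
    have s2 : ∀ v : ℝ × ℝ, ∀ c : ℝ, fderiv ℝ α (S (q, r)) (v, c)
        = fderiv ℝ α (S (q, r)) (v, 0) + c * fderiv ℝ α (S (q, r)) (0, 1) := by
      intro v c
      have : (v, c) = (v, (0 : ℝ)) + c • ((0 : ℝ × ℝ), (1 : ℝ)) := by simp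
      rw [this, map_add, map_smul, smul_eq_mul]
    rw [s1, map_add, map_smul, smul_eq_mul, s2 (1, 0) (_ + _), s2 (0, 1) (_ + _)]
    ring
  rw [integral_congr_ae (Eventually.of_forall key)]
  have iA1 : Integrable (fun p => fderiv ℝ α' p ((1, 0), 0)) := by
    apply Continuous.integrable_of_hasCompactSupport
    · have := hα'd.continuous_fderiv one_ne_zero
      fun_prop
    · exact hα'c.fderiv_apply ℝ _
  have iA2 : Integrable (fun p => 2 * fderiv ℝ κ p ((0, 1), 0)) := by
    apply Integrable.const_mul
    apply Continuous.integrable_of_hasCompactSupport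
    · have := hκd.continuous_fderiv one_ne_zero
      fun_prop
    · exact hκc.fderiv_apply ℝ _
  have iL : Integrable (fun p => fderiv ℝ α (S p) ((1, -2 * (S p).2), 0)
      + fderiv ℝ β (S p) (0, 1)) := by
    apply Continuous.integrable_of_hasCompactSupport
    · have := hα.continuous_fderiv one_ne_zero
      have := hβ.continuous_fderiv one_ne_zero
      have := hSd.continuous
      fun_prop
    · have c1 : HasCompactSupport (fun p => fderiv ℝ α p ((1, -2 * p.2), 0)
          + fderiv ℝ β p (0, 1)) := by
        refine HasCompactSupport.add ?_ (hβc.fderiv_apply ℝ _)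
        refine (hαc.fderiv ℝ).mono fun p hp => ?_
        simp only [Function.mem_support, ne_eq] at hp ⊢
        exact fun h0 => hp (by simp [h0])
      exact c1.comp_homeomorph (graphShearHomeo h hh.continuous)
  have iB : Integrable (fun p : (ℝ × ℝ) × ℝ => deriv (fun r => b (p.1, r)) p.2) := by
    have := (iL.sub iA1).add iA2
    refine this.congr (Eventually.of_forall fun p => ?_)
    simp only [Pi.add_apply, Pi.sub_apply]
    rw [key p]; ring
  rw [integral_add (f := fun p => fderiv ℝ α' p ((1, 0), 0) - 2 * fderiv ℝ κ p ((0, 1), 0))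
      (iA1.integrableOn.sub iA2.integrableOn) iB.integrableOn,
    integral_sub iA1.integrableOn iA2.integrableOn, integral_const_mul,
    setIntegral_fderiv_left_eq_zero hα'd hα'c, setIntegral_fderiv_left_eq_zero hκd hκc]
  simp only [mul_zero, sub_zero, zero_add]
  rw [Measure.volume_eq_prod, setIntegral_prod _ (by
    rw [← Measure.volume_eq_prod]; exact iB.integrableOn), Measure.restrict_univ]
  refine integral_congr_ae (Eventually.of_forall fun q => ?_)
  simp only
  rw [← integral_Iic_eq_integral_Iio,
    HasCompactSupport.integral_Iic_deriv_eq (hbq q) (HasCompactSupport.slice hbc q)]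
  simp only [hb, hα', hβ', hκ, hS, graphShear, charSlope_eq]
  simp only [add_zero]
  ring

/-! ### Coordinates adapted to a horizontal direction -/

/-- Coordinates `((z, τ), u)` adapted to the horizontal direction `V = aX + bY`, where
`a² + b² = 1`: here `V = ∂_u` and `-bX + aY = ∂_z - 2u ∂_τ`. -/
def chart (a b : ℝ) (p : (ℝ × ℝ) × ℝ) : Heis :=
  (-b * p.1.1 + a * p.2, a * p.1.1 + b * p.2, p.1.2 + p.1.1 * p.2)

/-- The inverse of `chart`. -/
def chartInv (a b : ℝ) (p : Heis) : (ℝ × ℝ) × ℝ :=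
  ((-b * p.1 + a * p.2.1, p.2.2 - (-b * p.1 + a * p.2.1) * (a * p.1 + b * p.2.1)),
    a * p.1 + b * p.2.1)

theorem contDiff_chart (a b : ℝ) {n : WithTop ℕ∞} : ContDiff ℝ n (chart a b) := by
  unfold chart
  fun_prop

theorem contDiff_chartInv (a b : ℝ) {n : WithTop ℕ∞} : ContDiff ℝ n (chartInv a b) := by
  unfold chartInv
  fun_prop

theorem chartInv_chart {a b : ℝ} (hab : a ^ 2 + b ^ 2 = 1) (p : (ℝ × ℝ) × ℝ) :
    chartInv a b (chart a b p) = p := by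
  obtain ⟨⟨z, t⟩, u⟩ := p
  have h1 : -b * (-b * z + a * u) + a * (a * z + b * u) = z := by linear_combination z * hab
  have h2 : a * (-b * z + a * u) + b * (a * z + b * u) = u := by linear_combination u * hab
  simp only [chart, chartInv, h1, h2]
  simp

theorem chart_chartInv {a b : ℝ} (hab : a ^ 2 + b ^ 2 = 1) (p : Heis) :
    chart a b (chartInv a b p) = p := by
  obtain ⟨x, y, t⟩ := p
  have h1 : -b * (-b * x + a * y) + a * (a * x + b * y) = x := by linear_combination x * hab
  have h2 : a * (-b * x + a * y) + b * (a * x + b * y) = y := by linear_combination y * hab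
  simp only [chart, chartInv, h1, h2]
  simp

/-- `chart` as a homeomorphism. -/
def chartHomeo {a b : ℝ} (hab : a ^ 2 + b ^ 2 = 1) : ((ℝ × ℝ) × ℝ) ≃ₜ Heis where
  toFun := chart a b
  invFun := chartInv a b
  left_inv := chartInv_chart hab
  right_inv := chart_chartInv hab
  continuous_toFun := (contDiff_chart a b (n := 0)).continuous
  continuous_invFun := (contDiff_chartInv a b (n := 0)).continuous

theorem measurePreserving_planeReflection {a b : ℝ} (hab : a ^ 2 + b ^ 2 = 1) :
    MeasurePreserving (fun p : ℝ × ℝ => (-b * p.1 + a * p.2, a * p.1 + b * p.2)) := by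
  set f := Matrix.toLin (Module.Basis.finTwoProd ℝ) (Module.Basis.finTwoProd ℝ) !![-b, a; a, b]
  have hf : ⇑f = fun p : ℝ × ℝ => (-b * p.1 + a * p.2, a * p.1 + b * p.2) := by
    ext p <;> simp [f, Matrix.toLin_finTwoProd_apply]
  have hdet : LinearMap.det f = -1 := by
    rw [LinearMap.det_toLin, Matrix.det_fin_two_of]
    linear_combination -hab
  rw [← hf]
  refine ⟨f.continuous_of_finiteDimensional.measurable, ?_⟩
  rw [Measure.map_linearMap_addHaar_eq_smul_addHaar _ (by rw [hdet]; norm_num), hdet]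
  norm_num

/-- The chart factors into coordinate permutations, a plane map of determinant `-1`, and a
translation of the last coordinate by an amount depending on the first two. -/
theorem measurePreserving_chart {a b : ℝ} (hab : a ^ 2 + b ^ 2 = 1) :
    MeasurePreserving (chart a b) := by
  have m1 : MeasurePreserving (fun p : (ℝ × ℝ) × ℝ => (p.1.1, p.1.2, p.2)) :=
    volume_preserving_prodAssoc
  have m2 : MeasurePreserving (fun p : ℝ × ℝ × ℝ => (p.1, p.2.2, p.2.1)) :=
    (MeasurePreserving.id volume).prod (Measure.measurePreserving_swap)
  have m3 : MeasurePreserving (fun p : ℝ × ℝ × ℝ => ((p.1, p.2.1), p.2.2)) :=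
    volume_preserving_prodAssoc.symm
  have m4 : MeasurePreserving (fun p : (ℝ × ℝ) × ℝ =>
      ((-b * p.1.1 + a * p.1.2, a * p.1.1 + b * p.1.2), p.2 + p.1.1 * p.1.2)) := by
    refine MeasurePreserving.skew_product (μa := volume) (μc := volume)
      (f := fun p : ℝ × ℝ => (-b * p.1 + a * p.2, a * p.1 + b * p.2))
      (g := fun q r => r + q.1 * q.2) (measurePreserving_planeReflection hab) ?_ ?_
    · have : Continuous (Function.uncurry fun (q : ℝ × ℝ) (r : ℝ) => r + q.1 * q.2) := by
        unfold Function.uncurry; fun_prop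
      exact this.measurable
    · exact Eventually.of_forall fun q =>
        (measurePreserving_add_right volume (q.1 * q.2)).map_eq
  exact ((m1.comp m4).comp m3).comp (m2.comp m1)

/-- The derivative of `chart`. -/
noncomputable def chartDeriv (a b : ℝ) (p : (ℝ × ℝ) × ℝ) : ((ℝ × ℝ) × ℝ) →L[ℝ] Heis :=
  let z := (ContinuousLinearMap.fst ℝ ℝ ℝ).comp (ContinuousLinearMap.fst ℝ (ℝ × ℝ) ℝ)
  let t := (ContinuousLinearMap.snd ℝ ℝ ℝ).comp (ContinuousLinearMap.fst ℝ (ℝ × ℝ) ℝ)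
  let u := ContinuousLinearMap.snd ℝ (ℝ × ℝ) ℝ
  ((-b) • z + a • u).prod ((a • z + b • u).prod (t + (p.1.1 • u + p.2 • z)))

theorem hasFDerivAt_chart (a b : ℝ) (p : (ℝ × ℝ) × ℝ) :
    HasFDerivAt (chart a b) (chartDeriv a b p) p := by
  have hz : HasFDerivAt (fun p : (ℝ × ℝ) × ℝ => p.1.1)
      ((ContinuousLinearMap.fst ℝ ℝ ℝ).comp (ContinuousLinearMap.fst ℝ (ℝ × ℝ) ℝ)) p :=
    hasFDerivAt_fst.comp p hasFDerivAt_fst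
  have ht : HasFDerivAt (fun p : (ℝ × ℝ) × ℝ => p.1.2)
      ((ContinuousLinearMap.snd ℝ ℝ ℝ).comp (ContinuousLinearMap.fst ℝ (ℝ × ℝ) ℝ)) p :=
    hasFDerivAt_snd.comp p hasFDerivAt_fst
  have hu : HasFDerivAt (fun p : (ℝ × ℝ) × ℝ => p.2) (ContinuousLinearMap.snd ℝ (ℝ × ℝ) ℝ) p :=
    hasFDerivAt_snd
  exact ((hz.const_mul (-b)).add (hu.const_mul a)).prodMk
    (((hz.const_mul a).add (hu.const_mul b)).prodMk (ht.add (hz.mul hu)))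

theorem chartDeriv_apply (a b : ℝ) (p v : (ℝ × ℝ) × ℝ) :
    chartDeriv a b p v = (-b * v.1.1 + a * v.2, a * v.1.1 + b * v.2,
      v.1.2 + (p.1.1 * v.2 + p.2 * v.1.1)) := by
  simp [chartDeriv]

theorem chartDeriv_transversal {a b : ℝ} (hab : a ^ 2 + b ^ 2 = 1) (p : (ℝ × ℝ) × ℝ) :
    chartDeriv a b p (0, 1) = a • frameX (chart a b p) + b • frameY (chart a b p) := by
  obtain ⟨⟨z, t⟩, u⟩ := p
  simp only [chartDeriv_apply, frameX, frameY, chart, Prod.smul_mk, Prod.mk_add_mk, smul_eq_mul,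
    Prod.mk.injEq]
  refine ⟨by simp, by simp, ?_⟩
  simp only [Prod.fst_zero, Prod.snd_zero]
  linear_combination -z * hab

theorem chartDeriv_characteristic {a b : ℝ} (hab : a ^ 2 + b ^ 2 = 1) (p : (ℝ × ℝ) × ℝ) :
    chartDeriv a b p ((1, -2 * p.2), 0) =
      (-b) • frameX (chart a b p) + a • frameY (chart a b p) := by
  obtain ⟨⟨z, t⟩, u⟩ := p
  simp only [chartDeriv_apply, frameX, frameY, chart, Prod.smul_mk, Prod.mk_add_mk, smul_eq_mul,
    Prod.mk.injEq]
  refine ⟨by simp, by simp, ?_⟩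
  linear_combination u * hab

/-- `X` and `Y` are divergence free, so only derivatives of the coefficients survive. -/
theorem divergence_horizontalField {c : Heis → ℝ × ℝ} {p : Heis} (hc : DifferentiableAt ℝ c p) :
    divergence (horizontalField c) p =
      (fderiv ℝ c p (frameX p)).1 + (fderiv ℝ c p (frameY p)).2 := by
  have hL := hc.hasFDerivAt
  set L := fderiv ℝ c p
  have h1 : HasFDerivAt (fun p => (c p).1) ((ContinuousLinearMap.fst ℝ ℝ ℝ).comp L) p :=
    hasFDerivAt_fst.comp p hL
  have h2 : HasFDerivAt (fun p => (c p).2) ((ContinuousLinearMap.snd ℝ ℝ ℝ).comp L) p :=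
    hasFDerivAt_snd.comp p hL
  have hx : HasFDerivAt (fun p : Heis => p.1) (ContinuousLinearMap.fst ℝ ℝ (ℝ × ℝ)) p :=
    hasFDerivAt_fst
  have hy : HasFDerivAt (fun p : Heis => p.2.1) ((ContinuousLinearMap.fst ℝ ℝ ℝ).comp
      (ContinuousLinearMap.snd ℝ ℝ (ℝ × ℝ))) p :=
    hasFDerivAt_fst.comp p hasFDerivAt_snd
  have hW : horizontalField c = fun p => ((c p).1, (c p).2, (c p).1 * p.2.1 - (c p).2 * p.1) := by
    ext p <;> simp [horizontalField, frameX, frameY]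
    ring
  have := h1.prodMk (h2.prodMk ((h1.fun_mul hy).fun_sub (h2.fun_mul hx)))
  have e : frameX p = (1, 0, 0) + p.2.1 • (0, 0, 1) := by simp [frameX]
  have e' : frameY p = (0, 1, 0) + (-p.1) • (0, 0, 1) := by simp [frameY]
  rw [divergence, hW, this.fderiv, e, e', map_add, map_add, map_smul, map_smul]
  simp
  ring

/-- The component along `-bX + aY` of the horizontal field `c₁ X + c₂ Y`, in
adapted coordinates. -/
def charComponent (a b : ℝ) (c : Heis → ℝ × ℝ) (p : (ℝ × ℝ) × ℝ) : ℝ :=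
  -b * (c (chart a b p)).1 + a * (c (chart a b p)).2

/-- The transversal component of a horizontal field, in adapted coordinates. -/
def transComponent (a b : ℝ) (c : Heis → ℝ × ℝ) (p : (ℝ × ℝ) × ℝ) : ℝ :=
  a * (c (chart a b p)).1 + b * (c (chart a b p)).2

/-- The expression `X c₁ + Y c₂` is a trace, unchanged when frame and components are transformed by
the same orthogonal matrix. -/
theorem divergence_horizontalField_chart {a b : ℝ} (hab : a ^ 2 + b ^ 2 = 1) {c : Heis → ℝ × ℝ}
    (hc : Differentiable ℝ c) (p : (ℝ × ℝ) × ℝ) :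
    divergence (horizontalField c) (chart a b p) =
      fderiv ℝ (charComponent a b c) p ((1, -2 * p.2), 0) +
      fderiv ℝ (transComponent a b c) p (0, 1) := by
  have hL := (hc (chart a b p)).hasFDerivAt.comp p (hasFDerivAt_chart a b p)
  rw [divergence_horizontalField (hc _)]
  set L := fderiv ℝ c (chart a b p)
  have h1 : HasFDerivAt (fun p => (c (chart a b p)).1) ((ContinuousLinearMap.fst ℝ ℝ ℝ).comp
      (L.comp (chartDeriv a b p))) p := hasFDerivAt_fst.comp p hL
  have h2 : HasFDerivAt (fun p => (c (chart a b p)).2) ((ContinuousLinearMap.snd ℝ ℝ ℝ).comp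
      (L.comp (chartDeriv a b p))) p := hasFDerivAt_snd.comp p hL
  have e1 : HasFDerivAt (charComponent a b c) _ p := (h1.const_mul (-b)).add (h2.const_mul a)
  have e2 : HasFDerivAt (transComponent a b c) _ p := (h1.const_mul a).add (h2.const_mul b)
  rw [e1.fderiv, e2.fderiv]
  simp only [add_apply, smul_apply, ContinuousLinearMap.comp_apply, chartDeriv_characteristic hab,
    chartDeriv_transversal hab, map_add, map_smul, smul_eq_mul,
    ContinuousLinearMap.coe_fst', ContinuousLinearMap.coe_snd']
  linear_combination (-((L (frameX (chart a b p))).1 + (L (frameY (chart a b p))).2)) * hab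

theorem contDiff_charComponent {a b : ℝ} {c : Heis → ℝ × ℝ} {n : WithTop ℕ∞}
    (hc : ContDiff ℝ n c) : ContDiff ℝ n (charComponent a b c) := by
  have : ContDiff ℝ n fun p => c (chart a b p) := hc.comp (contDiff_chart a b)
  unfold charComponent
  exact (contDiff_const.mul this.fst).add (contDiff_const.mul this.snd)

theorem contDiff_transComponent {a b : ℝ} {c : Heis → ℝ × ℝ} {n : WithTop ℕ∞}
    (hc : ContDiff ℝ n c) : ContDiff ℝ n (transComponent a b c) := by
  have : ContDiff ℝ n fun p => c (chart a b p) := hc.comp (contDiff_chart a b)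
  unfold transComponent
  exact (contDiff_const.mul this.fst).add (contDiff_const.mul this.snd)

theorem HasCompactSupport.charComponent {a b : ℝ} (hab : a ^ 2 + b ^ 2 = 1) {c : Heis → ℝ × ℝ}
    (hc : HasCompactSupport c) : HasCompactSupport (charComponent a b c) := by
  have h := hc.comp_homeomorph (chartHomeo hab)
  exact h.comp_left (g := fun k : ℝ × ℝ => -b * k.1 + a * k.2) (by simp)

theorem HasCompactSupport.transComponent {a b : ℝ} (hab : a ^ 2 + b ^ 2 = 1) {c : Heis → ℝ × ℝ}
    (hc : HasCompactSupport c) : HasCompactSupport (transComponent a b c) := by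
  have h := hc.comp_homeomorph (chartHomeo hab)
  exact h.comp_left (g := fun k : ℝ × ℝ => a * k.1 + b * k.2) (by simp)

/-! ### Sets that are subgraphs inside a cylinder of the chart. -/

/-- The open cylinder `D × J` in adapted coordinates. -/
def cylinder (a b : ℝ) (D : Set (ℝ × ℝ)) (J : Set ℝ) : Set Heis := chartInv a b ⁻¹' (D ×ˢ J)

theorem isOpen_cylinder (a b : ℝ) {D : Set (ℝ × ℝ)} {J : Set ℝ} (hD : IsOpen D) (hJ : IsOpen J) :
    IsOpen (cylinder a b D J) :=
  (hD.prod hJ).preimage (contDiff_chartInv a b (n := 0)).continuous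

theorem chart_mem_cylinder {a b : ℝ} (hab : a ^ 2 + b ^ 2 = 1) {D : Set (ℝ × ℝ)} {J : Set ℝ}
    {p : (ℝ × ℝ) × ℝ} : chart a b p ∈ cylinder a b D J ↔ p.1 ∈ D ∧ p.2 ∈ J := by
  rw [cylinder, mem_preimage, chartInv_chart hab, mem_prod]

/-- Inside the cylinder `D × J`, the set `E` is the subgraph of `h`, up to points of the graph. -/
def IsSubgraphIn (a b : ℝ) (D : Set (ℝ × ℝ)) (J : Set ℝ) (E : Set Heis) (h : ℝ × ℝ → ℝ) : Prop :=
  ∀ q ∈ D, ∀ u ∈ J, (u < h q → chart a b (q, u) ∈ E) ∧ (h q < u → chart a b (q, u) ∉ E)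

theorem measurableSet_graph {h : ℝ × ℝ → ℝ} (hh : Continuous h) :
    MeasurableSet {p : (ℝ × ℝ) × ℝ | p.2 = h p.1} :=
  (isClosed_eq continuous_snd (hh.comp continuous_fst)).measurableSet

theorem volume_graph_eq_zero {h : ℝ × ℝ → ℝ} (hh : Continuous h) :
    volume {p : (ℝ × ℝ) × ℝ | p.2 = h p.1} = 0 := by
  rw [Measure.volume_eq_prod, Measure.measure_prod_null (measurableSet_graph hh)]
  refine Eventually.of_forall fun q => ?_
  have : Prod.mk q ⁻¹' {p : (ℝ × ℝ) × ℝ | p.2 = h p.1} = {h q} := by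
    ext r; simp
  simp [this]

/-- The two sets can differ only on the graph, which is null because each vertical fibre meets it in
one point. -/
theorem IsSubgraphIn.inter_ae_eq {a b : ℝ} (hab : a ^ 2 + b ^ 2 = 1) {D : Set (ℝ × ℝ)} {J : Set ℝ}
    {E : Set Heis} {h : ℝ × ℝ → ℝ} (hE : IsSubgraphIn a b D J E h) (hh : Continuous h) :
    (E ∩ cylinder a b D J : Set Heis) =ᵐ[volume]
      (chartInv a b ⁻¹' {p | p.2 < h p.1} ∩ cylinder a b D J : Set Heis) := by
  have hmp : MeasurePreserving (chartInv a b) :=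
    (measurePreserving_chart hab).symm (chartHomeo hab).toMeasurableEquiv
  have h0 : volume (chartInv a b ⁻¹' {p | p.2 = h p.1}) = 0 := by
    rw [hmp.measure_preimage (measurableSet_graph hh).nullMeasurableSet]
    exact volume_graph_eq_zero hh
  have h1 : ∀ᵐ p : Heis, p ∉ chartInv a b ⁻¹' {p | p.2 = h p.1} :=
    measure_eq_zero_iff_ae_notMem.mp h0
  filter_upwards [h1] with p hp
  refine propext (and_congr_left fun hpc => ?_)
  have := hE (chartInv a b p).1 hpc.1 (chartInv a b p).2 hpc.2
  rw [Prod.mk.eta, chart_chartInv hab] at this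
  rcases lt_trichotomy (chartInv a b p).2 (h (chartInv a b p).1) with h2 | h2 | h2
  · exact ⟨fun _ => h2, fun _ => this.1 h2⟩
  · exact absurd h2 hp
  · exact ⟨fun h3 => absurd h3 (this.2 h2), fun h3 => absurd h3 (not_lt_of_gt h2)⟩

theorem IsSubgraphIn.setIntegral_inter {a b : ℝ} (hab : a ^ 2 + b ^ 2 = 1) {D : Set (ℝ × ℝ)}
    {J : Set ℝ} {E : Set Heis} {h : ℝ × ℝ → ℝ} (hE : IsSubgraphIn a b D J E h) (hh : Continuous h)
    (F : Heis → ℝ) :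
    ∫ p in E ∩ cylinder a b D J, F p =
      ∫ p in {p | p.2 < h p.1} ∩ D ×ˢ J, F (chart a b p) := by
  rw [setIntegral_congr_set (hE.inter_ae_eq hab hh),
    ← (measurePreserving_chart hab).setIntegral_preimage_emb
      (chartHomeo hab).measurableEmbedding]
  congr 2
  ext p
  simp only [cylinder, mem_preimage, mem_inter_iff, chartInv_chart hab]

/-- The flux of a horizontal field out of a set that is a subgraph near the support. -/
theorem IsSubgraphIn.setIntegral_divergence {a b : ℝ} (hab : a ^ 2 + b ^ 2 = 1) {D : Set (ℝ × ℝ)}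
    {J : Set ℝ} (hD : IsOpen D) (hJ : IsOpen J) {E : Set Heis} {h : ℝ × ℝ → ℝ}
    (hE : IsSubgraphIn a b D J E h) (hh : ContDiff ℝ 1 h)
    {c : Heis → ℝ × ℝ} (hc : ContDiff ℝ 1 c) (hcc : HasCompactSupport c)
    (hcs : tsupport c ⊆ cylinder a b D J) :
    ∫ p in E, divergence (horizontalField c) p =
      ∫ q, (transComponent a b c (q, h q) - charComponent a b c (q, h q) * charSlope h q) := by
  have hB := (isOpen_cylinder a b hD hJ).measurableSet
  -- The divergence vanishes off the cylinder, so `E` may be exchanged for the whole subgraph of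
  -- `h`, to which the global divergence formula applies.
  have hz : ∀ p, p ∉ cylinder a b D J → divergence (horizontalField c) p = 0 := fun p hp => by
    rw [divergence_horizontalField (hc.differentiable one_ne_zero p)]
    have : fderiv ℝ c p = 0 :=
      image_eq_zero_of_notMem_tsupport fun hh => hp (hcs (tsupport_fderiv_subset ℝ hh))
    simp [this]
  have hind : divergence (horizontalField c) =
      (cylinder a b D J).indicator (divergence (horizontalField c)) := by
    symm
    exact indicator_eq_self.mpr fun p hp => by_contra fun hh => hp (hz p hh)
  have step : ∀ A : Set Heis, ∫ p in A, divergence (horizontalField c) p =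
      ∫ p in A ∩ cylinder a b D J, divergence (horizontalField c) p := fun A => by
    conv_lhs => rw [hind]
    rw [setIntegral_indicator hB]
  rw [step, setIntegral_congr_set (hE.inter_ae_eq hab hh.continuous), ← step,
    ← (measurePreserving_chart hab).setIntegral_preimage_emb
      (chartHomeo hab).measurableEmbedding]
  have : chart a b ⁻¹' (chartInv a b ⁻¹' {p | p.2 < h p.1}) = {p | p.2 < h p.1} := by
    ext p; simp [chartInv_chart hab]
  rw [this, ← setIntegral_subgraph_divergence (contDiff_charComponent hc)
    (HasCompactSupport.charComponent hab hcc) (contDiff_transComponent hc)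
    (HasCompactSupport.transComponent hab hcc) hh]
  simp_rw [divergence_horizontalField_chart hab (hc.differentiable one_ne_zero)]

/-! ### The support function of a convex set of class `C²₊` -/

theorem exists_contDiffAt_localInverse {q : ℝ → ℝ} {x : ℝ} (hq : ContDiffAt ℝ 1 q x)
    (hx : deriv q x ≠ 0) :
    ∃ σ : ℝ → ℝ, σ (q x) = x ∧ ContDiffAt ℝ 1 σ (q x) ∧ (∀ᶠ w in 𝓝 (q x), q (σ w) = w) ∧
      ∀ᶠ y in 𝓝 x, σ (q y) = y := by
  have h1 : HasFDerivAt q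
      (ContinuousLinearEquiv.unitsEquivAut ℝ (Units.mk0 _ hx) : ℝ →L[ℝ] ℝ) x := by
    have := (hq.differentiableAt one_ne_zero).hasDerivAt.hasFDerivAt
    convert! this using 1
  have h2 := hq.hasStrictFDerivAt' h1 one_ne_zero
  exact ⟨hq.localInverse h1 one_ne_zero, hq.localInverse_apply_image h1 one_ne_zero,
    hq.to_localInverse h1 one_ne_zero, h2.eventually_right_inverse, h2.eventually_left_inverse⟩

theorem hasDerivAt_fst_comp {φ : ℝ → ℝ × ℝ} {g : ℝ × ℝ} {s : ℝ} (h : HasDerivAt φ g s) :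
    HasDerivAt (fun r => (φ r).1) g.1 s :=
  (hasFDerivAt_fst (𝕜 := ℝ) (p := φ s)).comp_hasDerivAt s h

theorem hasDerivAt_snd_comp {φ : ℝ → ℝ × ℝ} {g : ℝ × ℝ} {s : ℝ} (h : HasDerivAt φ g s) :
    HasDerivAt (fun r => (φ r).2) g.2 s :=
  (hasFDerivAt_snd (𝕜 := ℝ) (p := φ s)).comp_hasDerivAt s h

/-- The linear form `k ↦ ⟨k, e - w e'⟩`, where `e = (a, b)` and `e' = (-b, a)`. It is a multiple of
the pairing with the horizontal normal of a graph of slope `w`. -/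
def slopeForm (a b w : ℝ) (k : ℝ × ℝ) : ℝ :=
  (a * k.1 + b * k.2) - w * (-b * k.1 + a * k.2)

/-- The value at `e - w e'` of the support function of `K`. -/
noncomputable def slopeSupport (K : Set (ℝ × ℝ)) (a b w : ℝ) : ℝ :=
  sSup (slopeForm a b w '' closure K)

theorem continuous_slopeForm (a b w : ℝ) : Continuous (slopeForm a b w) := by
  unfold slopeForm; fun_prop

theorem continuous_slopeForm_slope (a b : ℝ) (k : ℝ × ℝ) :
    Continuous fun w => slopeForm a b w k := by
  unfold slopeForm; fun_prop

section

variable {K : Set (ℝ × ℝ)} (hK : Bornology.IsBounded K)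
include hK

theorem slopeForm_le_slopeSupport (a b w : ℝ) {k : ℝ × ℝ} (hk : k ∈ closure K) :
    slopeForm a b w k ≤ slopeSupport K a b w :=
  le_csSup ((hK.isCompact_closure.image (continuous_slopeForm a b w)).bddAbove)
    (mem_image_of_mem _ hk)

theorem exists_slopeForm_eq (hne : K.Nonempty) (a b w : ℝ) :
    ∃ k ∈ closure K, slopeForm a b w k = slopeSupport K a b w :=
  (hK.isCompact_closure.image (continuous_slopeForm a b w)).sSup_mem (hne.closure.image _)

/-- A supremum of affine functions of `w` whose slopes `-(-b k₁ + a k₂)` are bounded because `K` is.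
-/
theorem lipschitzWith_slopeSupport (hne : K.Nonempty) (a b : ℝ) :
    ∃ L, LipschitzWith L (slopeSupport K a b) := by
  obtain ⟨C, hC⟩ := (hK.isCompact_closure.image (f := fun k : ℝ × ℝ => -b * k.1 + a * k.2)
    (by fun_prop)).isBounded.exists_norm_le
  refine ⟨C.toNNReal, LipschitzWith.of_le_add_mul _ fun w w' => ?_⟩
  obtain ⟨k, hk, he⟩ := exists_slopeForm_eq hK hne a b w
  have h1 := slopeForm_le_slopeSupport hK a b w' hk
  have h2 := hC _ (mem_image_of_mem _ hk)
  have h3 : slopeForm a b w k = slopeForm a b w' k - (w - w') * (-b * k.1 + a * k.2) := by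
    unfold slopeForm; ring
  have h4 : -((w - w') * (-b * k.1 + a * k.2)) ≤ C * dist w w' := by
    refine (neg_le_abs _).trans ?_
    rw [abs_mul, mul_comm, Real.dist_eq]
    exact mul_le_mul_of_nonneg_right h2 (abs_nonneg _)
  have h5 := mul_le_mul_of_nonneg_right (Real.le_coe_toNNReal C) (dist_nonneg (x := w) (y := w'))
  linarith

end

theorem slopeForm_zero (a b w : ℝ) : slopeForm a b w 0 = 0 := by simp [slopeForm]

/-- The form grows at unit rate in the direction `(a, b)`. Hence maximisers over the closure lie on
the frontier, and the support function is positive when `0` is interior. -/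
theorem exists_mem_slopeForm_lt {K : Set (ℝ × ℝ)} {a b : ℝ}
    (hab : a ^ 2 + b ^ 2 = 1) (w : ℝ) {k : ℝ × ℝ} (hk : k ∈ interior K) :
    ∃ k' ∈ K, slopeForm a b w k < slopeForm a b w k' := by
  have hc : ContinuousAt (fun r : ℝ => k + r • (a, b)) 0 := by fun_prop
  have : ∀ᶠ r in 𝓝 (0 : ℝ), k + r • (a, b) ∈ interior K :=
    hc (by simpa using isOpen_interior.mem_nhds hk)
  obtain ⟨r, hr, hr0⟩ := ((this.filter_mono nhdsWithin_le_nhds).and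
    (self_mem_nhdsWithin : Ioi (0 : ℝ) ∈ 𝓝[>] 0)).exists
  refine ⟨_, interior_subset hr, ?_⟩
  have : slopeForm a b w (k + r • (a, b)) = slopeForm a b w k + r := by
    simp only [slopeForm, Prod.fst_add, Prod.snd_add, Prod.smul_mk, smul_eq_mul]
    linear_combination r * hab
  rw [this]
  exact lt_add_of_pos_right _ hr0

theorem slopeSupport_pos {K : Set (ℝ × ℝ)} (hK : Bornology.IsBounded K)
    (hK0 : (0 : ℝ × ℝ) ∈ interior K) {a b : ℝ} (hab : a ^ 2 + b ^ 2 = 1) (w : ℝ) :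
    0 < slopeSupport K a b w := by
  obtain ⟨k, hk, h⟩ := exists_mem_slopeForm_lt hab w hK0
  rw [slopeForm_zero] at h
  exact h.trans_le (slopeForm_le_slopeSupport hK a b w (subset_closure hk))

/-- A tangent line to the boundary of a convex body is a supporting line. -/
theorem slopeForm_le_of_tangent {K : Set (ℝ × ℝ)} (hK : Convex ℝ K)
    (hK0 : (0 : ℝ × ℝ) ∈ interior K) {a b : ℝ} (hab : a ^ 2 + b ^ 2 = 1) {γ : ℝ → ℝ × ℝ}
    (hγ : ∀ s, γ s ∈ frontier K) {s w : ℝ} (hd : DifferentiableAt ℝ γ s) (hd0 : deriv γ s ≠ 0)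
    (htan : slopeForm a b w (deriv γ s) = 0) (hpos : 0 < slopeForm a b w (γ s))
    {k : ℝ × ℝ} (hk : k ∈ closure K) : slopeForm a b w k ≤ slopeForm a b w (γ s) := by
  -- Hahn–Banach gives a supporting functional `f` at `γ s`. Since `f ∘ γ` is maximal there, `f`
  -- kills the tangent vector, as the slope form does. Two linear forms on the plane with a common
  -- nonzero kernel vector are proportional, and both being positive at `γ s` makes the factor
  -- positive.
  obtain ⟨f, hf⟩ := geometric_hahn_banach_open_point hK.interior isOpen_interior (hγ s).2
  have hle : ∀ k ∈ closure K, f k ≤ f (γ s) := by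
    rw [← hK.closure_interior_eq_closure_of_nonempty_interior ⟨0, hK0⟩]
    exact closure_minimal (fun k hk => (hf k hk).le)
      (isClosed_le f.continuous continuous_const)
  have h0 : 0 < f (γ s) := by simpa using hf 0 hK0
  have hcrit : f (deriv γ s) = 0 := by
    have hmax : IsLocalMax (fun r => f (γ r)) s :=
      Eventually.of_forall fun r => hle _ (frontier_subset_closure (hγ r))
    exact hmax.hasDerivAt_eq_zero (f.hasFDerivAt.comp_hasDerivAt s hd.hasDerivAt)
  have hdec : ∀ k : ℝ × ℝ, f k = (-b * k.1 + a * k.2) * f (-b, a) + (a * k.1 + b * k.2) * f (a, b) := by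
    intro k
    rw [← smul_eq_mul (_ + _) (f (-b, a)), ← smul_eq_mul (_ + _) (f (a, b)), ← map_smul, ← map_smul,
      ← map_add]
    congr 1
    ext
    · simp only [Prod.fst_add, Prod.smul_fst, smul_eq_mul]; linear_combination -k.1 * hab
    · simp only [Prod.snd_add, Prod.smul_snd, smul_eq_mul]; linear_combination -k.2 * hab
  set g := deriv γ s
  have hg : a * g.1 + b * g.2 = w * (-b * g.1 + a * g.2) := by
    rw [slopeForm] at htan; linarith
  have hgc : -b * g.1 + a * g.2 ≠ 0 := by
    intro h
    rw [h, mul_zero] at hg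
    refine hd0 (Prod.ext ?_ ?_)
    · show g.1 = 0
      linear_combination a * hg - b * h - g.1 * hab
    · show g.2 = 0
      linear_combination b * hg + a * h - g.2 * hab
  have hfe : f (-b, a) = -w * f (a, b) := by
    rw [hdec g, hg] at hcrit
    have : (-b * g.1 + a * g.2) * (f (-b, a) + w * f (a, b)) = 0 := by linear_combination hcrit
    have := (mul_eq_zero.mp this).resolve_left hgc
    linarith
  have hform : ∀ k, f k = f (a, b) * slopeForm a b w k := fun k => by
    rw [hdec k, hfe, slopeForm]; ring
  have hfpos : 0 < f (a, b) := by
    rw [hform] at h0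
    exact (pos_iff_pos_of_mul_pos h0).mpr hpos
  have := hle k hk
  rw [hform k, hform (γ s)] at this
  exact le_of_mul_le_mul_left this hfpos

/-- The support function of a convex body of class `C²₊` is of class `C²`, with nonvanishing second
derivative in the direction `e'`. -/
theorem slopeSupport_regularity_at {K : Set (ℝ × ℝ)} (hK : IsConvexC2Plus K)
    (hK0 : (0 : ℝ × ℝ) ∈ interior K) {a b : ℝ} (hab : a ^ 2 + b ^ 2 = 1) (w₀ : ℝ) :
    (∀ᶠ w in 𝓝 w₀, DifferentiableAt ℝ (slopeSupport K a b) w) ∧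
      ContDiffAt ℝ 1 (deriv (slopeSupport K a b)) w₀ ∧
      deriv (deriv (slopeSupport K a b)) w₀ ≠ 0 := by
  obtain ⟨P, γ, -, hγ, -, -, hran, hcurv⟩ := hK.boundary
  have hγf : ∀ s, γ s ∈ frontier K := fun s => hran ▸ mem_range_self s
  have hγd : Differentiable ℝ γ := hγ.differentiable two_ne_zero
  have hγ' : ContDiff ℝ 1 (deriv γ) := by
    rw [← one_add_one_eq_two] at hγ
    exact (contDiff_succ_iff_deriv.mp hγ).2.2
  -- A maximiser for the slope `w₀` exists by compactness and lies on the boundary curve, at a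
  -- parameter `s₀`.
  obtain ⟨k₀, hk₀, hk₀e⟩ := exists_slopeForm_eq hK.bounded ⟨0, interior_subset hK0⟩ a b w₀
  have hk₀f : k₀ ∈ frontier K := by
    refine ⟨hk₀, fun hi => ?_⟩
    obtain ⟨k', hk', hlt⟩ := exists_mem_slopeForm_lt hab w₀ hi
    have := slopeForm_le_slopeSupport hK.bounded a b w₀ (subset_closure hk')
    linarith
  rw [← hran] at hk₀f
  obtain ⟨s₀, rfl⟩ := hk₀f
  set c : ℝ → ℝ := fun s => -b * (γ s).1 + a * (γ s).2
  set p : ℝ → ℝ := fun s => a * (γ s).1 + b * (γ s).2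
  set c' : ℝ → ℝ := fun s => -b * (deriv γ s).1 + a * (deriv γ s).2
  set p' : ℝ → ℝ := fun s => a * (deriv γ s).1 + b * (deriv γ s).2
  have hc : ∀ s, HasDerivAt c (c' s) s := fun s =>
    ((hasDerivAt_fst_comp (hγd s).hasDerivAt).const_mul (-b)).add ((hasDerivAt_snd_comp (hγd s).hasDerivAt).const_mul a)
  have hp : ∀ s, HasDerivAt p (p' s) s := fun s =>
    ((hasDerivAt_fst_comp (hγd s).hasDerivAt).const_mul a).add ((hasDerivAt_snd_comp (hγd s).hasDerivAt).const_mul b)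
  have hc'd : ContDiff ℝ 1 c' :=
    (contDiff_const.mul hγ'.fst).add (contDiff_const.mul hγ'.snd)
  have hp'd : ContDiff ℝ 1 p' :=
    (contDiff_const.mul hγ'.fst).add (contDiff_const.mul hγ'.snd)
  have hγ'' := (hγ'.differentiable one_ne_zero s₀).hasDerivAt
  have hc'' : HasDerivAt c' (-b * (deriv (deriv γ) s₀).1 + a * (deriv (deriv γ) s₀).2) s₀ :=
    ((hasDerivAt_fst_comp hγ'').const_mul (-b)).add ((hasDerivAt_snd_comp hγ'').const_mul a)
  have hp'' : HasDerivAt p' (a * (deriv (deriv γ) s₀).1 + b * (deriv (deriv γ) s₀).2) s₀ :=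
    ((hasDerivAt_fst_comp hγ'').const_mul a).add ((hasDerivAt_snd_comp hγ'').const_mul b)
  have hform : ∀ w s, slopeForm a b w (γ s) = p s - w * c s := fun w s => rfl
  have hform' : ∀ w s, slopeForm a b w (deriv γ s) = p' s - w * c' s := fun w s => rfl
  have hcrit : p' s₀ = w₀ * c' s₀ := by
    have hmax : IsLocalMax (fun s => p s - w₀ * c s) s₀ := Eventually.of_forall fun s => by
      have := slopeForm_le_slopeSupport hK.bounded a b w₀ (frontier_subset_closure (hγf s))
      rw [← hk₀e] at this
      exact this
    have := hmax.hasDerivAt_eq_zero ((hp s₀).sub ((hc s₀).const_mul w₀))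
    linarith
  have hc0 : c' s₀ ≠ 0 := by
    intro h
    rw [h, mul_zero] at hcrit
    refine (hcurv s₀).1 (Prod.ext ?_ ?_)
    · show (deriv γ s₀).1 = 0
      linear_combination a * hcrit - b * h - (deriv γ s₀).1 * hab
    · show (deriv γ s₀).2 = 0
      linear_combination b * hcrit + a * h - (deriv γ s₀).2 * hab
  -- `q s` is the slope whose form is constant along the tangent line at `γ s`. Inverting `q` near
  -- `s₀` parametrises the maximiser by the slope: `σ w`.
  set q : ℝ → ℝ := fun s => p' s / c' s
  have hq0 : q s₀ = w₀ := by
    simp only [q]; rw [hcrit]; field_simp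
  have hqd : ContDiffAt ℝ 1 q s₀ := hp'd.contDiffAt.div hc'd.contDiffAt hc0
  -- The numerator `p'' c' - p' c''` is, up to sign, the numerator of the curvature, because `(c,
  -- p)` are the coordinates of `γ` in an orthonormal basis.
  have hq' : deriv q s₀ ≠ 0 := by
    have := (hp''.div hc'' hc0).deriv
    have e : deriv q s₀ = _ := this
    rw [e]
    refine div_ne_zero ?_ (pow_ne_zero 2 hc0)
    have hcv := (hcurv s₀).2
    rw [planeCurvature] at hcv
    have hne : (deriv γ s₀).1 * (deriv (deriv γ) s₀).2 - (deriv γ s₀).2 * (deriv (deriv γ) s₀).1 ≠ 0 := by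
      intro h; rw [h, zero_div] at hcv; exact lt_irrefl _ hcv
    intro h
    apply hne
    simp only [p', c'] at h
    linear_combination -h - ((deriv γ s₀).1 * (deriv (deriv γ) s₀).2
      - (deriv γ s₀).2 * (deriv (deriv γ) s₀).1) * hab
  obtain ⟨σ, hσ0, hσd, hσr, -⟩ := exists_contDiffAt_localInverse hqd hq'
  rw [hq0] at hσ0 hσd hσr
  have hσc := hσd.continuousAt
  have hpos : 0 < slopeForm a b w₀ (γ s₀) := by
    rw [hk₀e]; exact slopeSupport_pos hK.bounded hK0 hab w₀
  have ev1 : ∀ᶠ w in 𝓝 w₀, c' (σ w) ≠ 0 := by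
    have : ContinuousAt (fun w => c' (σ w)) w₀ :=
      hc'd.continuous.continuousAt.comp hσc
    exact this.eventually_ne (by rw [hσ0]; exact hc0)
  have ev2 : ∀ᶠ w in 𝓝 w₀, 0 < slopeForm a b w (γ (σ w)) := by
    have : ContinuousAt (fun w => p (σ w) - w * c (σ w)) w₀ := by
      have h1 : ContinuousAt (fun w => p (σ w)) w₀ :=
        ContinuousAt.comp (hp _).continuousAt hσc
      have h2 : ContinuousAt (fun w => c (σ w)) w₀ :=
        ContinuousAt.comp (hc _).continuousAt hσc
      exact h1.sub (continuousAt_id.mul h2)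
    refine this.eventually_const_lt ?_
    show 0 < p (σ w₀) - w₀ * c (σ w₀)
    rw [hσ0]; exact hpos
  have ev3 : ∀ᶠ w in 𝓝 w₀, DifferentiableAt ℝ σ w :=
    (hσd.eventually (by simp)).mono fun w hw => hw.differentiableAt one_ne_zero
  have evT : ∀ᶠ w in 𝓝 w₀, p' (σ w) = w * c' (σ w) := by
    filter_upwards [ev1, hσr] with w h1 h2
    have : p' (σ w) / c' (σ w) = w := h2
    field_simp at this
    linarith
  -- The point `γ (σ w)` is critical by `evT`; convexity, through the tangent-line lemma, upgrades
  -- this to a global maximum.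
  have evH : ∀ᶠ w in 𝓝 w₀, slopeSupport K a b w = p (σ w) - w * c (σ w) := by
    filter_upwards [ev2, evT] with w h2 h3
    refine le_antisymm ?_ ?_
    · refine csSup_le ((nonempty_of_mem hk₀).image _) ?_
      rintro _ ⟨k, hk, rfl⟩
      refine slopeForm_le_of_tangent hK.convex hK0 hab hγf (hγd _) (hcurv _).1 ?_ h2 hk
      rw [hform', h3, sub_self]
    · exact slopeForm_le_slopeSupport hK.bounded a b w (frontier_subset_closure (hγf _))
  -- Envelope argument: the terms containing `σ'` cancel because `p' (σ w) = w * c' (σ w)`, leaving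
  -- only the explicit dependence on `w`.
  have evD : ∀ᶠ w in 𝓝 w₀, HasDerivAt (slopeSupport K a b) (-c (σ w)) w := by
    filter_upwards [evH.eventually_nhds, evT, ev3] with w h1 h2 h3
    have d1 := (hp (σ w)).comp w h3.hasDerivAt
    have d2 := (hc (σ w)).comp w h3.hasDerivAt
    refine HasDerivAt.congr_of_eventuallyEq ?_ h1
    refine (d1.sub ((hasDerivAt_id w).mul d2)).congr_deriv ?_
    simp only [id, Function.comp]
    rw [h2]; ring
  have evD' : deriv (slopeSupport K a b) =ᶠ[𝓝 w₀] fun w => -c (σ w) :=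
    evD.mono fun w hw => hw.deriv
  have hcd : ContDiff ℝ 1 c := by
    have : ContDiff ℝ 1 γ := hγ.of_le one_le_two
    exact (contDiff_const.mul this.fst).add (contDiff_const.mul this.snd)
  refine ⟨evD.mono fun w hw => hw.differentiableAt, ?_, ?_⟩
  · exact ContDiffAt.congr_of_eventuallyEq (hcd.contDiffAt.comp w₀ hσd).neg evD'
  · have hσ' := hσd.differentiableAt one_ne_zero
    have hmul : deriv q s₀ * deriv σ w₀ = 1 := by
      have d1 : HasDerivAt q (deriv q s₀) (σ w₀) := by
        rw [hσ0]; exact (hqd.differentiableAt one_ne_zero).hasDerivAt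
      have d2 := d1.comp w₀ hσ'.hasDerivAt
      have d3 : HasDerivAt (q ∘ σ) 1 w₀ :=
        (hasDerivAt_id w₀).congr_of_eventuallyEq hσr
      exact d2.unique d3
    have d4 : HasDerivAt (fun w => -c (σ w)) (-(c' (σ w₀) * deriv σ w₀)) w₀ :=
      ((hc (σ w₀)).comp w₀ hσ'.hasDerivAt).neg
    -- The second derivative is `-c' σ'`, a product of nonzero factors, since `q' σ' = 1`.
    rw [evD'.deriv_eq, d4.deriv, hσ0]
    exact neg_ne_zero.mpr (mul_ne_zero hc0 (right_ne_zero_of_mul_eq_one hmul))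

theorem slopeSupport_regularity {K : Set (ℝ × ℝ)} (hK : IsConvexC2Plus K)
    (hK0 : (0 : ℝ × ℝ) ∈ interior K) {a b : ℝ} (hab : a ^ 2 + b ^ 2 = 1) :
    Differentiable ℝ (slopeSupport K a b) ∧ ContDiff ℝ 1 (deriv (slopeSupport K a b)) ∧
      ∀ w, deriv (deriv (slopeSupport K a b)) w ≠ 0 :=
  ⟨fun w => (slopeSupport_regularity_at hK hK0 hab w).1.self_of_nhds,
    contDiff_iff_contDiffAt.mpr fun w => (slopeSupport_regularity_at hK hK0 hab w).2.1,
    fun w => (slopeSupport_regularity_at hK hK0 hab w).2.2⟩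

/-! ### The perimeter of a subgraph -/

theorem _root_.Continuous.integrableOn_of_isBounded {E : Type*} [MetricSpace E] [ProperSpace E]
    [MeasurableSpace E] [BorelSpace E] {μ : Measure E} [IsFiniteMeasureOnCompacts μ] {G : E → ℝ}
    (hG : Continuous G) {D : Set E} (hD : Bornology.IsBounded D) : IntegrableOn G D μ :=
  (hG.continuousOn.integrableOn_compact hD.isCompact_closure).mono_set subset_closure

theorem exists_contDiff_cutoff {E : Type*} [NormedAddCommGroup E] [NormedSpace ℝ E]
    [FiniteDimensional ℝ E] {Q B : Set E} (hQ : IsCompact Q) (hB : IsOpen B) (hQB : Q ⊆ B) :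
    ∃ χ : E → ℝ, ContDiff ℝ ∞ χ ∧ HasCompactSupport χ ∧ tsupport χ ⊆ B ∧ (∀ x ∈ Q, χ x = 1) ∧
      ∀ x, χ x ∈ Icc 0 1 := by
  obtain ⟨L, hL, hQL, hLB⟩ := exists_compact_between hQ hB hQB
  obtain ⟨χ, hχ, hr, h0, h1⟩ := exists_contMDiff_zero_iff_one_iff_of_isClosed (n := ⊤)
    (modelWithCornersSelf ℝ E) (s := (interior L)ᶜ) (t := Q)
    isOpen_interior.isClosed_compl hQ.isClosed (disjoint_compl_left_iff_subset.mpr hQL)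
  have hsupp : tsupport χ ⊆ L := by
    refine closure_minimal (fun x hx => ?_) hL.isClosed
    by_contra hxL
    exact hx ((h0 x).mp fun hi => hxL (interior_subset hi))
  exact ⟨χ, hχ.contDiff, hL.of_isClosed_subset (isClosed_tsupport _) hsupp, hsupp.trans hLB,
    fun x hx => (h1 x).mp hx, fun x => hr (mem_range_self x)⟩

theorem continuous_slopeForm_uncurry (a b : ℝ) :
    Continuous fun p : ℝ × (ℝ × ℝ) => slopeForm a b p.1 p.2 := by
  unfold slopeForm; fun_prop

section

variable {K : Set (ℝ × ℝ)} (hKc : Convex ℝ K) (hKb : Bornology.IsBounded K)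
  (hK0 : (0 : ℝ × ℝ) ∈ interior K) {a b : ℝ} (hab : a ^ 2 + b ^ 2 = 1)
  {D : Set (ℝ × ℝ)} {J : Set ℝ} (hD : IsOpen D) (hDb : Bornology.IsBounded D) (hJ : IsOpen J)
  {E : Set Heis} {h : ℝ × ℝ → ℝ} (hE : IsSubgraphIn a b D J E h) (hh : ContDiff ℝ 1 h)

include hKb hK0 hh in
theorem continuous_slopeSupport_charSlope :
    Continuous fun q => slopeSupport K a b (charSlope h q) := by
  obtain ⟨L, hL⟩ := lipschitzWith_slopeSupport hKb ⟨0, interior_subset hK0⟩ a b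
  exact hL.continuous.comp (continuous_charSlope hh)

include hab hD hJ hE hh in
theorem setIntegral_divergence_eq_slopeForm {c : Heis → ℝ × ℝ}
    (hc : IsTestField K (cylinder a b D J) c) :
    ∫ p in E, divergence (horizontalField c) p =
      ∫ q in D, slopeForm a b (charSlope h q) (c (chart a b (q, h q))) := by
  rw [hE.setIntegral_divergence hab hD hJ hh hc.contDiff hc.compact hc.support]
  rw [← setIntegral_eq_integral_of_forall_compl_eq_zero (s := D)]
  · refine setIntegral_congr_fun hD.measurableSet fun q _ => ?_
    simp only [slopeForm, transComponent, charComponent]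
    ring
  · intro q hq
    have : c (chart a b (q, h q)) = 0 :=
      image_eq_zero_of_notMem_tsupport fun hm =>
        hq ((chart_mem_cylinder hab).mp (hc.support hm)).1
    simp [transComponent, charComponent, this]

include hh in
theorem integrableOn_slopeForm (hDb : Bornology.IsBounded D) {c : Heis → ℝ × ℝ}
    (hc : Continuous c) :
    IntegrableOn (fun q => slopeForm a b (charSlope h q) (c (chart a b (q, h q)))) D := by
  refine Continuous.integrableOn_of_isBounded ?_ hDb
  refine (continuous_slopeForm_uncurry a b).comp ((continuous_charSlope hh).prodMk ?_)
  exact hc.comp ((contDiff_chart a b (n := 0)).continuous.comp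
    (continuous_id.prodMk hh.continuous))

include hKc hKb hK0 hab hD hDb hJ hE hh

/-- Values of a test field lie in the closure of `K`, so pointwise the flux density is at most the
support function; outside the cylinder the field is `0`, which also lies in `K`. -/
theorem perimeter_subgraph_le :
    perimeter K E (cylinder a b D J) ≤
      ENNReal.ofReal (∫ q in D, slopeSupport K a b (charSlope h q)) := by
  refine iSup₂_le fun c hc => ENNReal.ofReal_le_ofReal ?_
  rw [setIntegral_divergence_eq_slopeForm hab hD hJ hE hh hc]
  refine setIntegral_mono_on (integrableOn_slopeForm hh hDb hc.contDiff.continuous)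
    ((continuous_slopeSupport_charSlope hKb hK0 hh).integrableOn_of_isBounded hDb)
    hD.measurableSet fun q _ => ?_
  refine slopeForm_le_slopeSupport hKb a b _ ?_
  by_cases hm : chart a b (q, h q) ∈ cylinder a b D J
  · exact (gauge_le_one_iff_mem_closure hKc (mem_interior_iff_mem_nhds.mp hK0)).mp (hc.norm_le _ hm)
  · rw [image_eq_zero_of_notMem_tsupport fun hn => hm (hc.support hn)]
    exact subset_closure (interior_subset hK0)

/-- For fixed `q` the near-maximisers of the slope form are a convex set, and by continuity a
maximiser at `q₀` remains a near-maximiser at nearby points. A partition of unity therefore yields a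
C¹ selection `C` that is optimal up to `ε₁`. It is extended constantly in `u` and cut off outside a
neighbourhood of the graph over a compact `D₀ ⊆ D`. -/
theorem exists_testField_ge (hhJ : ∀ q ∈ D, h q ∈ J) {ε : ℝ} (hε : 0 < ε) :
    ∃ c, IsTestField K (cylinder a b D J) c ∧
      (∫ q in D, slopeSupport K a b (charSlope h q)) - ε ≤
        ∫ p in E, divergence (horizontalField c) p := by
  set H := fun q => slopeSupport K a b (charSlope h q) with hH
  have hHc : Continuous H := continuous_slopeSupport_charSlope hKb hK0 hh
  have hDfin : volume D ≠ ⊤ := hDb.measure_lt_top.ne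
  obtain ⟨M, hM⟩ := (hDb.isCompact_closure.image hHc).isBounded.exists_norm_le
  have hM' : ∀ q ∈ D, H q ≤ |M| := fun q hq =>
    (le_abs_self _).trans ((hM _ (mem_image_of_mem _ (subset_closure hq))).trans (le_abs_self _))
  -- The error has two sources: `ε₁` per unit area of `D`, and at most `|M|` per unit area of `D \
  -- D₀`, whose measure is below `δ`. Each contributes at most `ε / 2`; the `+ 1` keeps the
  -- denominators positive.
  set ε₁ := ε / (2 * (volume.real D + 1)) with hε₁
  have hv : 0 ≤ volume.real D := measureReal_nonneg
  have hε₁0 : 0 < ε₁ := by positivity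
  set δ := ε / (2 * (|M| + 1)) with hδ
  have hδ0 : 0 < δ := by positivity
  obtain ⟨D₀, hD₀D, hD₀, hD₀m⟩ := hD.measurableSet.exists_isCompact_sdiff_lt hDfin
    (ENNReal.ofReal_pos.mpr hδ0).ne'
  obtain ⟨C, hC⟩ := exists_contMDiffMap_forall_mem_convex_of_local_const (n := 1)
    (modelWithCornersSelf ℝ (ℝ × ℝ)) (F := ℝ × ℝ)
    (t := fun q => {k | k ∈ closure K ∧ H q - ε₁ ≤ slopeForm a b (charSlope h q) k})
    (fun q => by
      refine hKc.closure.inter (t := {k | H q - ε₁ ≤ slopeForm a b (charSlope h q) k}) ?_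
      refine convex_halfSpace_ge ⟨fun x y => ?_, fun r x => ?_⟩ _
      · simp only [slopeForm, Prod.fst_add, Prod.snd_add]; ring
      · simp only [slopeForm, Prod.smul_fst, Prod.smul_snd, smul_eq_mul]; ring)
    (fun q₀ => by
      obtain ⟨k, hk, hke⟩ := exists_slopeForm_eq hKb ⟨0, interior_subset hK0⟩ a b (charSlope h q₀)
      refine ⟨k, ?_⟩
      have c1 : Continuous fun q => slopeForm a b (charSlope h q) k - H q :=
        ((continuous_slopeForm_slope a b k).comp (continuous_charSlope hh)).sub hHc
      have : ∀ᶠ q in 𝓝 q₀, -ε₁ < slopeForm a b (charSlope h q) k - H q := by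
        refine c1.continuousAt.eventually_const_lt ?_
        simpa [hH, hke] using hε₁0
      filter_upwards [this] with q hq
      exact ⟨hk, by linarith⟩)
  have hCd : ContDiff ℝ 1 C := C.contMDiff.contDiff
  obtain ⟨χ, hχ, hχc, hχs, hχ1, hχr⟩ := exists_contDiff_cutoff
    (Q := (fun q => chart a b (q, h q)) '' D₀) (B := cylinder a b D J)
    (hD₀.image ((contDiff_chart a b (n := 0)).continuous.comp
      (continuous_id.prodMk hh.continuous))) (isOpen_cylinder a b hD hJ) (by
        rintro _ ⟨q, hq, rfl⟩
        exact (chart_mem_cylinder hab).mpr ⟨hD₀D hq, hhJ q (hD₀D hq)⟩)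
  have h0K : (0 : ℝ × ℝ) ∈ closure K := subset_closure (interior_subset hK0)
  have htest : IsTestField K (cylinder a b D J) fun p => χ p • C (chartInv a b p).1 := by
    refine ⟨?_, hχc.smul_right, (tsupport_smul_subset_left _ _).trans hχs, fun p _ => ?_⟩
    · have h1 : ContDiff ℝ 1 fun p => C (chartInv a b p).1 :=
        hCd.comp (contDiff_fst.comp (contDiff_chartInv a b))
      exact (hχ.of_le (by exact_mod_cast le_top)).smul h1
    · refine (gauge_le_one_iff_mem_closure hKc (mem_interior_iff_mem_nhds.mp hK0)).mpr ?_
      exact hKc.closure.smul_mem_of_zero_mem h0K (hC _).1 (hχr p)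
  refine ⟨_, htest, ?_⟩
  rw [setIntegral_divergence_eq_slopeForm hab hD hJ hE hh htest]
  have i1 : IntegrableOn H D := hHc.integrableOn_of_isBounded hDb
  have i2 := integrableOn_slopeForm (a := a) (b := b) hh hDb htest.contDiff.continuous
  have i3 : IntegrableOn (fun _ => ε₁) D := integrableOn_const hDfin
  have hDm : MeasurableSet (D \ D₀) := hD.measurableSet.diff hD₀.measurableSet
  have i4 : IntegrableOn ((D \ D₀).indicator fun _ => |M|) D :=
    IntegrableOn.indicator (integrableOn_const hDfin) hDm
  have hle : ∫ q in D, (H q - slopeForm a b (charSlope h q)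
      (χ (chart a b (q, h q)) • C (chartInv a b (chart a b (q, h q))).1)) ≤
      ∫ q in D, (ε₁ + (D \ D₀).indicator (fun _ => |M|) q) := by
    refine setIntegral_mono_on (i1.sub i2) (i3.add i4) hD.measurableSet fun q hq => ?_
    · rw [chartInv_chart hab]
      have hlin : slopeForm a b (charSlope h q) (χ (chart a b (q, h q)) • C q) =
          χ (chart a b (q, h q)) * slopeForm a b (charSlope h q) (C q) := by
        simp only [slopeForm, Prod.smul_fst, Prod.smul_snd, smul_eq_mul]; ring
      rw [hlin]
      have hCq := (hC q).2
      obtain ⟨r0, r1⟩ := hχr (chart a b (q, h q))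
      have hHq : 0 < H q := slopeSupport_pos hKb hK0 hab _
      by_cases hq0 : q ∈ D₀
      · rw [hχ1 _ (mem_image_of_mem _ hq0), indicator_of_notMem (s := D \ D₀) (fun hh => hh.2 hq0)]
        linarith
      · rw [indicator_of_mem (s := D \ D₀) ⟨hq, hq0⟩]
        have := hM' q hq
        nlinarith [mul_le_mul_of_nonneg_left hCq r0, mul_nonneg r0 hHq.le]
  rw [integral_sub i1 i2] at hle
  have hr : ∫ q in D, (ε₁ + (D \ D₀).indicator (fun _ => |M|) q) ≤ ε := by
    rw [integral_add i3 i4,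
      setIntegral_indicator hDm, setIntegral_const, setIntegral_const, smul_eq_mul, smul_eq_mul,
      inter_eq_right.mpr sdiff_subset]
    have m1 : volume.real (D \ D₀) ≤ δ := ENNReal.toReal_le_of_le_ofReal hδ0.le hD₀m.le
    have m2 : volume.real D * ε₁ ≤ ε / 2 := by
      rw [hε₁, mul_div_assoc', div_le_div_iff₀ (by positivity) two_pos]
      nlinarith
    have m3 : δ * |M| ≤ ε / 2 := by
      rw [hδ, div_mul_eq_mul_div, div_le_div_iff₀ (by positivity) two_pos]
      nlinarith [abs_nonneg M]
    have := mul_le_mul_of_nonneg_right m1 (abs_nonneg M)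
    linarith
  linarith

theorem perimeter_subgraph_eq (hhJ : ∀ q ∈ D, h q ∈ J) :
    perimeter K E (cylinder a b D J) =
      ENNReal.ofReal (∫ q in D, slopeSupport K a b (charSlope h q)) := by
  refine le_antisymm (perimeter_subgraph_le hKc hKb hK0 hab hD hDb hJ hE hh) ?_
  refine ENNReal.le_of_forall_pos_le_add fun ε hε _ => ?_
  obtain ⟨c, hc, hle⟩ := exists_testField_ge hKc hKb hK0 hab hD hDb hJ hE hh hhJ
    (NNReal.coe_pos.mpr hε)
  have h1 : ENNReal.ofReal (∫ p in E, divergence (horizontalField c) p) ≤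
      perimeter K E (cylinder a b D J) :=
    le_iSup₂ (f := fun c (_ : IsTestField K (cylinder a b D J) c) =>
      ENNReal.ofReal (∫ p in E, divergence (horizontalField c) p)) c hc
  calc _ ≤ ENNReal.ofReal ((∫ p in E, divergence (horizontalField c) p) + ε) :=
        ENNReal.ofReal_le_ofReal (by linarith)
    _ ≤ _ := ENNReal.ofReal_add_le
    _ ≤ _ := by
      rw [ENNReal.ofReal_coe_nnreal]
      gcongr

end

/-! ### Flows -/

section

variable {F : Type*} [NormedAddCommGroup F] [NormedSpace ℝ F]

theorem integralCurve_eq {f : F → F} {k : NNReal} (hf : LipschitzWith k f)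
    {α β : ℝ → F} {x y t₀ : ℝ} (ht₀ : t₀ ∈ Ioo x y) (hα : ∀ t ∈ Ioo x y, HasDerivAt α (f (α t)) t)
    (hβ : ∀ t ∈ Ioo x y, HasDerivAt β (f (β t)) t) (h : α t₀ = β t₀) : EqOn α β (Ioo x y) :=
  ODE_solution_unique_of_mem_Ioo (v := fun _ => f) (s := fun _ => univ)
    (fun _ _ => hf.lipschitzOnWith) ht₀ (fun t ht => ⟨hα t ht, mem_univ _⟩)
    (fun t ht => ⟨hβ t ht, mem_univ _⟩) h

theorem integralCurve_eq_univ {f : F → F} {k : NNReal} (hf : LipschitzWith k f)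
    {α β : ℝ → F} (t₀ : ℝ) (hα : ∀ t, HasDerivAt α (f (α t)) t)
    (hβ : ∀ t, HasDerivAt β (f (β t)) t) (h : α t₀ = β t₀) : α = β :=
  ODE_solution_unique_univ (v := fun _ => f) (s := fun _ => univ)
    (fun _ => hf.lipschitzOnWith) (fun t => ⟨hα t, mem_univ _⟩) (fun t => ⟨hβ t, mem_univ _⟩) h

/-- A bounded Lipschitz vector field is complete. -/
theorem exists_integralCurve_of_bounded [CompleteSpace F] {f : F → F} {k : NNReal}
    (hf : LipschitzWith k f) {L : NNReal} (hL : ∀ x, ‖f x‖ ≤ L) (x : F) :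
    ∃ α : ℝ → F, α 0 = x ∧ ∀ t, HasDerivAt α (f (α t)) t := by
  have hloc : ∀ c : NNReal, ∃ α : ℝ → F, α 0 = x ∧
      ∀ t ∈ Ioo (-(c : ℝ)) c, HasDerivAt α (f (α t)) t := by
    intro c
    -- With speed at most `L`, a curve cannot leave the ball of radius `L * c` within time `c`.
    have hpl : IsPicardLindelof (fun _ => f) (tmin := -(c : ℝ)) (tmax := c)
        ⟨0, by simp⟩ x (L * c) 0 L k :=
      IsPicardLindelof.of_time_independent (fun y _ => hL y) hf.lipschitzOnWith (by simp)
    obtain ⟨α, h0, hα⟩ := hpl.exists_eq_forall_mem_Icc_hasDerivWithinAt₀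
    exact ⟨α, h0, fun t ht => (hα t (Ioo_subset_Icc_self ht)).hasDerivAt (Icc_mem_nhds ht.1 ht.2)⟩
  choose α h0 hα using hloc
  have hagree : ∀ c d : NNReal, c ≤ d → EqOn (α c) (α d) (Ioo (-(c : ℝ)) c) := by
    intro c d hcd
    rcases eq_or_lt_of_le (zero_le : (0 : NNReal) ≤ c) with rfl | hc
    · intro t ht; simp at ht
    have hc' : (0 : ℝ) < c := hc
    have hcd' : (c : ℝ) ≤ d := hcd
    exact integralCurve_eq hf (t₀ := 0) ⟨by linarith, hc'⟩ (hα c)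
      (fun t ht => hα d t ⟨by linarith [ht.1], by linarith [ht.2]⟩) (by rw [h0, h0])
  -- At time `t` the solution of time radius `|t| + 1` is used; it is defined on a neighbourhood of
  -- `t`, and uniqueness makes the choices agree.
  set γ : ℝ → F := fun t => α (‖t‖₊ + 1) t with hγ
  have hγe : ∀ c : NNReal, EqOn γ (α c) (Ioo (-(c : ℝ)) c) := by
    intro c t ht
    have h1 : t ∈ Ioo (-((‖t‖₊ + 1 : NNReal) : ℝ)) (‖t‖₊ + 1 : NNReal) := by
      simp only [NNReal.coe_add, coe_nnnorm, NNReal.coe_one, Real.norm_eq_abs]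
      constructor <;> linarith [neg_abs_le t, le_abs_self t]
    rcases le_total c (‖t‖₊ + 1) with h | h
    · exact (hagree _ _ h ht).symm
    · exact hagree _ _ h h1
  refine ⟨γ, h0 _, fun t => ?_⟩
  have h1 : t ∈ Ioo (-((‖t‖₊ + 1 : NNReal) : ℝ)) (‖t‖₊ + 1 : NNReal) := by
    simp only [NNReal.coe_add, coe_nnnorm, NNReal.coe_one, Real.norm_eq_abs]
    constructor <;> linarith [neg_abs_le t, le_abs_self t]
  have h2 : γ =ᶠ[𝓝 t] α (‖t‖₊ + 1) :=
    eventually_of_mem (isOpen_Ioo.mem_nhds h1) fun s hs => hγe _ hs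
  exact (hα _ t h1).congr_of_eventuallyEq h2

end

/-- `θ` is the flow of the vector field `χ ∂_u` on the line, where `χ` is a cutoff function that
vanishes outside `(u₀ - δ, u₀ + δ)` and equals `1` on `[u₀ - δ/2, u₀ + δ/2]`. -/
structure IsCutoffFlow (u₀ δ : ℝ) (χ : ℝ → ℝ) (θ : ℝ → ℝ → ℝ) : Prop where
  pos : 0 < δ
  contDiff : ContDiff ℝ ∞ χ
  compact : HasCompactSupport χ
  support : tsupport χ ⊆ Ioo (u₀ - δ) (u₀ + δ)
  eq_one : ∀ u ∈ Icc (u₀ - δ / 2) (u₀ + δ / 2), χ u = 1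
  zero : ∀ u, θ 0 u = u
  hasDerivAt : ∀ r u, HasDerivAt (fun r => θ r u) (χ (θ r u)) r

theorem exists_isCutoffFlow (u₀ : ℝ) {δ : ℝ} (hδ : 0 < δ) : ∃ χ θ, IsCutoffFlow u₀ δ χ θ := by
  obtain ⟨χ, hχ, hχc, hχs, hχ1, -⟩ := exists_contDiff_cutoff
    (Q := Icc (u₀ - δ / 2) (u₀ + δ / 2)) (B := Ioo (u₀ - δ) (u₀ + δ)) isCompact_Icc isOpen_Ioo
    (Icc_subset_Ioo (by linarith) (by linarith))
  obtain ⟨k, hk⟩ := hχ.lipschitzWith_of_hasCompactSupport hχc (by simp)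
  obtain ⟨L, hL⟩ := hχ.continuous.bounded_above_of_compact_support hχc
  choose θ h0 hθ using exists_integralCurve_of_bounded hk (L := L.toNNReal)
    fun x => (hL x).trans (Real.le_coe_toNNReal L)
  exact ⟨χ, fun r u => θ u r, hδ, hχ, hχc, hχs, hχ1, h0, fun r u => hθ u r⟩

namespace IsCutoffFlow

variable {u₀ δ : ℝ} {χ : ℝ → ℝ} {θ : ℝ → ℝ → ℝ} (H : IsCutoffFlow u₀ δ χ θ)
include H

theorem lipschitz : ∃ k, LipschitzWith k χ :=
  H.contDiff.lipschitzWith_of_hasCompactSupport H.compact (by simp)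

theorem curve_eq {α : ℝ → ℝ} (hα : ∀ r, HasDerivAt α (χ (α r)) r) {r₀ u : ℝ}
    (h : α r₀ = θ r₀ u) (r : ℝ) : α r = θ r u := by
  obtain ⟨k, hk⟩ := H.lipschitz
  exact congrFun (integralCurve_eq_univ hk r₀ hα (fun r => H.hasDerivAt r u) h) r

theorem neg_left (r u : ℝ) : θ (-r) (θ r u) = u := by
  have h1 : ∀ s, HasDerivAt (fun s => θ (s + r) u) (χ (θ (s + r) u)) s := fun s =>
    (H.hasDerivAt (s + r) u).comp_add_const s r
  have := H.curve_eq h1 (r₀ := 0) (u := θ r u) (by rw [H.zero, zero_add]) (-r)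
  rw [← this, neg_add_cancel, H.zero]

theorem neg_right (r u : ℝ) : θ r (θ (-r) u) = u := by
  simpa using H.neg_left (-r) u

theorem injective (r : ℝ) : Function.Injective (θ r) :=
  Function.LeftInverse.injective (H.neg_left r)

/-- If two trajectories changed order, their difference would vanish at some time, contradicting
injectivity. -/
theorem strictMono (r : ℝ) : StrictMono (θ r) := by
  intro u v huv
  have hc : Continuous fun s => θ s v - θ s u :=
    continuous_iff_continuousAt.mpr fun s =>
      (H.hasDerivAt s v).continuousAt.sub (H.hasDerivAt s u).continuousAt
  by_contra hle
  have h0 : 0 < θ 0 v - θ 0 u := by rw [H.zero, H.zero]; linarith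
  have h1 : θ r v - θ r u ≤ 0 := by linarith [not_lt.mp hle]
  obtain ⟨s, hs⟩ := mem_range_of_exists_le_of_exists_ge hc ⟨r, h1⟩ ⟨0, h0.le⟩
  exact huv.ne' (H.injective s (sub_eq_zero.mp hs))

theorem eq_self {u : ℝ} (hu : u ∉ Ioo (u₀ - δ) (u₀ + δ)) (r : ℝ) : θ r u = u := by
  have h0 : χ u = 0 := image_eq_zero_of_notMem_tsupport fun h => hu (H.support h)
  refine (H.curve_eq (α := fun _ => u) (fun s => ?_) (r₀ := 0) (by rw [H.zero]) r).symm
  rw [h0]; exact hasDerivAt_const s u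

theorem mem_Ioo {u : ℝ} (hu : u ∈ Ioo (u₀ - δ) (u₀ + δ)) (r : ℝ) :
    θ r u ∈ Ioo (u₀ - δ) (u₀ + δ) := by
  constructor
  · rw [← H.eq_self (u := u₀ - δ) (by simp) r]; exact H.strictMono r hu.1
  · rw [← H.eq_self (u := u₀ + δ) (by simp) r]; exact H.strictMono r hu.2

/-- For these `u` and `r` the line `u + r` stays within `δ / 2` of `u₀`, where the cutoff is `1` and
the speed is therefore one. -/
theorem eq_add {u r : ℝ} (hu : |u - u₀| < δ / 4) (hr : |r| < δ / 4) : θ r u = u + r := by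
  obtain ⟨k, hk⟩ := H.lipschitz
  have hδ := H.pos
  refine integralCurve_eq hk (x := -(δ / 4)) (y := δ / 4) (t₀ := 0) ⟨by linarith, by linarith⟩
    (fun s _ => H.hasDerivAt s u) (fun s hs => ?_) (by rw [H.zero, add_zero]) (abs_lt.mp hr)
  have hu' := abs_lt.mp hu
  rw [H.eq_one (u + s) ⟨by linarith [hs.1, hu'.1], by linarith [hs.2, hu'.2]⟩]
  exact (hasDerivAt_id s).const_add u

end IsCutoffFlow

/-- The vector field `v(z, τ) χ(u) ∂_u` in adapted coordinates. -/
def variationField (a b : ℝ) (v : ℝ × ℝ → ℝ) (χ : ℝ → ℝ) (p : Heis) : Heis :=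
  (v (chartInv a b p).1 * χ (chartInv a b p).2) • (a • frameX p + b • frameY p)

/-- The flow of `variationField`. -/
def variationFlow (a b : ℝ) (v : ℝ × ℝ → ℝ) (θ : ℝ → ℝ → ℝ) (s : ℝ) (p : Heis) : Heis :=
  chart a b ((chartInv a b p).1, θ (s * v (chartInv a b p).1) (chartInv a b p).2)

theorem contDiff_variationField {a b : ℝ} {v : ℝ × ℝ → ℝ} {χ : ℝ → ℝ} {n : WithTop ℕ∞}
    (hv : ContDiff ℝ n v) (hχ : ContDiff ℝ n χ) : ContDiff ℝ n (variationField a b v χ) := by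
  have h1 : ContDiff ℝ n fun p => v (chartInv a b p).1 :=
    hv.comp (contDiff_fst.comp (contDiff_chartInv a b))
  have h2 : ContDiff ℝ n fun p => χ (chartInv a b p).2 :=
    hχ.comp (contDiff_snd.comp (contDiff_chartInv a b))
  have h3 : ContDiff ℝ n fun p : Heis => a • frameX p + b • frameY p := by
    unfold frameX frameY; fun_prop
  exact (h1.mul h2).smul h3

theorem tsupport_variationField_subset {a b : ℝ} (v : ℝ × ℝ → ℝ) (χ : ℝ → ℝ) :
    tsupport (variationField a b v χ) ⊆ chartInv a b ⁻¹' (tsupport v ×ˢ tsupport χ) := by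
  refine closure_minimal (fun p hp => ?_) (((isClosed_tsupport v).prod (isClosed_tsupport χ)).preimage
    (contDiff_chartInv a b (n := 0)).continuous)
  have h1 : v (chartInv a b p).1 * χ (chartInv a b p).2 ≠ 0 := fun h => hp (by
    simp only [variationField, h, zero_smul])
  exact ⟨subset_tsupport _ (left_ne_zero_of_mul h1), subset_tsupport _ (right_ne_zero_of_mul h1)⟩

theorem hasCompactSupport_variationField {a b : ℝ} (hab : a ^ 2 + b ^ 2 = 1) {v : ℝ × ℝ → ℝ}
    {χ : ℝ → ℝ} (hv : HasCompactSupport v) (hχ : HasCompactSupport χ) :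
    HasCompactSupport (variationField a b v χ) := by
  have h1 : IsCompact (chartInv a b ⁻¹' (tsupport v ×ˢ tsupport χ)) :=
    (chartHomeo hab).symm.isCompact_preimage.mpr (hv.isCompact.prod hχ.isCompact)
  exact h1.of_isClosed_subset (isClosed_tsupport _) (tsupport_variationField_subset v χ)

theorem isFlow_variationFlow {a b : ℝ} (hab : a ^ 2 + b ^ 2 = 1) (v : ℝ × ℝ → ℝ)
    {u₀ δ : ℝ} {χ : ℝ → ℝ} {θ : ℝ → ℝ → ℝ} (H : IsCutoffFlow u₀ δ χ θ) :
    IsFlow (variationField a b v χ) (variationFlow a b v θ) where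
  zero p := by
    simp only [variationFlow, zero_mul, H.zero, Prod.mk.eta, chart_chartInv hab]
  hasDerivAt s p := by
    set q := (chartInv a b p).1 with hq
    set u := (chartInv a b p).2
    have h1 : HasDerivAt (fun r => θ (r * v q) u) (χ (θ (s * v q) u) * v q) s := by
      have := (H.hasDerivAt (s * v q) u).comp s ((hasDerivAt_id s).mul_const (v q))
      simpa using! this
    have h2 : HasDerivAt (fun r => (q, θ (r * v q) u)) ((0 : ℝ × ℝ), χ (θ (s * v q) u) * v q) s :=
      (hasDerivAt_const s q).prodMk h1
    have h3 := (hasFDerivAt_chart a b (q, θ (s * v q) u)).comp_hasDerivAt s h2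
    refine h3.congr_deriv ?_
    have e : ((0 : ℝ × ℝ), χ (θ (s * v q) u) * v q) =
        (v q * χ (θ (s * v q) u)) • ((0 : ℝ × ℝ), (1 : ℝ)) := by
      simp [mul_comm]
    rw [e, map_smul, chartDeriv_transversal hab]
    simp only [variationField, variationFlow, chartInv_chart hab, ← hq]
    rfl

/-- The variation moves the subgraph of `g` to the subgraph of `g + s v`. -/
theorem isSubgraphIn_variationFlow {a b : ℝ} (hab : a ^ 2 + b ^ 2 = 1) {v g : ℝ × ℝ → ℝ}
    {D : Set (ℝ × ℝ)} {u₀ δ : ℝ} {χ : ℝ → ℝ} {θ : ℝ → ℝ → ℝ} (H : IsCutoffFlow u₀ δ χ θ)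
    {E : Set Heis} (hE : IsSubgraphIn a b D (Ioo (u₀ - δ) (u₀ + δ)) E g)
    (hg : ∀ q ∈ D, |g q - u₀| < δ / 4) {s : ℝ} (hs : ∀ q ∈ D, |s * v q| < δ / 4) :
    IsSubgraphIn a b D (Ioo (u₀ - δ) (u₀ + δ)) (variationFlow a b v θ s '' E)
      (fun q => g q + s * v q) := by
  intro q hq u hu
  have hmem := H.mem_Ioo hu (-(s * v q))
  have himg : chart a b (q, u) ∈ variationFlow a b v θ s '' E ↔
      chart a b (q, θ (-(s * v q)) u) ∈ E := by
    constructor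
    · rintro ⟨p, hp, he⟩
      have h1 := congrArg (chartInv a b) he
      rw [variationFlow, chartInv_chart hab, chartInv_chart hab, Prod.mk.injEq] at h1
      obtain ⟨h2, h3⟩ := h1
      rw [h2] at h3
      rw [← h3, H.neg_left, ← h2, Prod.mk.eta, chart_chartInv hab]
      exact hp
    · intro hp
      refine ⟨_, hp, ?_⟩
      simp only [variationFlow, chartInv_chart hab, H.neg_right]
  -- The flow carries `g q` exactly to `g q + s * v q`, and monotonicity of `θ` in `u` then
  -- transports both sides of the graph.
  have hval : θ (-(s * v q)) (g q + s * v q) = g q := by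
    rw [← H.eq_add (hg q hq) (hs q hq), H.neg_left]
  have hE' := hE q hq _ hmem
  constructor
  · intro hlt
    rw [himg]
    refine hE'.1 ?_
    rw [← hval]
    exact H.strictMono _ hlt
  · intro hlt
    rw [himg]
    refine hE'.2 ?_
    conv_lhs => rw [← hval]
    exact H.strictMono _ hlt

/-! ### The first variation -/

/-- Differentiation under the integral, for the perimeter term. The argument of `H` is the slope of
`g + s v`, exactly quadratic in `s`; on `(-1, 1)` it has Lipschitz constant `|l| + 2|k|`, which
gives the domination. -/
theorem hasDerivAt_setIntegral_comp {H : ℝ → ℝ} {L : NNReal} (hL : LipschitzWith L H)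
    (hd : Differentiable ℝ H) (hd' : Continuous (deriv H)) {w l k : ℝ × ℝ → ℝ} (hw : Continuous w)
    (hl : Continuous l) (hk : Continuous k) {D : Set (ℝ × ℝ)}
    (hDb : Bornology.IsBounded D) :
    HasDerivAt (fun s : ℝ => ∫ q in D, H (w q + s * l q + s ^ 2 * k q))
      (∫ q in D, deriv H (w q) * l q) 0 := by
  have hHc : Continuous H := hL.continuous
  have hint : ∀ s : ℝ, IntegrableOn (fun q => H (w q + s * l q + s ^ 2 * k q)) D := fun s =>
    Continuous.integrableOn_of_isBounded (by fun_prop) hDb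
  refine (hasDerivAt_integral_of_dominated_loc_of_lip (s := Ioo (-1 : ℝ) 1)
    (bound := fun q => L * (|l q| + 2 * |k q|)) (Ioo_mem_nhds (by norm_num) (by norm_num))
    (Eventually.of_forall fun s => (hint s).aestronglyMeasurable) (hint 0) ?_ ?_ ?_ ?_).2
  · exact Continuous.aestronglyMeasurable (by fun_prop)
  · refine Eventually.of_forall fun q => LipschitzOnWith.of_dist_le_mul fun s hs t ht => ?_
    refine (hL.dist_le_mul _ _).trans ?_
    rw [Real.dist_eq, Real.dist_eq, Real.coe_nnabs, 
      abs_of_nonneg (a := (L : ℝ) * (|l q| + 2 * |k q|)) (by positivity), mul_assoc]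
    refine mul_le_mul_of_nonneg_left ?_ L.coe_nonneg
    have e : w q + s * l q + s ^ 2 * k q - (w q + t * l q + t ^ 2 * k q) =
        (l q + (s + t) * k q) * (s - t) := by ring
    rw [e, abs_mul]
    refine mul_le_mul_of_nonneg_right ((abs_add_le _ _).trans ?_) (abs_nonneg _)
    rw [abs_mul]
    have : |s + t| ≤ 2 := by
      rw [abs_le]; constructor <;> linarith [hs.1, hs.2, ht.1, ht.2]
    have := mul_le_mul_of_nonneg_right this (abs_nonneg (k q))
    linarith
  · exact Continuous.integrableOn_of_isBounded (by fun_prop) hDb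
  · refine Eventually.of_forall fun q => ?_
    have h1 : HasDerivAt (fun s : ℝ => w q + s * l q + s ^ 2 * k q) (l q) 0 := by
      have := (((hasDerivAt_id (0 : ℝ)).mul_const (l q)).const_add (w q)).add
        (((hasDerivAt_id (0 : ℝ)).pow 2).mul_const (k q))
      exact this.congr_deriv (by simp)
    have h2 : HasDerivAt H (deriv H (w q)) (w q + 0 * l q + 0 ^ 2 * k q) := by
      simpa using (hd (w q)).hasDerivAt
    exact h2.comp (0 : ℝ) h1

/-- The volume term. The fundamental theorem of calculus gives the pointwise derivative; boundedness
of `F` on the compact region swept by the graphs gives the Lipschitz bound `C * |v q|`. -/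
theorem hasDerivAt_setIntegral_primitive {F : (ℝ × ℝ) × ℝ → ℝ} (hF : Continuous F)
    {g v : ℝ × ℝ → ℝ} (hg : Continuous g) (hv : Continuous v) {D : Set (ℝ × ℝ)} (hD : IsOpen D)
    (hDb : Bornology.IsBounded D) (c : ℝ) :
    HasDerivAt (fun s : ℝ => ∫ q in D, ∫ u in c..(g q + s * v q), F (q, u))
      (∫ q in D, F (q, g q) * v q) 0 := by
  have hcont : ∀ s : ℝ, Continuous fun q => ∫ u in c..(g q + s * v q), F (q, u) := fun s => by
    refine intervalIntegral.continuous_parametric_intervalIntegral_of_continuous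
      (f := fun q u => F (q, u)) ?_ (by fun_prop)
    exact hF
  have hint : ∀ s : ℝ, IntegrableOn (fun q => ∫ u in c..(g q + s * v q), F (q, u)) D := fun s =>
    (hcont s).integrableOn_of_isBounded hDb
  obtain ⟨R, hR⟩ := (hDb.isCompact_closure.image hg).isBounded.exists_norm_le
  obtain ⟨R', hR'⟩ := (hDb.isCompact_closure.image hv).isBounded.exists_norm_le
  obtain ⟨C, hC⟩ := ((hDb.isCompact_closure.prod (isCompact_Icc (a := -(R + R'))
    (b := R + R'))).image hF).isBounded.exists_norm_le
  refine (hasDerivAt_integral_of_dominated_loc_of_lip (s := Ioo (-1 : ℝ) 1)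
    (bound := fun q => C * |v q|) (Ioo_mem_nhds (by norm_num) (by norm_num))
    (Eventually.of_forall fun s => (hint s).aestronglyMeasurable) (hint 0) ?_ ?_ ?_ ?_).2
  · exact Continuous.aestronglyMeasurable (by fun_prop)
  · refine (ae_restrict_mem hD.measurableSet).mono fun q hq => ?_
    refine LipschitzOnWith.of_dist_le_mul fun s hs t ht => ?_
    have hq' := subset_closure hq
    have b1 : |g q| ≤ R := hR _ (mem_image_of_mem _ hq')
    have b2 : |v q| ≤ R' := hR' _ (mem_image_of_mem _ hq')
    have hmem : ∀ s ∈ Ioo (-1 : ℝ) 1, g q + s * v q ∈ Icc (-(R + R')) (R + R') := by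
      intro s hs
      have b3 : |s * v q| ≤ R' := by
        rw [abs_mul]
        have : |s| ≤ 1 := abs_le.mpr ⟨hs.1.le, hs.2.le⟩
        nlinarith [abs_nonneg s, abs_nonneg (v q)]
      constructor <;> linarith [(abs_le.mp b1).1, (abs_le.mp b1).2, (abs_le.mp b3).1,
        (abs_le.mp b3).2]
    have hii : ∀ x y : ℝ, IntervalIntegrable (fun u => F (q, u)) volume x y := fun x y =>
      Continuous.intervalIntegrable (by fun_prop) _ _
    rw [dist_eq_norm, intervalIntegral.integral_interval_sub_left (hii _ _) (hii _ _)]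
    have := intervalIntegral.norm_integral_le_of_norm_le_const (f := fun u => F (q, u))
      (a := g q + t * v q) (b := g q + s * v q) (C := C) fun u hu => by
        refine hC _ (mem_image_of_mem _ ⟨hq', ?_⟩)
        exact (ordConnected_Icc.uIcc_subset (hmem t ht) (hmem s hs)) (uIoc_subset_uIcc hu)
    refine this.trans ?_
    have e : g q + s * v q - (g q + t * v q) = v q * (s - t) := by ring
    rw [e, abs_mul, Real.dist_eq, Real.coe_nnabs, ← mul_assoc]
    exact mul_le_mul_of_nonneg_right (le_abs_self _) (abs_nonneg _)
  · exact Continuous.integrableOn_of_isBounded (by fun_prop) hDb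
  · refine Eventually.of_forall fun q => ?_
    have hFq : Continuous fun u => F (q, u) := by fun_prop
    have h1 : HasDerivAt (fun s : ℝ => g q + s * v q) (v q) 0 := by
      simpa using ((hasDerivAt_id (0 : ℝ)).mul_const (v q)).const_add (g q)
    have h2 := (intervalIntegral.integral_hasDerivAt_right (hFq.intervalIntegrable c (g q))
      (hFq.stronglyMeasurableAtFilter _ _) hFq.continuousAt)
    have h3 : HasDerivAt (fun y => ∫ u in c..y, F (q, u)) (F (q, g q)) (g q + 0 * v q) := by
      simpa using h2
    exact h3.comp (0 : ℝ) h1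

/-! ### The weak Euler–Lagrange equation. -/

/-- The derivative at `v` of `charSlope` at `g`. -/
noncomputable def charSlopeVariation (g v : ℝ × ℝ → ℝ) (q : ℝ × ℝ) : ℝ :=
  fderiv ℝ v q (1, -2 * g q) - 2 * fderiv ℝ g q (0, 1) * v q

/-- The slope `h_z - 2 h h_τ` is quadratic in `h`, so the expansion has no remainder. -/
theorem charSlope_add_mul {g v : ℝ × ℝ → ℝ} {q : ℝ × ℝ} (hg : DifferentiableAt ℝ g q)
    (hv : DifferentiableAt ℝ v q) (s : ℝ) :
    charSlope (fun q => g q + s * v q) q = charSlope g q + s * charSlopeVariation g v q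
      + s ^ 2 * (-2 * v q * fderiv ℝ v q (0, 1)) := by
  have h1 : fderiv ℝ (fun q => g q + s * v q) q = fderiv ℝ g q + s • fderiv ℝ v q :=
    (hg.hasFDerivAt.add (hv.hasFDerivAt.const_mul s)).fderiv
  have e : ∀ (φ : ℝ × ℝ →L[ℝ] ℝ) (x : ℝ), φ (1, x) = φ (1, 0) + x * φ (0, 1) := fun φ x => by
    rw [← smul_eq_mul, ← map_smul, ← map_add]; simp
  rw [charSlope_eq, charSlope_eq, charSlopeVariation, h1, e (fderiv ℝ v q)]
  simp only [add_apply, smul_apply, smul_eq_mul]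
  ring

theorem isBounded_cylinder {a b : ℝ} (hab : a ^ 2 + b ^ 2 = 1) {D : Set (ℝ × ℝ)} {J : Set ℝ}
    (hD : Bornology.IsBounded D) (hJ : Bornology.IsBounded J) :
    Bornology.IsBounded (cylinder a b D J) := by
  have h1 : IsCompact (chartInv a b ⁻¹' (closure D ×ˢ closure J)) :=
    (chartHomeo hab).symm.isCompact_preimage.mpr (hD.isCompact_closure.prod hJ.isCompact_closure)
  exact h1.isBounded.subset (preimage_mono (prod_mono subset_closure subset_closure))

/-- Fubini in the chart. `F` is a globally continuous stand-in for `f`, whose continuity is only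
known in `Ω`. -/
theorem IsSubgraphIn.setIntegral_inter_eq {a b : ℝ} (hab : a ^ 2 + b ^ 2 = 1) {D : Set (ℝ × ℝ)}
    (hD : IsOpen D) (hDb : Bornology.IsBounded D) {c d : ℝ} {E : Set Heis} {h : ℝ × ℝ → ℝ}
    (hE : IsSubgraphIn a b D (Ioo c d) E h) (hh : Continuous h) (hhJ : ∀ q ∈ D, h q ∈ Ioo c d)
    {f : Heis → ℝ} {F : (ℝ × ℝ) × ℝ → ℝ} (hF : Continuous F)
    (hFf : ∀ q ∈ D, ∀ u ∈ Ioo c d, F (q, u) = f (chart a b (q, u))) :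
    ∫ p in E ∩ cylinder a b D (Ioo c d), f p = ∫ q in D, ∫ u in c..h q, F (q, u) := by
  have hm : MeasurableSet {p : (ℝ × ℝ) × ℝ | p.2 < h p.1} :=
    (isOpen_lt continuous_snd (hh.comp continuous_fst)).measurableSet
  have hDJ : MeasurableSet (D ×ˢ Ioo c d) := (hD.prod isOpen_Ioo).measurableSet
  rw [hE.setIntegral_inter hab hh, setIntegral_congr_fun (g := F) (hm.inter hDJ)
    (fun p hp => (hFf p.1 hp.2.1 p.2 hp.2.2).symm), inter_comm, ← setIntegral_indicator hm,
    Measure.volume_eq_prod, setIntegral_prod]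
  · refine setIntegral_congr_fun hD.measurableSet fun q hq => ?_
    have e : ∀ u, {p : (ℝ × ℝ) × ℝ | p.2 < h p.1}.indicator F (q, u) =
        (Iio (h q)).indicator (fun u => F (q, u)) u := fun u => by
      simp only [indicator, mem_ofPred_eq, mem_Iio]
    simp_rw [e]
    rw [setIntegral_indicator measurableSet_Iio,
      intervalIntegral.integral_of_le (hhJ q hq).1.le, integral_Ioc_eq_integral_Ioo]
    congr 2
    ext u
    simp only [mem_inter_iff, mem_Ioo, mem_Iio]
    have := (hhJ q hq).2
    constructor
    · rintro ⟨⟨h1, h2⟩, h3⟩; exact ⟨h1, h3⟩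
    · rintro ⟨h1, h2⟩; exact ⟨⟨h1, h2.trans this⟩, h2⟩
  · rw [← Measure.volume_eq_prod]
    exact (hF.integrableOn_of_isBounded (hDb.prod (Metric.isBounded_Ioo _ _))).indicator hm

/-- The weak form of the prescribed mean curvature equation for a `C¹` graph. -/
theorem weak_equation {K : Set (ℝ × ℝ)} (hK : IsConvexC2Plus K) (hK0 : (0 : ℝ × ℝ) ∈ interior K)
    {Ω E : Set Heis} {f : Heis → ℝ} (hcurv : HasPrescribedMeanCurvature K Ω E f)
    {a b : ℝ} (hab : a ^ 2 + b ^ 2 = 1) {D : Set (ℝ × ℝ)} (hD : IsOpen D)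
    (hDb : Bornology.IsBounded D) {u₀ δ : ℝ} (hδ : 0 < δ)
    (hcl : closure (cylinder a b D (Ioo (u₀ - δ) (u₀ + δ))) ⊆ Ω) {g : ℝ × ℝ → ℝ}
    (hg : ContDiff ℝ 1 g) (hgu : ∀ q ∈ D, |g q - u₀| < δ / 4)
    (hE : IsSubgraphIn a b D (Ioo (u₀ - δ) (u₀ + δ)) E g)
    {F : (ℝ × ℝ) × ℝ → ℝ} (hF : Continuous F)
    (hFf : ∀ q ∈ D, ∀ u ∈ Ioo (u₀ - δ) (u₀ + δ), F (q, u) = f (chart a b (q, u)))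
    {v : ℝ × ℝ → ℝ} (hv : ContDiff ℝ ∞ v) (hvc : HasCompactSupport v) (hvs : tsupport v ⊆ D) :
    ∫ q, deriv (slopeSupport K a b) (charSlope g q) * charSlopeVariation g v q =
      ∫ q, F (q, g q) * v q := by
  obtain ⟨χ, θ, H⟩ := exists_isCutoffFlow u₀ hδ
  set J := Ioo (u₀ - δ) (u₀ + δ) with hJ
  set B := cylinder a b D J with hB
  have hv1 : ContDiff ℝ 1 v := hv.of_le (by exact_mod_cast le_top)
  obtain ⟨L, hL⟩ := lipschitzWith_slopeSupport hK.bounded ⟨0, interior_subset hK0⟩ a b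
  obtain ⟨hHd, hHd', -⟩ := slopeSupport_regularity hK hK0 hab
  obtain ⟨R, hR⟩ := hv.continuous.bounded_above_of_compact_support hvc
  have hBo : IsOpen B := isOpen_cylinder a b hD isOpen_Ioo
  obtain ⟨hfin, hder⟩ := hcurv.2 B hBo (isBounded_cylinder hab hDb (Metric.isBounded_Ioo _ _)) hcl
    (variationField a b v χ) (contDiff_variationField hv H.contDiff)
    (hasCompactSupport_variationField hab hvc H.compact)
    ((tsupport_variationField_subset v χ).trans (preimage_mono (prod_mono hvs H.support)))
    (variationFlow a b v θ) (isFlow_variationFlow hab v H)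
  -- Together with `hgu`, this keeps the moved graphs in the region where the cutoff flow is a
  -- translation.
  have hsmall : ∀ᶠ s in 𝓝 (0 : ℝ), ∀ q, |s * v q| < δ / 4 := by
    have h1 : ContinuousAt (fun s : ℝ => |s| * (|R| + 1)) 0 := by fun_prop
    have h2 : ∀ᶠ s in 𝓝 (0 : ℝ), |s| * (|R| + 1) < δ / 4 :=
      h1.eventually_lt_const (by simpa using hδ)
    filter_upwards [h2] with s hs q
    refine lt_of_le_of_lt ?_ hs
    rw [abs_mul]
    refine mul_le_mul_of_nonneg_left ?_ (abs_nonneg s)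
    have := (hR q).trans (le_abs_self R)
    rw [Real.norm_eq_abs] at this
    linarith
  have hgs : ∀ s : ℝ, ContDiff ℝ 1 fun q => g q + s * v q := fun s => by fun_prop
  have hsub : ∀ s : ℝ, (∀ q, |s * v q| < δ / 4) →
      IsSubgraphIn a b D J (variationFlow a b v θ s '' E) (fun q => g q + s * v q) := fun s hs =>
    isSubgraphIn_variationFlow hab H hE hgu fun q _ => hs q
  have hmemJ : ∀ s : ℝ, (∀ q, |s * v q| < δ / 4) → ∀ q ∈ D, g q + s * v q ∈ J := by
    intro s hs q hq
    have h1 := abs_lt.mp (hgu q hq)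
    have h2 := abs_lt.mp (hs q)
    exact ⟨by linarith, by linarith⟩
  set A : ℝ → ℝ := fun s => ∫ q in D, slopeSupport K a b (charSlope (fun q => g q + s * v q) q)
    with hA
  have hApos : ∀ s, 0 ≤ A s := fun s =>
    integral_nonneg fun q => (slopeSupport_pos hK.bounded hK0 hab _).le
  have hPle : ∀ᶠ s in 𝓝 (0 : ℝ),
      (perimeter K (variationFlow a b v θ s '' E) B).toReal ≤ A s := by
    filter_upwards [hsmall] with s hs
    exact ENNReal.toReal_le_of_le_ofReal (hApos s) (perimeter_subgraph_le hK.convex hK.bounded hK0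
      hab hD hDb isOpen_Ioo (hsub s hs) (hgs s))
  have hPeq : (perimeter K (variationFlow a b v θ 0 '' E) B).toReal = A 0 := by
    have hs := hsmall.self_of_nhds
    rw [perimeter_subgraph_eq hK.convex hK.bounded hK0 hab hD hDb isOpen_Ioo (hsub 0 hs) (hgs 0)
      (hmemJ 0 hs), ENNReal.toReal_ofReal (hApos 0)]
  have hA' : HasDerivAt A (∫ q in D, deriv (slopeSupport K a b) (charSlope g q) *
      charSlopeVariation g v q) 0 := by
    have hAe : A = fun s : ℝ => ∫ q in D, slopeSupport K a b (charSlope g q +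
        s * charSlopeVariation g v q + s ^ 2 * (-2 * v q * fderiv ℝ v q (0, 1))) := by
      funext s
      simp only [hA]
      simp_rw [charSlope_add_mul (hg.differentiable one_ne_zero _)
        (hv1.differentiable one_ne_zero _)]
    have c1 := hg.continuous
    have c2 := hv.continuous
    have c3 := hg.continuous_fderiv one_ne_zero
    have c4 := hv1.continuous_fderiv one_ne_zero
    rw [hAe]
    refine hasDerivAt_setIntegral_comp hL hHd hHd'.continuous (continuous_charSlope hg) ?_ ?_ hDb
    · unfold charSlopeVariation; fun_prop
    · fun_prop
  have hF' : HasDerivAt (fun s => ∫ p in variationFlow a b v θ s '' E ∩ B, f p)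
      (∫ q in D, F (q, g q) * v q) 0 := by
    refine (hasDerivAt_setIntegral_primitive hF hg.continuous hv.continuous hD hDb
      (u₀ - δ)).congr_of_eventuallyEq ?_
    filter_upwards [hsmall] with s hs
    exact (hsub s hs).setIntegral_inter_eq hab hD hDb (hgs s).continuous (hmemJ s hs) hF hFf
  -- `A s` bounds the perimeter from above for small `s`, with equality at `s = 0`. The difference
  -- of the two functionals thus has a minimum at `0`; both being differentiable, the derivatives
  -- agree. The exact perimeter is needed only at `s = 0`.
  have hmin : IsLocalMin (fun s => (A s - ∫ p in variationFlow a b v θ s '' E ∩ B, f p) -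
      ((perimeter K (variationFlow a b v θ s '' E) B).toReal -
        ∫ p in variationFlow a b v θ s '' E ∩ B, f p)) 0 := by
    filter_upwards [hPle] with s hs
    rw [hPeq]
    linarith
  have hzero := hmin.hasDerivAt_eq_zero ((hA'.sub hF').sub hder)
  have hoff : ∀ q, q ∉ D → v q = 0 ∧ fderiv ℝ v q = 0 := fun q hq =>
    ⟨image_eq_zero_of_notMem_tsupport fun h => hq (hvs h),
      image_eq_zero_of_notMem_tsupport fun h => hq (hvs (tsupport_fderiv_subset ℝ h))⟩
  rw [← setIntegral_eq_integral_of_forall_compl_eq_zero (s := D)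
      (f := fun q => deriv (slopeSupport K a b) (charSlope g q) * charSlopeVariation g v q),
    ← setIntegral_eq_integral_of_forall_compl_eq_zero (s := D) (f := fun q => F (q, g q) * v q)]
  · linarith
  · intro q hq; simp [hoff q hq]
  · intro q hq; simp [charSlopeVariation, hoff q hq]

/-! ### The weak equation along characteristics -/

/-- Weierstrass approximation of `τ'`, integrated from the common value at `c`. This supplies smooth
tube centres, since the weak equation admits only smooth test functions. -/
theorem exists_contDiff_approx {c d : ℝ} (hcd : c ≤ d) {τ τ' : ℝ → ℝ}
    (hτ : ∀ z ∈ Icc c d, HasDerivAt τ (τ' z) z) (hτ' : ContinuousOn τ' (Icc c d)) {ε : ℝ}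
    (hε : 0 < ε) :
    ∃ T : ℝ → ℝ, ContDiff ℝ ∞ T ∧
      ∀ z ∈ Icc c d, |deriv T z - τ' z| ≤ ε ∧ |T z - τ z| ≤ ε * (d - c) := by
  obtain ⟨P, hP⟩ := exists_polynomial_near_of_continuousOn c d τ' hτ' ε hε
  have hPc : Continuous fun z => P.eval z := P.continuous
  set T : ℝ → ℝ := fun z => τ c + ∫ y in c..z, P.eval y
  have hT : ∀ z, HasDerivAt T (P.eval z) z := fun z =>
    (hPc.integral_hasStrictDerivAt c z).hasDerivAt.const_add _
  have hTd : deriv T = fun z => P.eval z := funext fun z => (hT z).deriv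
  refine ⟨T, ?_, fun z hz => ⟨?_, ?_⟩⟩
  · rw [contDiff_infty_iff_deriv, hTd]
    exact ⟨fun z => (hT z).differentiableAt, by simpa using P.contDiff_aeval (𝕜 := ℝ) ∞⟩
  · rw [hTd]; exact (hP z hz).le
  · have h1 := (convex_Icc c d).norm_image_sub_le_of_norm_hasDerivWithin_le
      (f := fun z => T z - τ z) (f' := fun z => P.eval z - τ' z) (C := ε)
      (fun y hy => ((hT y).sub (hτ y hy)).hasDerivWithinAt) (fun y hy => (hP y hy).le)
      (left_mem_Icc.mpr hcd) hz
    have h2 : T c = τ c := by simp [T]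
    simp only [h2, sub_self, sub_zero, Real.norm_eq_abs] at h1
    refine h1.trans (mul_le_mul_of_nonneg_left ?_ hε.le)
    rw [abs_of_nonneg (by linarith [hz.1])]
    linarith [hz.2]

/-- The affine straightening of a tube around the graph of `T`. -/
noncomputable def tubeHomeo (T : ℝ → ℝ) (hT : Continuous T) {ε : ℝ} (hε : ε ≠ 0) : (ℝ × ℝ) ≃ₜ (ℝ × ℝ) where
  toFun p := (p.1, T p.1 + ε * p.2)
  invFun p := (p.1, (p.2 - T p.1) / ε)
  left_inv p := by ext <;> simp [hε]
  right_inv p := by ext <;> simp; field_simp; ring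
  continuous_toFun := by fun_prop
  continuous_invFun := by fun_prop

/-- A shear followed by scaling the second variable by `ε`. The factor `ε` occurs on both sides of
the weak equation and cancels there. -/
theorem integral_tube {T : ℝ → ℝ} (hT : Continuous T) {ε : ℝ} (hε : 0 < ε) {G : ℝ × ℝ → ℝ}
    (hG : Continuous G) (hGc : HasCompactSupport G) :
    ∫ q, G q = ε * ∫ p : ℝ × ℝ, G (p.1, T p.1 + ε * p.2) := by
  have h1 : Integrable (fun p : ℝ × ℝ => G (p.1, T p.1 + ε * p.2)) :=
    Continuous.integrable_of_hasCompactSupport (by fun_prop)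
      (hGc.comp_homeomorph (tubeHomeo T hT hε.ne'))
  have h2 : Integrable G := hG.integrable_of_hasCompactSupport hGc
  rw [Measure.volume_eq_prod] at h1 h2 ⊢
  rw [integral_prod _ h1, integral_prod _ h2, ← integral_const_mul]
  refine integral_congr_ae (Eventually.of_forall fun z => ?_)
  simp only
  rw [Measure.integral_comp_mul_left (fun y => G (z, T z + y)) ε,
    integral_add_left_eq_self (fun y => G (z, y)), smul_eq_mul, abs_of_pos (inv_pos.mpr hε),
    mul_inv_cancel_left₀ hε.ne']

/-- A test function concentrated on a tube of width `ε` around the graph of `T`. -/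
noncomputable def tubeTest (η ρ T : ℝ → ℝ) (ε : ℝ) (q : ℝ × ℝ) : ℝ := η q.1 * ρ ((q.2 - T q.1) / ε)

theorem contDiff_tubeTest {η ρ T : ℝ → ℝ} (hη : ContDiff ℝ ∞ η) (hρ : ContDiff ℝ ∞ ρ)
    (hT : ContDiff ℝ ∞ T) (ε : ℝ) : ContDiff ℝ ∞ (tubeTest η ρ T ε) := by
  unfold tubeTest
  fun_prop

theorem tsupport_tubeTest_subset {η ρ T : ℝ → ℝ} (hT : Continuous T) {ε : ℝ}
    (hε : 0 < ε) (hρ : tsupport ρ ⊆ Icc (-1) 1) :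
    tsupport (tubeTest η ρ T ε) ⊆
      (fun p : ℝ × ℝ => (p.1, T p.1 + ε * p.2)) '' (tsupport η ×ˢ Icc (-1) 1) := by
  have hcl : IsClosed ((fun p : ℝ × ℝ => (p.1, T p.1 + ε * p.2)) '' (tsupport η ×ˢ Icc (-1) 1)) :=
    (tubeHomeo T hT hε.ne').isClosedMap _ ((isClosed_tsupport η).prod isClosed_Icc)
  refine closure_minimal (fun q hq => ?_) hcl
  refine ⟨(q.1, (q.2 - T q.1) / ε), ⟨subset_tsupport _ (left_ne_zero_of_mul hq),
    hρ (subset_tsupport _ (right_ne_zero_of_mul hq))⟩, ?_⟩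
  ext
  · rfl
  · simp only; field_simp; ring

/-- With `x = -2g`, the last quotient is the mismatch between the characteristic velocity and `T'`
relative to the tube width. It stays bounded as `ε → 0` when `T` follows a characteristic closely
enough. -/
theorem fderiv_tubeTest {η ρ T : ℝ → ℝ} (hη : ContDiff ℝ ∞ η) (hρ : ContDiff ℝ ∞ ρ)
    (hT : ContDiff ℝ ∞ T) {ε : ℝ} (hε : ε ≠ 0) (z r x : ℝ) :
    fderiv ℝ (tubeTest η ρ T ε) (z, T z + ε * r) (1, x) =
      deriv η z * ρ r + η z * deriv ρ r * ((x - deriv T z) / ε) := by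
  have hd := (contDiff_tubeTest hη hρ hT ε).differentiable (by simp) (z, T z + ε * r)
  have hη' := (hη.differentiable (by simp) z).hasDerivAt
  have hT' := (hT.differentiable (by simp) z).hasDerivAt
  have hρ' := (hρ.differentiable (by simp) r).hasDerivAt
  have hl : HasDerivAt (fun s : ℝ => (z + s, T z + ε * r + s * x)) ((1 : ℝ), x) 0 := by
    have h1 : HasDerivAt (fun s : ℝ => z + s) 1 0 := (hasDerivAt_id (0 : ℝ)).const_add z
    have h2 : HasDerivAt (fun s : ℝ => T z + ε * r + s * x) x 0 := by
      simpa using ((hasDerivAt_id (0 : ℝ)).mul_const x).const_add (T z + ε * r)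
    exact h1.prodMk h2
  have h1 : HasDerivAt (fun s : ℝ => tubeTest η ρ T ε (z + s, T z + ε * r + s * x))
      (fderiv ℝ (tubeTest η ρ T ε) (z, T z + ε * r) (1, x)) 0 := by
    have hd' : HasFDerivAt (tubeTest η ρ T ε) (fderiv ℝ (tubeTest η ρ T ε) (z, T z + ε * r))
        (z + 0, T z + ε * r + 0 * x) := by simpa using hd.hasFDerivAt
    exact hd'.comp_hasDerivAt (0 : ℝ) hl
  have hz : HasDerivAt (fun s : ℝ => z + s) 1 0 := (hasDerivAt_id (0 : ℝ)).const_add z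
  have e1 : HasDerivAt (fun s : ℝ => η (z + s)) (deriv η z) 0 := by
    have : HasDerivAt η (deriv η z) (z + 0) := by simpa using hη'
    simpa using! this.comp (0 : ℝ) hz
  have e2 : HasDerivAt (fun s : ℝ => T (z + s)) (deriv T z) 0 := by
    have : HasDerivAt T (deriv T z) (z + 0) := by simpa using hT'
    simpa using! this.comp (0 : ℝ) hz
  have e3 : HasDerivAt (fun s : ℝ => (T z + ε * r + s * x - T (z + s)) / ε)
      ((x - deriv T z) / ε) 0 := by
    have h2 : HasDerivAt (fun s : ℝ => T z + ε * r + s * x) x 0 := by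
      simpa using ((hasDerivAt_id (0 : ℝ)).mul_const x).const_add (T z + ε * r)
    exact (h2.sub e2).div_const ε
  have e4 : HasDerivAt (fun s : ℝ => ρ ((T z + ε * r + s * x - T (z + s)) / ε))
      (deriv ρ r * ((x - deriv T z) / ε)) 0 := by
    have : HasDerivAt ρ (deriv ρ r) ((T z + ε * r + 0 * x - T (z + 0)) / ε) := by
      have e : (T z + ε * r + 0 * x - T (z + 0)) / ε = r := by field_simp; simp
      rw [e]; exact hρ'
    exact this.comp (0 : ℝ) e3
  have h2 := e1.mul e4
  have h3 := h1.unique h2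
  rw [h3, zero_mul, add_zero, add_zero, add_sub_cancel_left, mul_div_cancel_left₀ _ hε]
  ring

/-- The weak equation for a tube test function, after straightening the tube. -/
theorem integral_tubeTest {D : Set (ℝ × ℝ)} {g M φ : ℝ × ℝ → ℝ} (hg : ContDiff ℝ 1 g)
    (hM : Continuous M) (hφ : Continuous φ)
    (hweak : ∀ v : ℝ × ℝ → ℝ, ContDiff ℝ ∞ v → HasCompactSupport v → tsupport v ⊆ D →
      ∫ q, M q * charSlopeVariation g v q = ∫ q, φ q * v q)
    {η ρ T : ℝ → ℝ} (hη : ContDiff ℝ ∞ η) (hηc : HasCompactSupport η) (hρ : ContDiff ℝ ∞ ρ)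
    (hρs : tsupport ρ ⊆ Icc (-1) 1) (hT : ContDiff ℝ ∞ T) {ε : ℝ} (hε : 0 < ε)
    (hD : ∀ z ∈ tsupport η, ∀ r ∈ Icc (-1 : ℝ) 1, (z, T z + ε * r) ∈ D) :
    ∫ p : ℝ × ℝ, M (p.1, T p.1 + ε * p.2) * (deriv η p.1 * ρ p.2 +
      η p.1 * deriv ρ p.2 * ((-2 * g (p.1, T p.1 + ε * p.2) - deriv T p.1) / ε) -
      2 * fderiv ℝ g (p.1, T p.1 + ε * p.2) (0, 1) * (η p.1 * ρ p.2)) =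
    ∫ p : ℝ × ℝ, φ (p.1, T p.1 + ε * p.2) * (η p.1 * ρ p.2) := by
  set v := tubeTest η ρ T ε with hv
  have hvd : ContDiff ℝ ∞ v := contDiff_tubeTest hη hρ hT ε
  have hvd1 : ContDiff ℝ 1 v := hvd.of_le (by exact_mod_cast le_top)
  have hsub := tsupport_tubeTest_subset (η := η) hT.continuous hε hρs
  have hvc : HasCompactSupport v :=
    ((hηc.isCompact.prod isCompact_Icc).image
      (tubeHomeo T hT.continuous hε.ne').continuous).of_isClosed_subset (isClosed_tsupport _) hsub
  have hvD : tsupport v ⊆ D := by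
    refine hsub.trans ?_
    rintro _ ⟨p, ⟨h1, h2⟩, rfl⟩
    exact hD _ h1 _ h2
  have key := hweak v hvd hvc hvD
  have c1 := hg.continuous
  have c2 := hvd.continuous
  have c3 := hg.continuous_fderiv one_ne_zero
  have c4 := hvd1.continuous_fderiv one_ne_zero
  have hcv : HasCompactSupport (charSlopeVariation g v) := by
    refine hvc.mono' fun q hq => ?_
    by_contra hn
    refine hq ?_
    have h1 : v q = 0 := image_eq_zero_of_notMem_tsupport hn
    have h2 : fderiv ℝ v q = 0 :=
      image_eq_zero_of_notMem_tsupport fun h => hn (tsupport_fderiv_subset ℝ h)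
    simp [charSlopeVariation, h1, h2]
  rw [integral_tube hT.continuous hε 
      (G := fun q => M q * charSlopeVariation g v q)
      (by unfold charSlopeVariation; fun_prop) hcv.mul_left,
    integral_tube hT.continuous hε (G := fun q => φ q * v q) (by fun_prop) hvc.mul_left] at key
  have key2 := mul_left_cancel₀ hε.ne' key
  have ev : ∀ z r : ℝ, v (z, T z + ε * r) = η z * ρ r := fun z r => by
    simp only [hv, tubeTest, add_sub_cancel_left, mul_div_cancel_left₀ _ hε.ne']
  simp only [charSlopeVariation, ev] at key2
  simp only [hv, fderiv_tubeTest hη hρ hT hε.ne'] at key2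
  exact key2

theorem integrable_of_continuousOn_Icc {c d : ℝ} {h : ℝ → ℝ} (hc : ContinuousOn h (Icc c d))
    (h0 : ∀ z, z ∉ Icc c d → h z = 0) : Integrable h :=
  (integrableOn_iff_integrable_of_support_subset (s := Icc c d)
    fun z hz => by_contra fun hn => hz (h0 z hn)).mp (hc.integrableOn_compact isCompact_Icc)

/-- The integrand is `(r ρ)'`. This is the cancellation that removes `g_τ` from the limit equation.
-/
theorem integral_mul_deriv_add_eq_zero {ρ : ℝ → ℝ} (hρ : ContDiff ℝ 1 ρ)
    (hρc : HasCompactSupport ρ) : ∫ r, (r * deriv ρ r + ρ r) = 0 := by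
  have h := integral_fderiv_apply_eq_zero (E := ℝ) volume (F := fun r => r * ρ r)
    (contDiff_id.mul hρ) hρc.mul_left 1
  rw [← h]
  refine integral_congr_ae (Eventually.of_forall fun r => ?_)
  have : HasDerivAt (fun r => r * ρ r) (1 * ρ r + r * deriv ρ r) r :=
    (hasDerivAt_id r).mul (hρ.differentiable one_ne_zero r).hasDerivAt
  simp only [fderiv_eq_deriv_mul, this.deriv]
  ring

/-- The transversal offset is `r e n` to first order, so only the `τ`-derivative of `g` survives. -/
theorem tendsto_difference_quotient {g : ℝ × ℝ → ℝ} {x : ℝ × ℝ} (hg : DifferentiableAt ℝ g x)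
    {e y : ℕ → ℝ} (he : ∀ n, 0 < e n) (he0 : Tendsto e atTop (𝓝 0)) {r : ℝ}
    (hy : Tendsto (fun n => (y n - x.2) / e n) atTop (𝓝 r)) :
    Tendsto (fun n => (g (x.1, y n) - g x) / e n) atTop (𝓝 (r * fderiv ℝ g x (0, 1))) := by
  have hd : Tendsto (fun n => ((0 : ℝ), y n - x.2)) atTop (𝓝 0) := by
    refine tendsto_const_nhds.prodMk_nhds ?_
    have := hy.mul he0
    rw [mul_zero] at this
    exact this.congr fun n => div_mul_cancel₀ _ (he n).ne'
  have hv : Tendsto (fun n => (e n)⁻¹ • ((0 : ℝ), y n - x.2)) atTop (𝓝 ((0 : ℝ), r)) := by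
    have : Tendsto (fun n => ((0 : ℝ), (y n - x.2) / e n)) atTop (𝓝 ((0 : ℝ), r)) :=
      tendsto_const_nhds.prodMk_nhds hy
    refine this.congr fun n => ?_
    simp [div_eq_inv_mul]
  have h := (hg.hasFDerivAt.hasFDerivWithinAt (s := univ)).lim hd (by simp) hv
  have e1 : fderiv ℝ g x (0, r) = r * fderiv ℝ g x (0, 1) := by
    rw [← smul_eq_mul, ← map_smul]; simp
  rw [← e1]
  refine h.congr fun n => ?_
  have e2 : x + (0, y n - x.2) = (x.1, y n) := by ext <;> simp
  rw [e2, smul_eq_mul, div_eq_inv_mul]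

/-- Along a characteristic curve `τ' = -2g(z, τ)`, the function `M` is weakly differentiable with
derivative `-φ`. -/
theorem integral_characteristic {D : Set (ℝ × ℝ)} (hD : IsOpen D) {g M φ : ℝ × ℝ → ℝ}
    (hg : ContDiff ℝ 1 g) {L : NNReal} (hgL : LipschitzWith L g)
    (hM : Continuous M) (hφ : Continuous φ)
    (hweak : ∀ v : ℝ × ℝ → ℝ, ContDiff ℝ ∞ v → HasCompactSupport v → tsupport v ⊆ D →
      ∫ q, M q * charSlopeVariation g v q = ∫ q, φ q * v q)
    {c d : ℝ} (hcd : c < d) {τ : ℝ → ℝ} (hτ : ∀ z ∈ Icc c d, HasDerivAt τ (-2 * g (z, τ z)) z)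
    (hτD : ∀ z ∈ Icc c d, (z, τ z) ∈ D) {η : ℝ → ℝ} (hη : ContDiff ℝ ∞ η)
    (hηs : tsupport η ⊆ Ioo c d) :
    ∫ z, M (z, τ z) * deriv η z = ∫ z, φ (z, τ z) * η z := by
  have hηI : tsupport η ⊆ Icc c d := hηs.trans Ioo_subset_Icc_self
  have hηc : HasCompactSupport η := isCompact_Icc.of_isClosed_subset (isClosed_tsupport _) hηI
  have hη0 : ∀ z, z ∉ Icc c d → η z = 0 := fun z hz =>
    image_eq_zero_of_notMem_tsupport fun h => hz (hηI h)
  have hη'0 : ∀ z, z ∉ Icc c d → deriv η z = 0 := fun z hz =>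
    image_eq_zero_of_notMem_tsupport fun h => hz (hηI (tsupport_deriv_subset h))
  have hη1 : ContDiff ℝ 1 η := hη.of_le (by exact_mod_cast le_top)
  have hτc : ContinuousOn τ (Icc c d) := fun z hz => (hτ z hz).continuousAt.continuousWithinAt
  have hgrc : ContinuousOn (fun z => (z, τ z)) (Icc c d) := continuousOn_id.prodMk hτc
  have hgc := hg.continuous
  have hgd := hg.continuous_fderiv one_ne_zero
  set e : ℕ → ℝ := fun n => 1 / ((n : ℝ) + 1) with he
  have he0 : ∀ n, 0 < e n := fun n => by positivity
  have he1 : ∀ n, e n ≤ 1 := fun n => by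
    rw [he]; simp only; rw [div_le_one (by positivity)]; linarith [n.cast_nonneg (α := ℝ)]
  have helim : Tendsto e atTop (𝓝 0) := tendsto_one_div_add_atTop_nhds_zero_nat
  -- The accuracy is `(e n)²`, so the errors in both `T` and `T'` still tend to zero after division
  -- by the tube width `e n`.
  choose T hTd hT using fun n => exists_contDiff_approx hcd.le hτ
    (continuousOn_const.mul (hgc.comp_continuousOn hgrc)) (pow_pos (he0 n) 2)
  set N := d - c + 1 with hN
  have hN1 : 1 ≤ N := by linarith
  have hclose : ∀ n, ∀ z ∈ Icc c d, ∀ r ∈ Icc (-1 : ℝ) 1,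
      |T n z + e n * r - τ z| ≤ e n * N := by
    intro n z hz r hr
    have h1 := (hT n z hz).2
    have h2 : |e n * r| ≤ e n := by
      rw [abs_mul, abs_of_pos (he0 n)]
      exact mul_le_of_le_one_right (he0 n).le (abs_le.mpr hr)
    have h3 : T n z + e n * r - τ z = (T n z - τ z) + e n * r := by ring
    rw [h3]
    refine (abs_add_le _ _).trans ?_
    have h4 : e n ^ 2 * (d - c) ≤ e n * (d - c) :=
      mul_le_mul_of_nonneg_right (by nlinarith [he0 n, he1 n]) (by linarith)
    rw [hN]; linarith
  let bump : ContDiffBump (0 : ℝ) := ⟨1 / 2, 1, by norm_num, by norm_num⟩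
  set ρ : ℝ → ℝ := fun r => bump r with hρdef
  have hρ : ContDiff ℝ ∞ ρ := bump.contDiff
  have hρ1 : ContDiff ℝ 1 ρ := bump.contDiff
  have hρs : tsupport ρ ⊆ Icc (-1) 1 := by
    rw [hρdef, bump.tsupport_eq, Real.closedBall_eq_Icc]; simp [bump]
  have hρc : HasCompactSupport ρ := bump.hasCompactSupport
  have hρpos : 0 < ∫ r, ρ r := bump.integral_pos
  have hρ0 : ∀ r, r ∉ Icc (-1 : ℝ) 1 → ρ r = 0 := fun r hr =>
    image_eq_zero_of_notMem_tsupport fun h => hr (hρs h)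
  have hρ'0 : ∀ r, r ∉ Icc (-1 : ℝ) 1 → deriv ρ r = 0 := fun r hr =>
    image_eq_zero_of_notMem_tsupport fun h => hr (hρs (tsupport_deriv_subset h))
  -- the identities for the approximating tubes
  set left : ℕ → ℝ × ℝ → ℝ := fun n p => M (p.1, T n p.1 + e n * p.2) * (deriv η p.1 * ρ p.2 +
      η p.1 * deriv ρ p.2 * ((-2 * g (p.1, T n p.1 + e n * p.2) - deriv (T n) p.1) / e n) -
      2 * fderiv ℝ g (p.1, T n p.1 + e n * p.2) (0, 1) * (η p.1 * ρ p.2)) with hleft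
  set right : ℕ → ℝ × ℝ → ℝ := fun n p =>
    φ (p.1, T n p.1 + e n * p.2) * (η p.1 * ρ p.2) with hright
  -- The characteristic arc is compact in the open set `D`, so the closed tubes lie in `D` once `e n
  -- * N` is below a fixed distance.
  have hkey : ∀ᶠ n in atTop, ∫ p, left n p = ∫ p, right n p := by
    obtain ⟨r₀, hr₀, hsub⟩ := (isCompact_Icc.image_of_continuousOn hgrc).exists_thickening_subset_open
      hD (by rintro _ ⟨z, hz, rfl⟩; exact hτD z hz)
    have hlim : Tendsto (fun n => e n * N) atTop (𝓝 0) := by simpa using helim.mul_const N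
    filter_upwards [hlim.eventually_lt_const hr₀] with n hn
    refine integral_tubeTest hg hM hφ hweak hη hηc hρ hρs (hTd n) (he0 n) fun z hz r hr => ?_
    refine hsub (Metric.mem_thickening_iff.mpr ⟨_, mem_image_of_mem _ (hηI hz), ?_⟩)
    rw [Prod.dist_eq, dist_self, Real.dist_eq]
    exact max_lt hr₀ ((hclose n z (hηI hz) r hr).trans_lt hn)
  -- bounds
  obtain ⟨R, hR⟩ := (isCompact_Icc.image_of_continuousOn hτc).isBounded.exists_norm_le
  have hQc : IsCompact (Icc c d ×ˢ Icc (-(R + N)) (R + N)) := isCompact_Icc.prod isCompact_Icc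
  have hQ : ∀ n, ∀ p ∈ Icc c d ×ˢ Icc (-1 : ℝ) 1,
      (p.1, T n p.1 + e n * p.2) ∈ Icc c d ×ˢ Icc (-(R + N)) (R + N) := by
    rintro n ⟨z, r⟩ ⟨hz, hr⟩
    refine ⟨hz, ?_⟩
    have h1 := abs_le.mp ((hclose n z hz r hr).trans
      (mul_le_of_le_one_left (by linarith) (he1 n)))
    have h2 := abs_le.mp (hR _ (mem_image_of_mem τ hz))
    exact ⟨by simp only; linarith [h1.1, h2.1], by simp only; linarith [h1.2, h2.2]⟩
  obtain ⟨CM, hCM⟩ := hQc.exists_bound_of_continuousOn hM.continuousOn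
  obtain ⟨Cφ, hCφ⟩ := hQc.exists_bound_of_continuousOn hφ.continuousOn
  obtain ⟨Cg, hCg⟩ := hQc.exists_bound_of_continuousOn
    (f := fun q => fderiv ℝ g q (0, 1)) (by fun_prop)
  obtain ⟨Cη, hCη⟩ := hη.continuous.bounded_above_of_compact_support hηc
  obtain ⟨Cη', hCη'⟩ := (hη1.continuous_deriv le_rfl).bounded_above_of_compact_support hηc.deriv
  obtain ⟨Cρ, hCρ⟩ := hρ.continuous.bounded_above_of_compact_support hρc
  obtain ⟨Cρ', hCρ'⟩ := (hρ1.continuous_deriv le_rfl).bounded_above_of_compact_support hρc.deriv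
  -- Uniform bound for dominated convergence: the Lipschitz constant of `g` over a displacement `e n
  -- * N` gives `2 * L * N`, and the error in `T'` gives at most `1`.
  have hratio : ∀ n, ∀ z ∈ Icc c d, ∀ r ∈ Icc (-1 : ℝ) 1,
      |(-2 * g (z, T n z + e n * r) - deriv (T n) z) / e n| ≤ 1 + 2 * L * N := by
    intro n z hz r hr
    have h1 := (hT n z hz).1
    have h2 : |g (z, T n z + e n * r) - g (z, τ z)| ≤ L * (e n * N) := by
      have := hgL.dist_le_mul (z, T n z + e n * r) (z, τ z)
      rw [Real.dist_eq, Prod.dist_eq, dist_self, Real.dist_eq, max_eq_right (abs_nonneg _)] at this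
      exact this.trans (mul_le_mul_of_nonneg_left (hclose n z hz r hr) L.coe_nonneg)
    rw [abs_div, abs_of_pos (he0 n), div_le_iff₀ (he0 n)]
    have h3 : -2 * g (z, T n z + e n * r) - deriv (T n) z =
        -2 * (g (z, T n z + e n * r) - g (z, τ z)) + -(deriv (T n) z - -2 * g (z, τ z)) := by ring
    rw [h3]
    refine (abs_add_le _ _).trans ?_
    rw [abs_mul, abs_neg, abs_neg, abs_two]
    have h4 : e n ^ 2 ≤ e n := by nlinarith [he0 n, he1 n]
    linarith
  have hTc : ∀ n, Continuous (T n) := fun n => (hTd n).continuous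
  have hTc' : ∀ n, Continuous (deriv (T n)) := fun n =>
    ((hTd n).of_le (by exact_mod_cast le_top) : ContDiff ℝ 1 (T n)).continuous_deriv le_rfl
  have hηc' := hη1.continuous_deriv le_rfl
  have hρc' := hρ1.continuous_deriv le_rfl
  have hηcont := hη.continuous
  have hρcont := hρ.continuous
  have hbound : ∀ C : ℝ, Integrable ((Icc c d ×ˢ Icc (-1 : ℝ) 1).indicator fun _ => C) := fun C =>
    (integrable_indicator_iff (isCompact_Icc.prod isCompact_Icc).measurableSet).mpr
      (integrableOn_const (isCompact_Icc.prod isCompact_Icc).measure_lt_top.ne)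
  -- pointwise limits
  have hlimT : ∀ z ∈ Icc c d, ∀ r, Tendsto (fun n => (T n z + e n * r - τ z) / e n) atTop (𝓝 r) := by
    intro z hz r
    have h1 : Tendsto (fun n => (T n z - τ z) / e n) atTop (𝓝 0) := by
      refine squeeze_zero_norm (a := fun n => e n * (d - c)) (fun n => ?_)
        (by simpa using helim.mul_const (d - c))
      rw [Real.norm_eq_abs, abs_div, abs_of_pos (he0 n), div_le_iff₀ (he0 n)]
      exact ((hT n z hz).2).trans (by nlinarith)
    have h2 := h1.add_const r
    rw [zero_add] at h2
    refine h2.congr fun n => ?_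
    have := (he0 n).ne'
    field_simp
    ring
  have hlimS : ∀ z ∈ Icc c d, ∀ r, Tendsto (fun n => (z, T n z + e n * r)) atTop (𝓝 (z, τ z)) := by
    intro z hz r
    refine tendsto_const_nhds.prodMk_nhds ?_
    have h1 := ((hlimT z hz r).mul helim).add_const (τ z)
    rw [mul_zero, zero_add] at h1
    refine h1.congr fun n => ?_
    have := (he0 n).ne'
    field_simp
    ring
  -- Since `τ' = -2g` on the curve, the mismatch comes only from the displacement `e n * r` across
  -- it, and tends to `-2 r g_τ`.
  have hlimratio : ∀ z ∈ Icc c d, ∀ r,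
      Tendsto (fun n => (-2 * g (z, T n z + e n * r) - deriv (T n) z) / e n) atTop
        (𝓝 (-2 * (r * fderiv ℝ g (z, τ z) (0, 1)))) := by
    intro z hz r
    have h1 : Tendsto (fun n => (-2 * g (z, τ z) - deriv (T n) z) / e n) atTop (𝓝 0) := by
      refine squeeze_zero_norm (a := e) (fun n => ?_) helim
      rw [Real.norm_eq_abs, abs_div, abs_of_pos (he0 n), div_le_iff₀ (he0 n), abs_sub_comm]
      exact ((hT n z hz).1).trans (by nlinarith)
    have h2 := tendsto_difference_quotient (hg.differentiable one_ne_zero (z, τ z)) he0 helim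
      (hlimT z hz r)
    have h3 := (h2.const_mul (-2)).add h1
    rw [add_zero] at h3
    refine h3.congr fun n => ?_
    have := (he0 n).ne'
    field_simp
    ring
  have hlimL : Tendsto (fun n => ∫ p, left n p) atTop (𝓝 (∫ p : ℝ × ℝ,
      M (p.1, τ p.1) * (deriv η p.1 * ρ p.2 +
      η p.1 * deriv ρ p.2 * (-2 * (p.2 * fderiv ℝ g (p.1, τ p.1) (0, 1))) -
      2 * fderiv ℝ g (p.1, τ p.1) (0, 1) * (η p.1 * ρ p.2)))) := by
    refine tendsto_integral_of_dominated_convergence ((Icc c d ×ˢ Icc (-1 : ℝ) 1).indicator fun _ =>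
      CM * (Cη' * Cρ + Cη * Cρ' * (1 + 2 * L * N) + 2 * Cg * (Cη * Cρ))) (fun n => ?_)
      (hbound _) (fun n => Eventually.of_forall fun p => ?_) (Eventually.of_forall fun p => ?_)
    · have := hTc n
      have := hTc' n
      exact Continuous.aestronglyMeasurable (by simp only [hleft]; fun_prop)
    · by_cases hp : p ∈ Icc c d ×ˢ Icc (-1 : ℝ) 1
      · rw [indicator_of_mem hp]
        have hq := hQ n p hp
        have b1 := hCM _ hq
        have b2 := hCg _ hq
        have b3 := hratio n p.1 hp.1 p.2 hp.2
        rw [← Real.norm_eq_abs] at b3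
        have n1 := norm_nonneg (η p.1)
        have n2 := norm_nonneg (ρ p.2)
        have n3 := (norm_nonneg _).trans b1
        have n4 := (norm_nonneg _).trans b2
        have n5 := (norm_nonneg _).trans b3
        have n6 := n1.trans (hCη _)
        have n7 := n2.trans (hCρ _)
        have n8 := (norm_nonneg _).trans (hCη' p.1)
        have n9 := (norm_nonneg _).trans (hCρ' p.2)
        simp only [hleft]
        rw [norm_mul]
        refine mul_le_mul b1 ?_ (norm_nonneg _) n3
        refine (norm_sub_le _ _).trans (add_le_add ((norm_add_le _ _).trans (add_le_add ?_ ?_)) ?_)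
        · rw [norm_mul]; exact mul_le_mul (hCη' _) (hCρ _) n2 n8
        · rw [norm_mul, norm_mul]
          exact mul_le_mul (mul_le_mul (hCη _) (hCρ' _) (norm_nonneg _) n6) b3 (norm_nonneg _)
            (mul_nonneg n6 n9)
        · rw [norm_mul, norm_mul, norm_mul, Real.norm_two]
          exact mul_le_mul (mul_le_mul_of_nonneg_left b2 two_pos.le)
            (mul_le_mul (hCη _) (hCρ _) n2 n6) (mul_nonneg n1 n2) (by linarith)
      · rw [indicator_of_notMem hp]
        simp only [hleft]
        rw [mem_prod, not_and_or] at hp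
        rcases hp with hp | hp
        · simp [hη0 _ hp, hη'0 _ hp]
        · simp [hρ0 _ hp, hρ'0 _ hp]
    · by_cases hp : p.1 ∈ Icc c d
      · have t1 := (hM.tendsto (p.1, τ p.1)).comp (hlimS p.1 hp p.2)
        have t2 := ((show Continuous fun q => fderiv ℝ g q (0, 1) by fun_prop).tendsto
          (p.1, τ p.1)).comp (hlimS p.1 hp p.2)
        have t3 := hlimratio p.1 hp p.2
        exact t1.mul (((t3.const_mul (η p.1 * deriv ρ p.2)).const_add (deriv η p.1 * ρ p.2)).sub
          ((t2.const_mul 2).mul_const (η p.1 * ρ p.2)))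
      · simp [hleft, hη0 _ hp, hη'0 _ hp]
  have hlimR : Tendsto (fun n => ∫ p, right n p) atTop (𝓝 (∫ p : ℝ × ℝ,
      φ (p.1, τ p.1) * (η p.1 * ρ p.2))) := by
    refine tendsto_integral_of_dominated_convergence ((Icc c d ×ˢ Icc (-1 : ℝ) 1).indicator fun _ =>
      Cφ * (Cη * Cρ)) (fun n => ?_)
      (hbound _) (fun n => Eventually.of_forall fun p => ?_) (Eventually.of_forall fun p => ?_)
    · have := hTc n
      exact Continuous.aestronglyMeasurable (by simp only [hright]; fun_prop)
    · by_cases hp : p ∈ Icc c d ×ˢ Icc (-1 : ℝ) 1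
      · rw [indicator_of_mem hp]
        have b1 := hCφ _ (hQ n p hp)
        simp only [hright]
        rw [norm_mul, norm_mul]
        exact mul_le_mul b1 (mul_le_mul (hCη _) (hCρ _) (norm_nonneg _)
          ((norm_nonneg _).trans (hCη p.1))) (by positivity) ((norm_nonneg _).trans b1)
      · rw [indicator_of_notMem hp]
        simp only [hright]
        rw [mem_prod, not_and_or] at hp
        rcases hp with hp | hp
        · simp [hη0 _ hp]
        · simp [hρ0 _ hp]
    · by_cases hp : p.1 ∈ Icc c d
      · exact ((hφ.tendsto (p.1, τ p.1)).comp (hlimS p.1 hp p.2)).mul_const _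
      · simp [hright, hη0 _ hp]
  have hlim := tendsto_nhds_unique (hlimL.congr' hkey) hlimR
  -- evaluation of the limits
  set A : ℝ → ℝ := fun z => M (z, τ z) * deriv η z
  set B : ℝ → ℝ := fun z => M (z, τ z) * (-2 * fderiv ℝ g (z, τ z) (0, 1)) * η z
  set κ : ℝ → ℝ := fun r => r * deriv ρ r + ρ r
  have hA : Integrable A := by
    refine integrable_of_continuousOn_Icc (c := c) (d := d) ?_ fun z hz => by simp [A, hη'0 z hz]
    exact (hM.comp_continuousOn hgrc).mul hηc'.continuousOn
  have hB : Integrable B := by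
    refine integrable_of_continuousOn_Icc (c := c) (d := d) ?_ fun z hz => by simp [B, hη0 z hz]
    exact ((hM.comp_continuousOn hgrc).mul (continuousOn_const.mul
      ((show Continuous fun q => fderiv ℝ g q (0, 1) by fun_prop).comp_continuousOn hgrc))).mul
      hηcont.continuousOn
  have hρi : Integrable ρ := hρcont.integrable_of_hasCompactSupport hρc
  have hκi : Integrable κ := by
    refine Continuous.integrable_of_hasCompactSupport (by fun_prop) ?_
    exact hρc.deriv.mul_left.add hρc
  -- The limit splits as `A(z) ρ(r) + B(z) κ(r)` with `κ = r ρ' + ρ`. The second product integrates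
  -- to zero, and the common factor `∫ ρ > 0` is later cancelled.
  have e1 : ∫ p : ℝ × ℝ, M (p.1, τ p.1) * (deriv η p.1 * ρ p.2 +
      η p.1 * deriv ρ p.2 * (-2 * (p.2 * fderiv ℝ g (p.1, τ p.1) (0, 1))) -
      2 * fderiv ℝ g (p.1, τ p.1) (0, 1) * (η p.1 * ρ p.2)) = (∫ z, A z) * ∫ r, ρ r := by
    have : ∀ p : ℝ × ℝ, M (p.1, τ p.1) * (deriv η p.1 * ρ p.2 +
      η p.1 * deriv ρ p.2 * (-2 * (p.2 * fderiv ℝ g (p.1, τ p.1) (0, 1))) -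
      2 * fderiv ℝ g (p.1, τ p.1) (0, 1) * (η p.1 * ρ p.2)) = A p.1 * ρ p.2 + B p.1 * κ p.2 := by
      intro p; simp only [A, B, κ]; ring
    simp_rw [this]
    rw [Measure.volume_eq_prod, integral_add (hA.mul_prod hρi) (hB.mul_prod hκi),
      integral_prod_mul, integral_prod_mul, integral_mul_deriv_add_eq_zero hρ1 hρc]
    ring
  have e2 : ∫ p : ℝ × ℝ, φ (p.1, τ p.1) * (η p.1 * ρ p.2) =
      (∫ z, φ (z, τ z) * η z) * ∫ r, ρ r := by
    rw [← integral_prod_mul, ← Measure.volume_eq_prod]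
    simp_rw [mul_assoc]
  rw [e1, e2] at hlim
  exact mul_right_cancel₀ hρpos.ne' hlim

/-! ### From the weak to the classical derivative on an interval. -/

theorem exists_Icc_of_isCompact_subset_Ioo {c d : ℝ} (hcd : c < d) {S : Set ℝ} (hS : IsCompact S)
    (hSI : S ⊆ Ioo c d) : ∃ c' d', c < c' ∧ c' ≤ d' ∧ d' < d ∧ S ⊆ Icc c' d' := by
  have hmid : (c + d) / 2 ∈ Ioo c d := ⟨by linarith, by linarith⟩
  have hS' : IsCompact (insert ((c + d) / 2) S) := hS.insert _
  have hsub : insert ((c + d) / 2) S ⊆ Ioo c d := insert_subset hmid hSI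
  obtain ⟨c', hc'⟩ := hS'.exists_isLeast (insert_nonempty _ _)
  obtain ⟨d', hd'⟩ := hS'.exists_isGreatest (insert_nonempty _ _)
  exact ⟨c', d', (hsub hc'.1).1, hc'.2 hd'.1, (hsub hd'.1).2, fun x hx =>
    ⟨hc'.2 (mem_insert_of_mem _ hx), hd'.2 (mem_insert_of_mem _ hx)⟩⟩

/-- The primitive from `c` vanishes to the left of the support of `k`, and to the right because `k`
has mean zero. -/
theorem exists_compactly_supported_primitive {c d : ℝ} (hcd : c < d) {k : ℝ → ℝ}
    (hk : ContDiff ℝ ∞ k) (hkc : HasCompactSupport k) (hks : tsupport k ⊆ Ioo c d)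
    (hk0 : ∫ z, k z = 0) :
    ∃ η : ℝ → ℝ, ContDiff ℝ ∞ η ∧ tsupport η ⊆ Ioo c d ∧ deriv η = k := by
  obtain ⟨c', d', hc', hcd', hd', hsub⟩ := exists_Icc_of_isCompact_subset_Ioo hcd hkc.isCompact hks
  set η : ℝ → ℝ := fun z => ∫ y in c..z, k y
  have hη : ∀ z, HasDerivAt η (k z) z := fun z =>
    (hk.continuous.integral_hasStrictDerivAt c z).hasDerivAt
  have hd : deriv η = k := funext fun z => (hη z).deriv
  have hzero : ∀ y, y ∉ Icc c' d' → k y = 0 := fun y hy =>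
    image_eq_zero_of_notMem_tsupport fun h => hy (hsub h)
  refine ⟨η, ?_, ?_, hd⟩
  · rw [contDiff_infty_iff_deriv, hd]
    exact ⟨fun z => (hη z).differentiableAt, hk⟩
  · refine (closure_minimal (fun z hz => ?_) isClosed_Icc).trans (Icc_subset_Ioo hc' hd')
    by_contra hn
    apply hz
    rcases not_and_or.mp hn with h | h
    · have h1 : EqOn k 0 (uIcc c z) := fun y hy => hzero y fun hy' => by
        have := hy.2.trans_lt (max_lt hc' (not_le.mp h))
        linarith [hy'.1]
      rw [show η z = ∫ y in c..z, k y from rfl, intervalIntegral.integral_congr h1]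
      simp
    · have hle : c ≤ z := by linarith [not_le.mp h]
      rw [show η z = ∫ y in c..z, k y from rfl, intervalIntegral.integral_of_le hle, ← hk0]
      refine setIntegral_eq_integral_of_forall_compl_eq_zero fun y hy => ?_
      by_contra hne
      have hy' : y ∈ Icc c' d' := by_contra fun hn' => hne (hzero y hn')
      exact hy ⟨by linarith [hy'.1], by linarith [hy'.2, not_le.mp h]⟩

/-- The du Bois-Reymond lemma. -/
theorem hasDerivAt_of_weak {c d : ℝ} (hcd : c < d) {m φ : ℝ → ℝ} (hm : Continuous m)
    (hφ : Continuous φ)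
    (hweak : ∀ η : ℝ → ℝ, ContDiff ℝ ∞ η → tsupport η ⊆ Ioo c d →
      ∫ z, m z * deriv η z = ∫ z, φ z * η z) {z : ℝ} (hz : z ∈ Ioo c d) :
    HasDerivAt m (-φ z) z := by
  set Φ : ℝ → ℝ := fun z => ∫ y in c..z, φ y
  have hΦ : ∀ z, HasDerivAt Φ (φ z) z := fun z =>
    (hφ.integral_hasStrictDerivAt c z).hasDerivAt
  have hΦc : Continuous Φ := continuous_iff_continuousAt.mpr fun z => (hΦ z).continuousAt
  set h : ℝ → ℝ := fun z => m z + Φ z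
  have hh : Continuous h := hm.add hΦc
  have hcs : ∀ η : ℝ → ℝ, tsupport η ⊆ Ioo c d → HasCompactSupport η := fun η hη =>
    isCompact_Icc.of_isClosed_subset (isClosed_tsupport _) (hη.trans Ioo_subset_Icc_self)
  have hint : ∀ {a b : ℝ → ℝ}, Continuous a → Continuous b → HasCompactSupport b →
      Integrable fun z => a z * b z := fun ha hb hc =>
    (ha.mul hb).integrable_of_hasCompactSupport hc.mul_left
  -- Adding the primitive `Φ` of `φ` turns the weak equation into `h' = 0`; it remains to show that
  -- `h` is constant.
  have hzero : ∀ η : ℝ → ℝ, ContDiff ℝ ∞ η → tsupport η ⊆ Ioo c d →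
      ∫ z, h z * deriv η z = 0 := by
    intro η hη hs
    have hη1 : ContDiff ℝ 1 η := hη.of_le (by exact_mod_cast le_top)
    have hc := hcs η hs
    have hη' := hη1.continuous_deriv le_rfl
    have h1 := integral_mul_deriv_eq_deriv_mul_of_integrable (u := Φ) (v := η) (u' := φ)
      (v' := deriv η) (fun z _ => hΦ z)
      (fun z _ => (hη1.differentiable one_ne_zero z).hasDerivAt) (hint hΦc hη' hc.deriv)
      (hint hφ hη.continuous hc) (hint hΦc hη.continuous hc)
    have h2 : ∀ z, h z * deriv η z = m z * deriv η z + Φ z * deriv η z := fun z => by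
      simp only [h]; ring
    simp_rw [h2]
    rw [integral_add (hint hm hη' hc.deriv) (hint hΦc hη' hc.deriv), hweak η hη hs, h1]
    ring
  obtain ⟨ρ₀, hρ₀s, hρ₀c, hρ₀, hρ₀r, hρ₀z⟩ := exists_contDiff_tsupport_subset (n := ⊤)
    (isOpen_Ioo.mem_nhds hz)
  set P : ℝ := ∫ y, ρ₀ y with hP
  have hP0 : P ≠ 0 := by
    refine ((hρ₀.continuous.integral_pos_of_hasCompactSupport_nonneg_nonzero hρ₀c
      (fun y => (hρ₀r (mem_range_self y)).1) (x := z) ?_)).ne'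
    rw [hρ₀z]; exact one_ne_zero
  set C : ℝ := (∫ y, h y * ρ₀ y) / P
  have hconst : ∀ ζ : ℝ → ℝ, ContDiff ℝ ∞ ζ → HasCompactSupport ζ → tsupport ζ ⊆ Ioo c d →
      ∫ y, ζ y • (h y - C) = 0 := by
    intro ζ hζ hζc hζs
    -- A multiple of the fixed bump `ρ₀` is subtracted to reach mean zero, so that `k` is the
    -- derivative of a test function. The price is the constant `C`, the `ρ₀`-average of `h`.
    set k : ℝ → ℝ := fun y => ζ y - (∫ y, ζ y) / P * ρ₀ y
    have hρ₀' : ContDiff ℝ ∞ fun y => (∫ y, ζ y) / P * ρ₀ y := contDiff_const.mul hρ₀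
    have hρ₀c' : HasCompactSupport fun y => (∫ y, ζ y) / P * ρ₀ y := hρ₀c.mul_left
    have hiζ := hζ.continuous.integrable_of_hasCompactSupport (μ := volume) hζc
    have hiρ := hρ₀.continuous.integrable_of_hasCompactSupport (μ := volume) hρ₀c
    have hk0 : ∫ y, k y = 0 := by
      rw [integral_sub hiζ (hiρ.const_mul _), integral_const_mul, ← hP]
      field_simp
      ring
    have hks : tsupport k ⊆ Ioo c d := (tsupport_sub _ _).trans
      (union_subset hζs ((tsupport_mul_subset_right).trans hρ₀s))
    obtain ⟨η, hη, hηs, hηk⟩ := exists_compactly_supported_primitive hcd (hζ.sub hρ₀') (hcs k hks)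
      hks hk0
    have h0 := hzero η hη hηs
    have e1 : ∀ y, h y * deriv η y = h y * ζ y - (∫ y, ζ y) / P * (h y * ρ₀ y) := fun y => by
      rw [hηk]; ring
    have e2 : ∀ y, ζ y • (h y - C) = h y * ζ y - C * ζ y := fun y => by
      rw [smul_eq_mul]; ring
    simp_rw [e1] at h0
    simp_rw [e2]
    rw [integral_sub (hint hh hζ.continuous hζc) ((hint hh hρ₀.continuous hρ₀c).const_mul _),
      integral_const_mul] at h0
    rw [integral_sub (hint hh hζ.continuous hζc) (hiζ.const_mul _), integral_const_mul, ← h0]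
    ring
  have hae := isOpen_Ioo.ae_eq_zero_of_integral_contDiff_smul_eq_zero (μ := volume)
    ((hh.sub continuous_const).locallyIntegrable.locallyIntegrableOn (Ioo c d)) hconst
  have heq : EqOn h (fun _ => C) (Ioo c d) := by
    refine Measure.eqOn_open_of_ae_eq (μ := volume) ?_ isOpen_Ioo hh.continuousOn
      continuousOn_const
    rw [Filter.EventuallyEq, ae_restrict_iff' measurableSet_Ioo]
    filter_upwards [hae] with y hy hyI
    exact sub_eq_zero.mp (hy hyI)
  have hev : m =ᶠ[𝓝 z] fun y => C - Φ y := by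
    filter_upwards [isOpen_Ioo.mem_nhds hz] with y hy
    have h1 : m y + Φ y = C := heq hy
    linarith
  exact ((hΦ z).const_sub C).congr_of_eventuallyEq hev

/-! ### The boundary as a graph in adapted coordinates -/

theorem finrank_horizontalPlane (p : Heis) : Module.finrank ℝ (horizontalPlane p) = 2 := by
  have hli : LinearIndependent ℝ ![frameX p, frameY p] := by
    refine LinearIndependent.pair_iff.mpr fun s t h => ?_
    have h1 := congrArg Prod.fst h
    have h2 := congrArg (fun v : Heis => v.2.1) h
    simp [frameX, frameY] at h1 h2
    exact ⟨h1, h2⟩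
  have h := finrank_span_eq_card hli
  rwa [Matrix.range_cons, Matrix.range_cons, Matrix.range_empty, union_empty,
    singleton_union, Fintype.card_fin] at h

/-- The horizontal plane lies in the kernel, and both have dimension two. Thus at a nonsingular
point `Xφ` and `Yφ` cannot both vanish. -/
theorem ker_eq_horizontalPlane {p : Heis} {L : Heis →L[ℝ] ℝ} (hL : L ≠ 0)
    (hX : L (frameX p) = 0) (hY : L (frameY p) = 0) :
    LinearMap.ker L.toLinearMap = horizontalPlane p := by
  symm
  refine Submodule.eq_of_le_of_finrank_eq (Submodule.span_le.mpr ?_) ?_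
  · rintro v (rfl | rfl)
    · exact hX
    · exact hY
  · have h0 : L.toLinearMap ≠ 0 := fun h => hL (ContinuousLinearMap.coe_injective h)
    have h1 := Module.Dual.finrank_ker_add_one_of_ne_zero h0
    have h2 : Module.finrank ℝ Heis = 3 := by simp [Heis]
    rw [finrank_horizontalPlane]
    omega

theorem exists_unit_direction {x y : ℝ} (h : x ≠ 0 ∨ y ≠ 0) :
    ∃ a b : ℝ, a ^ 2 + b ^ 2 = 1 ∧ 0 < a * x + b * y := by
  have hpos : 0 < x ^ 2 + y ^ 2 := by rcases h with h | h <;> positivity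
  have hs := Real.sqrt_pos.mpr hpos
  have hsq := Real.sq_sqrt hpos.le
  refine ⟨x / √(x ^ 2 + y ^ 2), y / √(x ^ 2 + y ^ 2), ?_, ?_⟩
  · rw [div_pow, div_pow, hsq, ← add_div, div_self hpos.ne']
  · have : x / √(x ^ 2 + y ^ 2) * x + y / √(x ^ 2 + y ^ 2) * y =
        (x ^ 2 + y ^ 2) / √(x ^ 2 + y ^ 2) := by ring
    rw [this]
    positivity

/-- Off the singular set there is a unit horizontal direction pointing out of the set. -/
theorem exists_transversal_direction {Ω E : Set Heis} {p : Heis}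
    (hp : p ∈ bdry Ω E \ singularSet Ω E) {φ : Heis → ℝ} (hφ : IsDefiningFunction E p φ) :
    ∃ a b : ℝ, a ^ 2 + b ^ 2 = 1 ∧ 0 < fderiv ℝ φ p (a • frameX p + b • frameY p) := by
  have h : fderiv ℝ φ p (frameX p) ≠ 0 ∨ fderiv ℝ φ p (frameY p) ≠ 0 := by
    by_contra! hn
    exact hp.2 ⟨hp.1, φ, hφ, ker_eq_horizontalPlane hφ.2.1 hn.1 hn.2⟩
  obtain ⟨a, b, hab, hpos⟩ := exists_unit_direction h
  exact ⟨a, b, hab, by simpa using hpos⟩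

/-- Localization of an implicitly defined function to a globally defined function. -/
theorem exists_contDiff_extension {g₀ : ℝ × ℝ → ℝ} {q₀ : ℝ × ℝ} (hg₀ : ContDiffAt ℝ 1 g₀ q₀) :
    ∃ (g : ℝ × ℝ → ℝ) (L : NNReal), ContDiff ℝ 1 g ∧ LipschitzWith L g ∧ g =ᶠ[𝓝 q₀] g₀ := by
  obtain ⟨O, hO, hgO⟩ := hg₀.contDiffOn le_rfl (by simp)
  obtain ⟨r, hr, hrO⟩ := Metric.nhds_basis_closedBall.mem_iff.mp (interior_mem_nhds.mpr hO)
  obtain ⟨χ, hχ, hχc, hχs, hχ1, -⟩ := exists_contDiff_cutoff (isCompact_closedBall q₀ r)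
    isOpen_interior hrO
  have hχ' : ContDiff ℝ 1 χ := hχ.of_le (by exact_mod_cast le_top)
  have hg : ContDiff ℝ 1 fun q => χ q * g₀ q := by
    refine contDiff_iff_contDiffAt.mpr fun q => ?_
    by_cases hq : q ∈ tsupport χ
    · exact hχ'.contDiffAt.mul (hgO.contDiffAt (mem_interior_iff_mem_nhds.mp (hχs hq)))
    · refine contDiffAt_const (c := (0 : ℝ)) |>.congr_of_eventuallyEq ?_
      filter_upwards [(isClosed_tsupport χ).isOpen_compl.mem_nhds hq] with x hx
      rw [image_eq_zero_of_notMem_tsupport hx, zero_mul]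
  obtain ⟨L, hL⟩ := hg.lipschitzWith_of_hasCompactSupport hχc.mul_right one_ne_zero
  refine ⟨_, L, hg, hL, ?_⟩
  filter_upwards [Metric.closedBall_mem_nhds q₀ hr] with q hq
  rw [hχ1 q hq, one_mul]

/-- Near a point where a defining function increases in the direction `aX + bY`, the set is a
subgraph in adapted coordinates. -/
theorem exists_isSubgraphIn {Ω E : Set Heis} (hΩ : IsOpen Ω) {p : Heis} (hp : p ∈ Ω)
    {φ : Heis → ℝ} (hφ : IsDefiningFunction E p φ) {a b : ℝ} (hab : a ^ 2 + b ^ 2 = 1)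
    (hpos : 0 < fderiv ℝ φ p (a • frameX p + b • frameY p)) :
    ∃ (r δ : ℝ) (g : ℝ × ℝ → ℝ) (L : NNReal), 0 < r ∧ 0 < δ ∧ ContDiff ℝ 1 g ∧
      LipschitzWith L g ∧
      (∀ q ∈ Metric.ball (chartInv a b p).1 r, |g q - (chartInv a b p).2| < δ / 4) ∧
      IsSubgraphIn a b (Metric.ball (chartInv a b p).1 r)
        (Ioo ((chartInv a b p).2 - δ) ((chartInv a b p).2 + δ)) E g ∧
      ∀ q ∈ Metric.closedBall (chartInv a b p).1 r,
        ∀ u ∈ Icc ((chartInv a b p).2 - δ) ((chartInv a b p).2 + δ), chart a b (q, u) ∈ Ω := by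
  obtain ⟨hφ0, -, U, hU, hpU, hφU, hUE⟩ := hφ
  set x₀ := chartInv a b p with hx₀
  have hpx : chart a b x₀ = p := chart_chartInv hab p
  set ψ : (ℝ × ℝ) × ℝ → ℝ := fun x => φ (chart a b x) with hψ
  have hcc : Continuous (chart a b) := (contDiff_chart a b (n := 0)).continuous
  have hV : IsOpen (chart a b ⁻¹' U) := hU.preimage hcc
  have hψV : ContDiffOn ℝ 1 ψ (chart a b ⁻¹' U) :=
    hφU.comp (contDiff_chart a b).contDiffOn fun x hx => hx
  have hx₀V : x₀ ∈ chart a b ⁻¹' U := by rw [mem_preimage, hpx]; exact hpU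
  have hψ0 : ContDiffAt ℝ 1 ψ x₀ := hψV.contDiffAt (hV.mem_nhds hx₀V)
  have hdψ : fderiv ℝ ψ x₀ (0, 1) = fderiv ℝ φ p (a • frameX p + b • frameY p) := by
    have h1 : DifferentiableAt ℝ φ (chart a b x₀) := by
      rw [hpx]
      exact (hφU.contDiffAt (hU.mem_nhds hpU)).differentiableAt one_ne_zero
    have h2 : HasFDerivAt ψ _ x₀ := h1.hasFDerivAt.comp x₀ (hasFDerivAt_chart a b x₀)
    rw [h2.fderiv, ContinuousLinearMap.comp_apply, chartDeriv_transversal hab, hpx]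
  have hinv : (fderiv ℝ ψ x₀ ∘L .inr ℝ (ℝ × ℝ) ℝ).IsInvertible := by
    have hne : fderiv ℝ ψ x₀ (0, 1) ≠ 0 := by rw [hdψ]; exact hpos.ne'
    refine ⟨ContinuousLinearEquiv.unitsEquivAut ℝ (Units.mk0 _ hne), ?_⟩
    ext
    simp
  -- The implicit function exists only locally; it is cut off to a global C¹ Lipschitz function, the
  -- form used by the weak equation and the tube estimates.
  obtain ⟨g, L, hg, hL, hgg⟩ := exists_contDiff_extension
    (hψ0.contDiffAt_implicitFunction one_ne_zero hinv)
  have hg0 : g x₀.1 = x₀.2 := by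
    rw [hgg.eq_of_nhds]
    exact hψ0.implicitFunction_apply_self one_ne_zero hinv
  have hψg : ∀ᶠ q in 𝓝 x₀.1, ψ (q, g q) = 0 := by
    filter_upwards [hgg, hψ0.eventually_apply_implicitFunction one_ne_zero hinv] with q h1 h2
    rw [h1, h2, hψ]
    simp only [hpx, hφ0]
  have hnear : ∀ᶠ x in 𝓝 x₀, chart a b x ∈ U ∧ chart a b x ∈ Ω ∧ 0 < fderiv ℝ ψ x (0, 1) := by
    refine Eventually.and (hV.mem_nhds hx₀V) (Eventually.and ((hΩ.preimage hcc).mem_nhds (by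
      rw [mem_preimage, hpx]; exact hp)) ?_)
    have h1 : ContinuousAt (fun x => fderiv ℝ ψ x (0, 1)) x₀ :=
      ((hψV.continuousOn_fderiv_of_isOpen hV le_rfl).continuousAt (hV.mem_nhds hx₀V)).clm_apply
        continuousAt_const
    exact h1.eventually (lt_mem_nhds (hpos.trans_eq hdψ.symm))
  -- The height `δ` is fixed first; the base radius is then shrunk so that `g` varies by less than
  -- `δ / 4`, leaving room for the variation.
  obtain ⟨δ, hδ, hδn⟩ := Metric.nhds_basis_closedBall.eventually_iff.mp hnear
  have hgδ : ∀ᶠ q in 𝓝 x₀.1, |g q - x₀.2| < δ / 4 := by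
    have hc : ContinuousAt (fun q => |g q - x₀.2|) x₀.1 :=
      (hg.continuous.sub continuous_const).abs.continuousAt
    refine hc.eventually (gt_mem_nhds ?_)
    simp only [hg0, sub_self, abs_zero]
    positivity
  obtain ⟨r, hr, hrn⟩ := Metric.nhds_basis_closedBall.eventually_iff.mp (hψg.and hgδ)
  have hmem : ∀ q ∈ Metric.closedBall x₀.1 (min r δ), ∀ u ∈ Icc (x₀.2 - δ) (x₀.2 + δ),
      (q, u) ∈ Metric.closedBall x₀ δ := fun q hq u hu => by
    rw [← Real.closedBall_eq_Icc] at hu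
    rw [Metric.mem_closedBall, Prod.dist_eq]
    exact max_le ((Metric.mem_closedBall.mp hq).trans (min_le_right _ _)) hu
  refine ⟨min r δ, δ, g, L, lt_min hr hδ, hδ, hg, hL, fun q hq => ?_, fun q hq u hu => ?_,
    fun q hq u hu => (hδn (hmem q hq u hu)).2.1⟩
  · exact (hrn (Metric.ball_subset_closedBall.trans
      (Metric.closedBall_subset_closedBall (min_le_left _ _)) hq)).2
  · have hq' := Metric.ball_subset_closedBall hq
    obtain ⟨h0, h1⟩ := hrn (Metric.closedBall_subset_closedBall (min_le_left _ _) hq')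
    have hgJ : g q ∈ Ioo (x₀.2 - δ) (x₀.2 + δ) := by
      rw [abs_lt] at h1
      constructor <;> linarith
    have hd : ∀ u ∈ Ioo (x₀.2 - δ) (x₀.2 + δ),
        HasDerivAt (fun u => ψ (q, u)) (fderiv ℝ ψ (q, u) (0, 1)) u := fun u hu => by
      have h2 := (hδn (hmem q hq' u (Ioo_subset_Icc_self hu))).1
      have h3 := (hψV.contDiffAt (hV.mem_nhds h2)).differentiableAt one_ne_zero
      exact h3.hasFDerivAt.comp_hasDerivAt u ((hasDerivAt_const u q).prodMk (hasDerivAt_id u))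
    -- Strict monotonicity in `u`, with `ψ (q, g q) = 0`, makes the sign of `ψ` the sign of `u - g
    -- q`.
    have hmono : StrictMonoOn (fun u => ψ (q, u)) (Ioo (x₀.2 - δ) (x₀.2 + δ)) := by
      refine strictMonoOn_of_deriv_pos (convex_Ioo _ _)
        (fun u hu => (hd u hu).continuousAt.continuousWithinAt) fun u hu => ?_
      rw [interior_Ioo] at hu
      rw [(hd u hu).deriv]
      exact (hδn (hmem q hq' u (Ioo_subset_Icc_self hu))).2.2
    have hUu := (hδn (hmem q hq' u (Ioo_subset_Icc_self hu))).1
    refine ⟨fun h => (hUE _ hUu).1 ?_, fun h => (hUE _ hUu).2 ?_⟩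
    · exact (hmono hu hgJ h).trans_eq h0
    · exact h0.symm.trans_lt (hmono hgJ hu h)

/-! ### Frontier, normal and characteristic vector of a subgraph. -/

theorem IsSubgraphIn.eq_of_mem_frontier {a b : ℝ} (hab : a ^ 2 + b ^ 2 = 1) {D : Set (ℝ × ℝ)}
    {J : Set ℝ} (hD : IsOpen D) (hJ : IsOpen J) {E : Set Heis} {g : ℝ × ℝ → ℝ}
    (hE : IsSubgraphIn a b D J E g) (hg : Continuous g) {p : Heis} (hp : p ∈ frontier E)
    (hpc : p ∈ cylinder a b D J) : (chartInv a b p).2 = g (chartInv a b p).1 := by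
  have hci : Continuous (chartInv a b) := (contDiff_chartInv a b (n := 0)).continuous
  have hsub : ∀ x ∈ cylinder a b D J,
      ((chartInv a b x).2 < g (chartInv a b x).1 → x ∈ E) ∧
      (g (chartInv a b x).1 < (chartInv a b x).2 → x ∉ E) := fun x hx => by
    have := hE (chartInv a b x).1 hx.1 (chartInv a b x).2 hx.2
    rwa [Prod.mk.eta, chart_chartInv hab] at this
  have hc := (isOpen_cylinder a b hD hJ).mem_nhds hpc
  -- Off the graph, a point of the cylinder is interior to `E` or to its complement.
  rcases lt_trichotomy (chartInv a b p).2 (g (chartInv a b p).1) with h | h | h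
  · refine absurd (mem_interior_iff_mem_nhds.mpr ?_) hp.2
    filter_upwards [hc, (isOpen_lt hci.snd (hg.comp hci.fst)).mem_nhds h] with x h1 h2
    exact (hsub x h1).1 h2
  · exact h
  · refine absurd hp.1 ?_
    rw [← mem_compl_iff, ← interior_compl, mem_interior_iff_mem_nhds]
    filter_upwards [hc, (isOpen_lt (hg.comp hci.fst) hci.snd).mem_nhds h] with x h1 h2
    exact (hsub x h1).2 h2

/-- Pushing a vector of `ker G` slightly along `-e` enters `{G < 0}`, so in the limit `L ≤ 0` on
`ker G`; by symmetry `L = 0` there. This compares the differentials of two functions describing the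
same set. -/
theorem eq_smul_of_forall_neg {V : Type*} [AddCommGroup V] [Module ℝ V] {L G : V →ₗ[ℝ] ℝ}
    (h : ∀ v, G v < 0 → L v ≤ 0) {e : V} (he : G e = 1) :
    0 ≤ L e ∧ ∀ v, L v = L e * G v := by
  have h0 : 0 ≤ L e := by
    have := h (-e) (by rw [map_neg, he]; norm_num)
    rw [map_neg] at this
    linarith
  have h1 : ∀ v, G v = 0 → L v ≤ 0 := fun v hv => by
    refine le_of_forall_pos_le_add fun ε hε => ?_
    have hp : 0 < ε / (L e + 1) := by positivity
    have := h (v - (ε / (L e + 1)) • e) (by rw [map_sub, map_smul, he, hv]; simpa using hp)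
    rw [map_sub, map_smul, smul_eq_mul] at this
    have h2 : ε / (L e + 1) * L e ≤ ε := by
      rw [div_mul_eq_mul_div, div_le_iff₀ (by positivity)]
      nlinarith
    linarith
  refine ⟨h0, fun v => ?_⟩
  have hG : G (v - G v • e) = 0 := by rw [map_sub, map_smul, he]; simp
  have h2 := h1 _ hG
  have h3 := h1 (-(v - G v • e)) (by rw [map_neg, hG, neg_zero])
  rw [map_neg] at h3
  rw [map_sub, map_smul, smul_eq_mul] at h2 h3
  linarith

/-- The horizontal gradient of a defining function of a subgraph is determined up to a positive
factor. -/
theorem IsSubgraphIn.frameGradient_eq {a b : ℝ} (hab : a ^ 2 + b ^ 2 = 1) {D : Set (ℝ × ℝ)}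
    {J : Set ℝ} (hD : IsOpen D) (hJ : IsOpen J) {E : Set Heis} {g : ℝ × ℝ → ℝ}
    (hE : IsSubgraphIn a b D J E g) (hg : ContDiff ℝ 1 g) {q : ℝ × ℝ} (hq : q ∈ D)
    (hgq : g q ∈ J) {φ : Heis → ℝ} (hφ : IsDefiningFunction E (chart a b (q, g q)) φ) :
    ∃ c : ℝ, 0 < c ∧ (frameGradient φ (chart a b (q, g q))).1 = c * (a + b * charSlope g q) ∧
      (frameGradient φ (chart a b (q, g q))).2.1 = c * (b - a * charSlope g q) := by
  obtain ⟨hφ0, hφne, U, hU, hpU, hφU, hUE⟩ := hφ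
  set x₀ : (ℝ × ℝ) × ℝ := (q, g q) with hx₀
  have hφd : DifferentiableAt ℝ φ (chart a b x₀) :=
    (hφU.contDiffAt (hU.mem_nhds hpU)).differentiableAt one_ne_zero
  set A := fderiv ℝ φ (chart a b x₀) with hA
  have hψ : HasFDerivAt (fun x => φ (chart a b x)) (A.comp (chartDeriv a b x₀)) x₀ :=
    hφd.hasFDerivAt.comp x₀ (hasFDerivAt_chart a b x₀)
  have hG : HasFDerivAt (fun x : (ℝ × ℝ) × ℝ => x.2 - g x.1)
      (ContinuousLinearMap.snd ℝ (ℝ × ℝ) ℝ -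
        (fderiv ℝ g q).comp (ContinuousLinearMap.fst ℝ (ℝ × ℝ) ℝ)) x₀ :=
    hasFDerivAt_snd.fun_sub (HasFDerivAt.comp x₀
      (hg.differentiable one_ne_zero q).hasFDerivAt hasFDerivAt_fst)
  set B := ContinuousLinearMap.snd ℝ (ℝ × ℝ) ℝ -
    (fderiv ℝ g q).comp (ContinuousLinearMap.fst ℝ (ℝ × ℝ) ℝ) with hB
  -- A direction that decreases `u - g` enters `E`; if `φ` increased along it, the same points would
  -- lie outside `E`.
  have hneg : ∀ ξ, B ξ < 0 → A.comp (chartDeriv a b x₀) ξ ≤ 0 := by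
    intro ξ hξ
    have hl : HasDerivAt (fun t : ℝ => x₀ + t • ξ) ξ 0 := by
      simpa using ((hasDerivAt_id (0 : ℝ)).smul_const ξ).const_add x₀
    have hx : x₀ + (0 : ℝ) • ξ = x₀ := by simp
    have hψl : HasDerivAt (fun t : ℝ => φ (chart a b (x₀ + t • ξ)))
        (A.comp (chartDeriv a b x₀) ξ) 0 :=
      HasFDerivAt.comp_hasDerivAt (0 : ℝ) (f := fun t : ℝ => x₀ + t • ξ)
        (l := fun x => φ (chart a b x)) (by rw [hx]; exact hψ) hl
    have hGl : HasDerivAt (fun t : ℝ => (x₀ + t • ξ).2 - g (x₀ + t • ξ).1) (B ξ) 0 :=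
      HasFDerivAt.comp_hasDerivAt (0 : ℝ) (f := fun t : ℝ => x₀ + t • ξ)
        (l := fun x : (ℝ × ℝ) × ℝ => x.2 - g x.1) (by rw [hx]; exact hG) hl
    have hc : ContinuousAt (fun t : ℝ => x₀ + t • ξ) 0 := hl.continuousAt
    have hev : ∀ᶠ t in 𝓝 (0 : ℝ), x₀ + t • ξ ∈ D ×ˢ J ∧ chart a b (x₀ + t • ξ) ∈ U := by
      refine (hc.eventually ((hD.prod hJ).mem_nhds ?_)).and (hc.eventually
        ((hU.preimage (contDiff_chart a b (n := 0)).continuous).mem_nhds ?_))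
      · simp only [hx]; exact ⟨hq, hgq⟩
      · simp only [hx]; exact hpU
    by_contra! hpos
    have h1 := (hasDerivAt_iff_tendsto_slope.mp hψl).eventually (lt_mem_nhds hpos)
    have h2 := (hasDerivAt_iff_tendsto_slope.mp hGl).eventually (gt_mem_nhds hξ)
    have hle : 𝓝[>] (0 : ℝ) ≤ 𝓝[≠] 0 := nhdsWithin_mono _ fun t ht => ne_of_gt ht
    obtain ⟨t, ⟨h1, h2⟩, ⟨h3, h4⟩, ht⟩ := (((h1.and h2).filter_mono hle).and
      ((hev.filter_mono nhdsWithin_le_nhds).and self_mem_nhdsWithin)).exists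
    have ht : 0 < t := ht
    have e1 : φ (chart a b x₀) = 0 := hφ0
    simp only [slope_def_field, zero_smul, add_zero, sub_zero, e1] at h1 h2
    have e2 : x₀.2 - g x₀.1 = 0 := sub_self _
    rw [e2, sub_zero, div_lt_iff₀ ht, zero_mul] at h2
    rw [lt_div_iff₀ ht, zero_mul] at h1
    exact (hUE _ h4).2 h1 ((hE _ h3.1 _ h3.2).1 (sub_neg.mp h2))
  have hBe : B (0, 1) = 1 := by
    simp [hB]
  obtain ⟨hnn, heq⟩ := eq_smul_of_forall_neg (L := (A.comp (chartDeriv a b x₀)).toLinearMap)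
    (G := B.toLinearMap) (e := ((0 : ℝ × ℝ), (1 : ℝ))) hneg hBe
  set c := (A.comp (chartDeriv a b x₀)).toLinearMap ((0 : ℝ × ℝ), (1 : ℝ)) with hc
  -- With `c = 0` the differential of `φ` in the chart would vanish, hence so would that of `φ`, the
  -- chart being a diffeomorphism.
  have hcne : c ≠ 0 := by
    intro h0
    have hz : A.comp (chartDeriv a b x₀) = 0 := by
      refine ContinuousLinearMap.ext fun v => ?_
      have := heq v
      rw [h0, zero_mul] at this
      exact this
    have hinv : HasFDerivAt (chartInv a b) (fderiv ℝ (chartInv a b) (chart a b x₀))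
        (chart a b x₀) :=
      ((contDiff_chartInv a b (n := 1)).differentiable one_ne_zero _).hasFDerivAt
    rw [hz] at hψ
    have h1 := HasFDerivAt.comp (chart a b x₀) (g := fun x => φ (chart a b x))
      (by rw [chartInv_chart hab]; exact hψ) hinv
    have h2 : (fun x => φ (chart a b x)) ∘ chartInv a b = φ :=
      funext fun x => congrArg φ (chart_chartInv hab x)
    rw [h2, ContinuousLinearMap.zero_comp] at h1
    exact hφne h1.fderiv
  have hT : a * A (frameX (chart a b x₀)) + b * A (frameY (chart a b x₀)) = c := by
    rw [hc, ContinuousLinearMap.coe_coe, ContinuousLinearMap.comp_apply,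
      chartDeriv_transversal hab, map_add, map_smul, map_smul, smul_eq_mul, smul_eq_mul]
  have hC : -b * A (frameX (chart a b x₀)) + a * A (frameY (chart a b x₀)) =
      -(c * charSlope g q) := by
    have h1 := heq ((1, -2 * x₀.2), 0)
    rw [ContinuousLinearMap.coe_coe, ContinuousLinearMap.comp_apply,
      chartDeriv_characteristic hab, map_add, map_smul, map_smul, smul_eq_mul, smul_eq_mul] at h1
    rw [h1]
    simp [hB, charSlope, hx₀]
  refine ⟨c, lt_of_le_of_ne hnn hcne.symm, ?_, ?_⟩
  · change A (frameX (chart a b x₀)) = _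
    linear_combination a * hT - b * hC - A (frameX (chart a b x₀)) * hab
  · change A (frameY (chart a b x₀)) = _
    linear_combination b * hT + a * hC - A (frameY (chart a b x₀)) * hab

/-- The characteristic vector of a subgraph, in adapted coordinates. -/
theorem IsSubgraphIn.characteristicVector_eq {a b : ℝ} (hab : a ^ 2 + b ^ 2 = 1)
    {D : Set (ℝ × ℝ)} {J : Set ℝ} (hD : IsOpen D) (hJ : IsOpen J) {E : Set Heis} {g : ℝ × ℝ → ℝ}
    (hE : IsSubgraphIn a b D J E g) (hg : ContDiff ℝ 1 g) {q : ℝ × ℝ} (hq : q ∈ D)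
    (hgq : g q ∈ J) {N : ℝ × ℝ × ℝ} (hN : IsOuterUnitNormal E (chart a b (q, g q)) N) :
    characteristicVector N (chart a b (q, g q)) =
      chartDeriv a b (q, g q) ((√(1 + charSlope g q ^ 2))⁻¹ •
        ((1, -2 * g q), charSlope g q)) := by
  obtain ⟨φ, hφ, rfl⟩ := hN
  obtain ⟨c, hc, hX, hY⟩ := hE.frameGradient_eq hab hD hJ hg hq hgq hφ
  set p := chart a b (q, g q) with hp
  set w := charSlope g q with hw
  have hsum : (frameGradient φ p).1 ^ 2 + (frameGradient φ p).2.1 ^ 2 = c ^ 2 * (1 + w ^ 2) := by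
    rw [hX, hY]
    linear_combination c ^ 2 * (1 + w ^ 2) * hab
  have hpos : 0 < (frameGradient φ p).1 ^ 2 + (frameGradient φ p).2.1 ^ 2 +
      (frameGradient φ p).2.2 ^ 2 := by
    rw [hsum]; positivity
  set k := (√((frameGradient φ p).1 ^ 2 + (frameGradient φ p).2.1 ^ 2 +
      (frameGradient φ p).2.2 ^ 2))⁻¹ with hk
  have hk0 : 0 < k := inv_pos.mpr (Real.sqrt_pos.mpr hpos)
  -- The positive factors `k` and `c` cancel in the horizontal normal, which therefore depends only
  -- on the slope `w`.
  have hs : √((k • frameGradient φ p).1 ^ 2 + (k • frameGradient φ p).2.1 ^ 2) =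
      k * c * √(1 + w ^ 2) := by
    rw [← Real.sqrt_sq (x := k * c) (by positivity), ← Real.sqrt_mul (by positivity)]
    congr 1
    simp only [Prod.smul_fst, Prod.smul_snd, smul_eq_mul]
    linear_combination k ^ 2 * hsum
  have hs0 : 0 < √(1 + w ^ 2) := Real.sqrt_pos.mpr (by positivity)
  have hν : horizontalNormal (k • frameGradient φ p) =
      ((√(1 + w ^ 2))⁻¹ * (a + b * w), (√(1 + w ^ 2))⁻¹ * (b - a * w)) := by
    rw [horizontalNormal, hs]
    simp only [Prod.smul_fst, Prod.smul_snd, smul_eq_mul, Prod.smul_mk, hX, hY, Prod.mk.injEq]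
    constructor <;> field_simp
  have hv : (((1 : ℝ), -2 * g q), w) = ((1, -2 * g q), (0 : ℝ)) + w • ((0 : ℝ × ℝ), (1 : ℝ)) := by
    simp
  have hch := chartDeriv_characteristic hab (q, g q)
  rw [characteristicVector, hν, map_smul, hv, map_add, map_smul, chartDeriv_transversal hab, hch,
    ← hp]
  simp only [smul_add, smul_smul]
  module

/-! ### Regularity of characteristic curves -/

theorem contDiffAt_one_of_hasDerivAt {V : Type*} [NormedAddCommGroup V] [NormedSpace ℝ V]
    {γ γ' : ℝ → V} {s : ℝ} (h : ∀ᶠ r in 𝓝 s, HasDerivAt γ (γ' r) r)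
    (hc : ∀ᶠ r in 𝓝 s, ContinuousAt γ' r) : ContDiffAt ℝ 1 γ s := by
  obtain ⟨u, hu, hu'⟩ := (h.and hc).exists_mem
  have := (contDiffAt_succ_iff_hasFDerivAt (𝕜 := ℝ) (n := 0) (f := γ) (x := s)).mpr
    ⟨fun r => ContinuousLinearMap.toSpanSingleton ℝ (γ' r),
      ⟨u, hu, fun r hr => (hu' r hr).1.hasFDerivAt⟩,
      contDiffAt_zero.mpr ⟨u, hu, fun r hr => ((ContinuousLinearMap.toSpanSingletonCLE (𝕜 := ℝ)
        (E := V)).continuous.continuousAt.comp (hu' r hr).2).continuousWithinAt⟩⟩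
  simpa using this

theorem contDiffAt_two_of_hasDerivAt {V : Type*} [NormedAddCommGroup V] [NormedSpace ℝ V]
    {γ γ' : ℝ → V} {s : ℝ} (h : ∀ᶠ r in 𝓝 s, HasDerivAt γ (γ' r) r)
    (hc : ContDiffAt ℝ 1 γ' s) : ContDiffAt ℝ 2 γ s := by
  obtain ⟨u, hu, hu'⟩ := h.exists_mem
  have := (contDiffAt_succ_iff_hasFDerivAt (𝕜 := ℝ) (n := 1) (f := γ) (x := s)).mpr
    ⟨fun r => ContinuousLinearMap.toSpanSingleton ℝ (γ' r),
      ⟨u, hu, fun r hr => (hu' r hr).hasFDerivAt⟩,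
      (ContinuousLinearMap.toSpanSingletonCLE (𝕜 := ℝ) (E := V)).contDiff.contDiffAt.comp s hc⟩
  exact this

/-- A weak solution of `m' = -φ` along a continuous curve, given on a closed interval. -/
theorem hasDerivAt_of_weak_on {c d : ℝ} (hcd : c < d) {m φ : ℝ → ℝ}
    (hm : ContinuousOn m (Icc c d)) (hφ : ContinuousOn φ (Icc c d))
    (hweak : ∀ η : ℝ → ℝ, ContDiff ℝ ∞ η → tsupport η ⊆ Ioo c d →
      ∫ z, m z * deriv η z = ∫ z, φ z * η z) {z : ℝ} (hz : z ∈ Ioo c d) :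
    HasDerivAt m (-φ z) z := by
  have hext : ∀ f : ℝ → ℝ, ∀ y ∈ Icc c d, IccExtend hcd.le ((Icc c d).domRestrict f) y = f y :=
    fun f y hy => IccExtend_of_mem hcd.le _ hy
  have hcont : ∀ f : ℝ → ℝ, ContinuousOn f (Icc c d) →
      Continuous (IccExtend hcd.le ((Icc c d).domRestrict f)) := fun f hf =>
    (continuousOn_iff_continuous_domRestrict.mp hf).Icc_extend'
  have key := hasDerivAt_of_weak hcd (hcont m hm) (hcont φ hφ) (fun η hη hs => ?_) hz
  · rw [hext φ z (Ioo_subset_Icc_self hz)] at key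
    refine key.congr_of_eventuallyEq ?_
    filter_upwards [isOpen_Ioo.mem_nhds hz] with y hy
    exact (hext m y (Ioo_subset_Icc_self hy)).symm
  · have hmul : ∀ f k : ℝ → ℝ, tsupport k ⊆ Ioo c d →
        (fun y => IccExtend hcd.le ((Icc c d).domRestrict f) y * k y) = fun y => f y * k y :=
      fun f k hk => funext fun y => by
        by_cases hy : y ∈ Icc c d
        · rw [hext f y hy]
        · rw [image_eq_zero_of_notMem_tsupport fun h => hy (Ioo_subset_Icc_self (hk h)),
            mul_zero, mul_zero]
    rw [hmul m _ ((tsupport_deriv_subset).trans hs), hmul φ _ hs]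
    exact hweak η hη hs

/-- If `g` solves the weak equation, then its slope is of class `C¹` along the characteristic
curves. -/
theorem contDiffAt_charSlope_comp {D : Set (ℝ × ℝ)} (hD : IsOpen D) {g φ : ℝ × ℝ → ℝ}
    (hg : ContDiff ℝ 1 g) {L : NNReal} (hgL : LipschitzWith L g) (hφ : Continuous φ)
    {h : ℝ → ℝ} (hh : ContDiff ℝ 1 h) (hh' : ∀ w, deriv h w ≠ 0)
    (hweak : ∀ v : ℝ × ℝ → ℝ, ContDiff ℝ ∞ v → HasCompactSupport v → tsupport v ⊆ D →
      ∫ q, h (charSlope g q) * charSlopeVariation g v q = ∫ q, φ q * v q)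
    {z τ α : ℝ → ℝ} {s₀ : ℝ} (hα : ∀ s, 0 < α s) (hαc : ∀ᶠ s in 𝓝 s₀, ContinuousAt α s)
    (hz : ∀ᶠ s in 𝓝 s₀, HasDerivAt z (α s) s)
    (hτ : ∀ᶠ s in 𝓝 s₀, HasDerivAt τ (α s * (-2 * g (z s, τ s))) s)
    (hzD : (z s₀, τ s₀) ∈ D) :
    ContDiffAt ℝ 1 (fun s => charSlope g (z s, τ s)) s₀ := by
  have hgc := hg.continuous
  have hwc := continuous_charSlope hg
  have hz1 : ContDiffAt ℝ 1 z s₀ := contDiffAt_one_of_hasDerivAt hz hαc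
  -- As `z' = α > 0`, the curve can be parametrised by `z`; `τ ∘ σ` then solves the characteristic
  -- equation in its normal form.
  obtain ⟨σ, hσ0, hσ, hzσ, hσz⟩ := exists_contDiffAt_localInverse hz1
    (by rw [hz.self_of_nhds.deriv]; exact (hα s₀).ne')
  have hσt : Tendsto σ (𝓝 (z s₀)) (𝓝 s₀) := by
    have := hσ.continuousAt.tendsto
    rwa [hσ0] at this
  have hσd : ∀ᶠ y in 𝓝 (z s₀), DifferentiableAt ℝ σ y := by
    filter_upwards [hσ.eventually (by simp)] with y hy
    exact hy.differentiableAt one_ne_zero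
  have hτσ : ∀ᶠ y in 𝓝 (z s₀), HasDerivAt (fun y => τ (σ y)) (-2 * g (y, τ (σ y))) y := by
    filter_upwards [hσd, hσt.eventually hz, hσt.eventually hτ, hzσ, hzσ.eventually_nhds]
      with y h1 h2 h3 h4 h5
    have h6 : HasDerivAt (fun y => z (σ y)) (α (σ y) * deriv σ y) y :=
      HasDerivAt.comp y h2 h1.hasDerivAt
    have h7 : α (σ y) * deriv σ y = 1 :=
      h6.unique ((hasDerivAt_id y).congr_of_eventuallyEq h5)
    have h8 : HasDerivAt (fun y => τ (σ y)) _ y := HasDerivAt.comp y h3 h1.hasDerivAt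
    rw [h4] at h8
    convert! h8 using 1
    linear_combination (2 * g (y, τ (σ y))) * h7
  have hDτ : ∀ᶠ y in 𝓝 (z s₀), (y, τ (σ y)) ∈ D := by
    have hc : ContinuousAt (fun y => (y, τ (σ y))) (z s₀) :=
      continuousAt_id.prodMk hτσ.self_of_nhds.continuousAt
    exact hc.eventually (hD.mem_nhds (by simp only [hσ0]; exact hzD))
  obtain ⟨ε, hε, hev⟩ := Metric.nhds_basis_closedBall.eventually_iff.mp (hτσ.and hDτ)
  rw [Real.closedBall_eq_Icc] at hev
  have hcd : z s₀ - ε < z s₀ + ε := by linarith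
  have hcurve : ContinuousOn (fun y => (y, τ (σ y))) (Icc (z s₀ - ε) (z s₀ + ε)) :=
    continuousOn_id.prodMk fun y hy => (hev hy).1.continuousAt.continuousWithinAt
  have hm : ∀ y ∈ Ioo (z s₀ - ε) (z s₀ + ε),
      HasDerivAt (fun y => h (charSlope g (y, τ (σ y)))) (-φ (y, τ (σ y))) y := fun y hy =>
    hasDerivAt_of_weak_on hcd (φ := fun y => φ (y, τ (σ y)))
      ((hh.continuous.comp hwc).comp_continuousOn hcurve)
      (hφ.comp_continuousOn hcurve)
      (fun η hη hs => integral_characteristic hD hg hgL (hh.continuous.comp hwc) hφ hweak hcd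
        (fun y hy => (hev hy).1) (fun y hy => (hev hy).2) hη hs) hy
  have hnh : Ioo (z s₀ - ε) (z s₀ + ε) ∈ 𝓝 (z s₀) := Ioo_mem_nhds (by linarith) (by linarith)
  have hcat : ∀ y ∈ Ioo (z s₀ - ε) (z s₀ + ε), ContinuousAt (fun y => (y, τ (σ y))) y :=
    fun y hy => hcurve.continuousAt (Icc_mem_nhds hy.1 hy.2)
  have hm1 : ContDiffAt ℝ 1 (fun y => h (charSlope g (y, τ (σ y)))) (z s₀) := by
    refine contDiffAt_one_of_hasDerivAt (γ' := fun y => -φ (y, τ (σ y))) ?_ ?_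
    · filter_upwards [hnh] with y hy using hm y hy
    · filter_upwards [hnh] with y hy
      exact (hφ.continuousAt.comp (hcat y hy)).neg
  -- So far `h ∘ w` is C¹ along the curve; the local inverse of `h` recovers `w`, whose continuity
  -- keeps it where the inverse is valid.
  obtain ⟨κ, -, hκ, -, hκh⟩ := exists_contDiffAt_localInverse
    (hh.contDiffAt (x := charSlope g (z s₀, τ (σ (z s₀))))) (hh' _)
  have hwcat : ContinuousAt (fun y => charSlope g (y, τ (σ y))) (z s₀) :=
    hwc.continuousAt.comp (hcat _ (mem_of_mem_nhds hnh))
  have hw1 : ContDiffAt ℝ 1 (fun y => charSlope g (y, τ (σ y))) (z s₀) := by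
    refine (hκ.comp (z s₀) hm1).congr_of_eventuallyEq ?_
    filter_upwards [hwcat.eventually hκh] with y hy
    exact hy.symm
  refine (hw1.comp s₀ hz1).congr_of_eventuallyEq ?_
  filter_upwards [hσz] with s hs
  simp only [Function.comp_apply, hs]

/-- Curves on a graph with velocity proportional to `(1, -2g, w)` are of class `C²`. -/
theorem contDiffAt_two_of_characteristic {D : Set (ℝ × ℝ)} (hD : IsOpen D) {g φ : ℝ × ℝ → ℝ}
    (hg : ContDiff ℝ 1 g) {L : NNReal} (hgL : LipschitzWith L g) (hφ : Continuous φ)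
    {h : ℝ → ℝ} (hh : ContDiff ℝ 1 h) (hh' : ∀ w, deriv h w ≠ 0)
    (hweak : ∀ v : ℝ × ℝ → ℝ, ContDiff ℝ ∞ v → HasCompactSupport v → tsupport v ⊆ D →
      ∫ q, h (charSlope g q) * charSlopeVariation g v q = ∫ q, φ q * v q)
    {γ : ℝ → (ℝ × ℝ) × ℝ} {s₀ : ℝ}
    (hγ : ∀ᶠ s in 𝓝 s₀, HasDerivAt γ ((√(1 + charSlope g (γ s).1 ^ 2))⁻¹ •
      ((1, -2 * g (γ s).1), charSlope g (γ s).1)) s)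
    (hγD : (γ s₀).1 ∈ D) : ContDiffAt ℝ 2 γ s₀ := by
  have hwc := continuous_charSlope hg
  have hpos : ∀ w : ℝ, 0 < √(1 + w ^ 2) := fun w => Real.sqrt_pos.mpr (by positivity)
  set α : ℝ → ℝ := fun s => (√(1 + charSlope g (γ s).1 ^ 2))⁻¹ with hα
  have hαc : ∀ᶠ s in 𝓝 s₀, ContinuousAt α s := by
    filter_upwards [hγ] with s hs
    have h1 : ContinuousAt (fun s => charSlope g (γ s).1) s :=
      hwc.continuousAt.comp (continuousAt_fst.comp hs.continuousAt)
    exact ((continuousAt_const.add (h1.pow 2)).sqrt).inv₀ (hpos _).ne'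
  have hq : ∀ᶠ s in 𝓝 s₀, HasDerivAt (fun s => (γ s).1) (α s • ((1 : ℝ), -2 * g (γ s).1)) s := by
    filter_upwards [hγ] with s hs
    exact (hasFDerivAt_fst (𝕜 := ℝ) (p := γ s)).comp_hasDerivAt s hs
  -- This is the gain of regularity: with `w` of class C¹ along the curve, every component of the
  -- velocity becomes C¹.
  have hw : ContDiffAt ℝ 1 (fun s => charSlope g (γ s).1) s₀ := by
    refine contDiffAt_charSlope_comp hD hg hgL hφ hh hh' hweak (z := fun s => (γ s).1.1)
      (τ := fun s => (γ s).1.2) (α := α) (fun s => inv_pos.mpr (hpos _)) hαc ?_ ?_ hγD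
    · filter_upwards [hq] with s hs
      simpa using hasDerivAt_fst_comp hs
    · filter_upwards [hq] with s hs
      exact hasDerivAt_snd_comp hs
  have hα1 : ContDiffAt ℝ 1 α s₀ := by
    have h1 : ContDiffAt ℝ 1 (fun s => 1 + charSlope g (γ s).1 ^ 2) s₀ :=
      contDiffAt_const.add (hw.pow 2)
    exact (h1.sqrt (by positivity)).inv (hpos _).ne'
  have hq1 : ContDiffAt ℝ 1 (fun s => (γ s).1) s₀ := by
    refine contDiffAt_one_of_hasDerivAt hq ?_
    filter_upwards [hαc, hq] with s h1 h2
    exact h1.smul (continuousAt_const.prodMk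
      (continuousAt_const.mul (hg.continuous.continuousAt.comp h2.continuousAt)))
  exact contDiffAt_two_of_hasDerivAt hγ (hα1.smul ((contDiffAt_const.prodMk
    (contDiffAt_const.mul (hg.contDiffAt.comp s₀ hq1))).prodMk hw))

theorem hasDerivAt_chartInv_comp {a b : ℝ} (hab : a ^ 2 + b ^ 2 = 1) {Γ : ℝ → Heis} {s : ℝ}
    {x ξ : (ℝ × ℝ) × ℝ} (hx : chart a b x = Γ s) (h : HasDerivAt Γ (chartDeriv a b x ξ) s) :
    HasDerivAt (fun r => chartInv a b (Γ r)) ξ s := by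
  have hinv : HasFDerivAt (chartInv a b) (fderiv ℝ (chartInv a b) (chart a b x)) (chart a b x) :=
    ((contDiff_chartInv a b (n := 1)).differentiable one_ne_zero _).hasFDerivAt
  have h1 := hinv.comp x (hasFDerivAt_chart a b x)
  have h2 : chartInv a b ∘ chart a b = id := funext fun x => chartInv_chart hab x
  rw [h2] at h1
  have h3 := h1.unique (hasFDerivAt_id x)
  rw [hx] at hinv h3
  have h4 := hinv.comp_hasDerivAt s h
  rw [← ContinuousLinearMap.comp_apply, h3] at h4
  exact h4

theorem exists_continuous_extension {X : Type*} [TopologicalSpace X] [NormalSpace X] {S : Set X}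
    (hS : IsClosed S) {f : X → ℝ} (hf : ContinuousOn f S) :
    ∃ F : X → ℝ, Continuous F ∧ EqOn F f S := by
  obtain ⟨F, hF⟩ := ContinuousMap.exists_restrict_eq hS
    ⟨S.domRestrict f, continuousOn_iff_continuous_domRestrict.mp hf⟩
  exact ⟨F, F.continuous, fun x hx => congrArg (fun k : C(S, ℝ) => k ⟨x, hx⟩) hF⟩

theorem closure_cylinder_subset {a b : ℝ} {D : Set (ℝ × ℝ)} {J : Set ℝ} {C : Set (ℝ × ℝ)}
    {I : Set ℝ} (hC : IsClosed C) (hI : IsClosed I) (hDC : D ⊆ C) (hJI : J ⊆ I) :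
    closure (cylinder a b D J) ⊆ cylinder a b C I :=
  closure_minimal (preimage_mono (prod_mono hDC hJI))
    ((hC.prod hI).preimage (contDiff_chartInv a b (n := 0)).continuous)

theorem IsCharacteristicCurve.contDiffAt {K : Set (ℝ × ℝ)} (hK : IsConvexC2Plus K)
    (hK0 : (0 : ℝ × ℝ) ∈ interior K) {Ω : Set Heis} (hΩ : IsOpen Ω) {E : Set Heis}
    {f : Heis → ℝ} (hf : ContinuousOn f Ω) (hcurv : HasPrescribedMeanCurvature K Ω E f)
    {I : Set ℝ} (hI : IsOpen I) {Γ : ℝ → Heis} (hΓ : IsCharacteristicCurve Ω E I Γ) {s₀ : ℝ}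
    (hs₀ : s₀ ∈ I) : ContDiffAt ℝ 2 Γ s₀ := by
  -- The outer unit normal at `Γ s₀` carries a C¹ defining function there.
  obtain ⟨hp, N, ⟨φ, hφ, -⟩, -⟩ := hΓ s₀ hs₀
  obtain ⟨a, b, hab, hpos⟩ := exists_transversal_direction hp hφ
  obtain ⟨r, δ, g, L, hr, hδ, hg, hgL, hgδ, hsub, hΩc⟩ :=
    exists_isSubgraphIn hΩ hp.1.2 hφ hab hpos
  set x₀ := chartInv a b (Γ s₀) with hx₀
  set D := Metric.ball x₀.1 r with hDdef
  set J := Ioo (x₀.2 - δ) (x₀.2 + δ) with hJdef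
  have hD : IsOpen D := Metric.isOpen_ball
  have hcl : closure (cylinder a b D J) ⊆ Ω := fun p hp => by
    have := closure_cylinder_subset Metric.isClosed_closedBall isClosed_Icc
      Metric.ball_subset_closedBall Ioo_subset_Icc_self hp
    rw [← chart_chartInv hab p]
    exact hΩc _ this.1 _ this.2
  -- Tietze extension of `f` in the chart, from a closed box contained in `Ω`.
  obtain ⟨F, hF, hFf⟩ := exists_continuous_extension
    (S := Metric.closedBall x₀.1 r ×ˢ Icc (x₀.2 - δ) (x₀.2 + δ)) (f := fun x => f (chart a b x))
    (Metric.isClosed_closedBall.prod isClosed_Icc)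
    (hf.comp (contDiff_chart a b (n := 0)).continuous.continuousOn
      fun x hx => hΩc x.1 hx.1 x.2 hx.2)
  obtain ⟨-, hH', hH''⟩ := slopeSupport_regularity hK hK0 hab
  have hweak : ∀ v : ℝ × ℝ → ℝ, ContDiff ℝ ∞ v → HasCompactSupport v → tsupport v ⊆ D →
      ∫ q, deriv (slopeSupport K a b) (charSlope g q) * charSlopeVariation g v q =
        ∫ q, F (q, g q) * v q := fun v hv hvc hvs =>
    weak_equation hK hK0 hcurv hab hD Metric.isBounded_ball hδ hcl hg hgδ hsub hF
      (fun q hq u hu => hFf ⟨Metric.ball_subset_closedBall hq, Ioo_subset_Icc_self hu⟩) hv hvc hvs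
  have hx₀D : x₀.1 ∈ D := Metric.mem_ball_self hr
  have hx₀J : x₀.2 ∈ J := ⟨by linarith, by linarith⟩
  have hΓc : ∀ s ∈ I, ContinuousAt Γ s := fun s hs => by
    obtain ⟨-, N, -, h⟩ := hΓ s hs
    exact h.continuousAt
  have hγ : ∀ᶠ s in 𝓝 s₀, HasDerivAt (fun s => chartInv a b (Γ s))
      ((√(1 + charSlope g (chartInv a b (Γ s)).1 ^ 2))⁻¹ •
        ((1, -2 * g (chartInv a b (Γ s)).1), charSlope g (chartInv a b (Γ s)).1)) s := by
    -- For `s` near `s₀` the point `Γ s` is a frontier point in the cylinder, hence on the graph,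
    -- and its velocity is the one computed for subgraphs.
    filter_upwards [hI.mem_nhds hs₀, (hΓc s₀ hs₀).eventually
      ((isOpen_cylinder a b hD isOpen_Ioo).mem_nhds ⟨hx₀D, hx₀J⟩)] with s hs hsc
    obtain ⟨hps, N, hN, hd⟩ := hΓ s hs
    have hgr := hsub.eq_of_mem_frontier hab hD isOpen_Ioo hg.continuous hps.1.1 hsc
    have hch : chart a b ((chartInv a b (Γ s)).1, g (chartInv a b (Γ s)).1) = Γ s := by
      rw [← hgr, Prod.mk.eta, chart_chartInv hab]
    have hgJ : g (chartInv a b (Γ s)).1 ∈ J := hgr ▸ hsc.2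
    rw [← hch] at hN
    have hZ := hsub.characteristicVector_eq hab hD isOpen_Ioo hg hsc.1 hgJ hN
    rw [hch] at hZ
    rw [hZ] at hd
    exact hasDerivAt_chartInv_comp hab hch hd
  have h2 := contDiffAt_two_of_characteristic hD hg hgL
    (hF.comp (continuous_id.prodMk hg.continuous)) hH' hH'' hweak hγ hx₀D
  have h3 := (contDiff_chart a b (n := 2)).contDiffAt.comp s₀ h2
  refine h3.congr_of_eventuallyEq (Eventually.of_forall fun s => ?_)
  exact (chart_chartInv hab (Γ s)).symm

end SubFinsler

open SubFinsler
theorem mainTheorem2 (K : Set (ℝ × ℝ)) (hK : IsConvexC2Plus K) (hK0 : (0 : ℝ × ℝ) ∈ interior K)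
    (Ω : Set Heis) (hΩ : IsOpen Ω) (E : Set Heis) (hE : E ⊆ Ω)
    (f : Heis → ℝ) (hf : ContinuousOn f Ω)
    (hcurv : HasPrescribedMeanCurvature K Ω E f) (hS : HasC1Boundary Ω E)
    (I : Set ℝ) (hI : IsOpen I) (hIc : I.OrdConnected)
    (Γ : ℝ → Heis) (hΓ : IsCharacteristicCurve Ω E I Γ) :
    ContDiffOn ℝ 2 Γ I :=
  fun _ hs => (hΓ.contDiffAt hK hK0 hΩ hf hcurv hI hs).contDiffWithinAt
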